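/- **Proposition 3.3.** Fix an energy $\lambda>0$. A *warping function* is a function $f=e^{-x}+V>0$ on $[0,\infty)$ with $V\in C^1([0,\infty))$ compactly supported in $[0,\infty)$, $V'\in W^{1,\infty}(\mathbb R_+)$ and $e^xV>-1+d$ for some constant $d>0$. With an integer $n\ge 2$ and a compact Riemannian manifold $(K,g_K)$ of dimension $n-1$, it defines the warped ball $[0,\infty)\times K$ with the metric $f(x)^2(dx^2+g_K)$. Set $q_0(x)=-\lambda e^{-2x}$, $$Q_f=\frac{(f^{\frac n2-1})''}{f^{\frac n2-1}}-\frac{(n-2)^2}{4}-\lambda\,(f-e^{-x})(f+e^{-x}),\qquad q=q_0+Q_f .$$ *Regge poles.* For $\operatorname{Re} z>0$ the Weyl–Titchmarsh function is $M(-z^2)=v'(0)/v(0)$, where $v\neq 0$ is the solution, unique up to a constant factor, of $-v''+qv=-z^2v$ on $[0,\infty)$ that is square-integrable. The Regge poles of the warped ball are the poles, counted with multiplicity, of the meromorphic extension to $z\in\mathbb C$ of $z\mapsto M(-z^2)$. *Modified Jost function.* Let $J_z$ be the Bessel function of order $z$. Let $K_f$ be the unique continuous function on $\{0\le x\le t\}$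 such that, for some $a>0$, $K_f(x,t)=0$ whenever $x+t\ge 2a$, and which satisfies $$K_f(x,t)=\frac12\int_{\frac{t+x}2}^\infty Q_f(s)\,ds+\int_{\frac{t+x}2}^\infty\int_0^{\frac{t-x}2}\bigl(q(\alpha-\beta)-q_0(\alpha+\beta)\bigr)K_f(\alpha-\beta,\alpha+\beta)\,d\beta\,d\alpha .$$ The modified Jost function is $$\psi_f(0,z)=J_z(\sqrt\lambda)+\int_0^\infty K_f(0,s)\,J_z(\sqrt\lambda\,e^{-s})\,ds,\qquad z\in\mathbb C .$$ Let two warped balls be given, with warping functions $f_1,f_2$ and dimensions $n_1,n_2\ge 2$, at the same energy $\lambda$. If they have the same Regge poles, counted with multiplicity, then $\psi_{f_1}(0,z)=\psi_{f_2}(0,z)$ for all $z\in\mathbb C$. -/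

import Mathlib

open MeasureTheory Set

noncomputable section

namespace ReggePoles

/-- The perturbation `V(x) = f(x) - e^{-x}` of the warping function of the Euclidean ball.
Only the values for `x ≥ 0` are ever used. -/
def perturbation (f : ℝ → ℝ) (x : ℝ) : ℝ := f x - Real.exp (-x)

/-- Admissible warping functions: `f = e^{-x} + V > 0` on `[0, ∞)`, where `V` has compact support
in `[0, ∞)`, `e^x V > -1 + d` for some `d > 0`, `V` is `C¹` up to the boundary point `0`, and
`V' ∈ W^{1,∞}`. Since `V'` is continuous with compact support, the last condition says
that `V'` is Lipschitz. The function `f` is considered on `[0, ∞)` only; its values at negative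
arguments are irrelevant.

The warped ball defined by `f` and by a compact Riemannian manifold `(K, g_K)` of dimension
`n - 1` is `[0, ∞) × K` with the metric `f(x)² (dx² + g_K)`. Its associated Schrödinger operator
depends on `f` and `n` only. -/
structure IsWarpingFunction (f : ℝ → ℝ) : Prop where
  pos : ∀ x : ℝ, 0 ≤ x → 0 < f x
  compact_support : ∃ a : ℝ, 0 ≤ a ∧ ∀ x : ℝ, a ≤ x → perturbation f x = 0
  lower_bound : ∃ d : ℝ, 0 < d ∧ ∀ x : ℝ, 0 ≤ x → -1 + d < Real.exp x * perturbation f x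
  contDiffOn : ContDiffOn ℝ 1 (perturbation f) (Ici 0)
  lipschitz_deriv : ∃ C : NNReal,
    LipschitzOnWith C (derivWithin (perturbation f) (Ici 0)) (Ici 0)

/-- The potential `q_f = (f^{n/2-1})'' / f^{n/2-1}`. The second derivative exists almost
everywhere on `(0, ∞)` and agrees with the weak one. -/
def conformalPotential (n : ℕ) (f : ℝ → ℝ) (x : ℝ) : ℝ :=
  deriv (deriv fun y : ℝ => f y ^ ((n : ℝ) / 2 - 1)) x / f x ^ ((n : ℝ) / 2 - 1)

/-- The compactly supported bounded potential
`Q_f = q_f - (n-2)²/4 - lam (f - e^{-x}) (f + e^{-x})`. -/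
def warpedPotential (n : ℕ) (lam : ℝ) (f : ℝ → ℝ) (x : ℝ) : ℝ :=
  conformalPotential n f x - ((n : ℝ) - 2) ^ 2 / 4
    - lam * (f x - Real.exp (-x)) * (f x + Real.exp (-x))

/-- The reference potential `q₀(x) = -lam e^{-2x}`. -/
def referencePotential (lam x : ℝ) : ℝ := -lam * Real.exp (-2 * x)

/-! ### The Weyl-Titchmarsh function and the Regge poles -/

/-- `v` is a solution of `-v'' + (Q - lam e^{-2x}) v = -z² v` on `[0, ∞)` which is
square-integrable, and `v'` is its derivative: both functions are locally absolutely continuous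
and the equation holds almost everywhere (in integrated form). -/
structure IsWeylSolution (lam : ℝ) (Q : ℝ → ℝ) (z : ℂ) (v v' : ℝ → ℂ) : Prop where
  continuousOn : ContinuousOn v (Ici 0)
  continuousOn_deriv : ContinuousOn v' (Ici 0)
  eq_integral_deriv : ∀ x : ℝ, 0 ≤ x → v x = v 0 + ∫ s in (0 : ℝ)..x, v' s
  equation : ∀ x : ℝ, 0 ≤ x →
    v' x = v' 0 + ∫ s in (0 : ℝ)..x, (((Q s + referencePotential lam s : ℝ) : ℂ) + z ^ 2) * v s
  memLp : MemLp v 2 (volume.restrict (Ioi 0))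

/-- `w` is the value `M(-z²) = v'(0) / v(0)` of the Weyl-Titchmarsh function of
`H = -d²/dx² + Q - lam e^{-2x}` with Dirichlet condition at `0`; here `v` is the solution
(unique up to a constant factor when `Re z > 0`) which is `L²` at infinity. -/
def IsWeylTitchmarshValue (lam : ℝ) (Q : ℝ → ℝ) (z w : ℂ) : Prop :=
  ∃ v v' : ℝ → ℂ, IsWeylSolution lam Q z v v' ∧ v 0 ≠ 0 ∧ w = v' 0 / v 0

/-- `m` is a meromorphic extension to `ℂ` of the function `z ↦ M(-z²)`, `Re z > 0`. -/
def IsMeromorphicExtension (lam : ℝ) (Q : ℝ → ℝ) (m : ℂ → ℂ) : Prop :=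
  MeromorphicOn m univ ∧
    ∀ z : ℂ, 0 < z.re → ∀ w : ℂ, IsWeylTitchmarshValue lam Q z w → m z = w

/-- `z` is a Regge pole of multiplicity `k ≥ 1`: the meromorphic extension of the
Weyl-Titchmarsh function has a pole of order `k` at `z`. -/
def IsReggePole (lam : ℝ) (Q : ℝ → ℝ) (z : ℂ) (k : ℕ) : Prop :=
  1 ≤ k ∧ ∃ m : ℂ → ℂ, IsMeromorphicExtension lam Q m ∧
    meromorphicOrderAt m z = ((-(k : ℤ) : ℤ) : WithTop ℤ)

/-! ### The modified Jost function -/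

/-- The Bessel function `J_z(t)` of complex order `z`, for `t > 0`. (The reciprocal of
Mathlib's `Complex.Gamma` is `0` at the poles of the Gamma function, as it should be.) -/
def besselJ (z : ℂ) (t : ℝ) : ℂ :=
  ∑' m : ℕ, (-1) ^ m / ((m.factorial : ℂ) * Complex.Gamma (z + m + 1))
    * ((t / 2 : ℝ) : ℂ) ^ (z + 2 * m)

/-- The map whose fixed point is the kernel of the transformation operator:
`½ ∫_{(t+x)/2}^∞ Q(s) ds
  + ∫_{(t+x)/2}^∞ ∫_0^{(t-x)/2} (q(α-β) - q₀(α+β)) L(α-β, α+β) dβ dα`, with `q = q₀ + Q`. -/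
def kernelMap (lam : ℝ) (Q : ℝ → ℝ) (L : ℝ → ℝ → ℝ) (x t : ℝ) : ℝ :=
  (1 / 2) * (∫ s in Ioi ((t + x) / 2), Q s)
    + ∫ α in Ioi ((t + x) / 2), ∫ β in (0 : ℝ)..((t - x) / 2),
        ((referencePotential lam (α - β) + Q (α - β)) - referencePotential lam (α + β))
          * L (α - β) (α + β)

/-- `K` is, on `{0 ≤ x ≤ t}`, a continuous fixed point of `kernelMap` vanishing for
`x + t ≥ 2a`, for some `a > 0`. For bounded measurable `Q` of compact support there is exactly one
such function on `{0 ≤ x ≤ t}`. -/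
structure IsTransformationKernel (lam : ℝ) (Q : ℝ → ℝ) (K : ℝ → ℝ → ℝ) : Prop where
  continuousOn : ContinuousOn (fun p : ℝ × ℝ => K p.1 p.2) {p : ℝ × ℝ | 0 ≤ p.1 ∧ p.1 ≤ p.2}
  support : ∃ a : ℝ, 0 < a ∧ ∀ x t : ℝ, 0 ≤ x → x ≤ t → 2 * a ≤ x + t → K x t = 0
  fixed_point : ∀ x t : ℝ, 0 ≤ x → x ≤ t → K x t = kernelMap lam Q K x t

/-- The kernel of the transformation operator, i.e. the function characterized by
`IsTransformationKernel`. Only its values for `0 ≤ x ≤ t` are used. -/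
def transformationKernel (lam : ℝ) (Q : ℝ → ℝ) : ℝ → ℝ → ℝ :=
  Classical.epsilon (IsTransformationKernel lam Q)

/-- The modified Jost solution
`ψ(x, z) = J_z(√lam e^{-x}) + ∫_x^∞ K(x, s) J_z(√lam e^{-s}) ds`, for `x ≥ 0`. -/
def modifiedJostSolution (lam : ℝ) (Q : ℝ → ℝ) (x : ℝ) (z : ℂ) : ℂ :=
  besselJ z (Real.sqrt lam * Real.exp (-x))
    + ∫ s in Ioi x, (transformationKernel lam Q x s : ℂ)
        * besselJ z (Real.sqrt lam * Real.exp (-s))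

/-- The modified Jost function `z ↦ ψ(0, z)`. -/
def modifiedJostFunction (lam : ℝ) (Q : ℝ → ℝ) (z : ℂ) : ℂ :=
  modifiedJostSolution lam Q 0 z

end ReggePoles

end

noncomputable section

namespace ReggePoles

open Filter Topology Metric Real

/-! ### Entire functions of order at most 3/2 with the same zeros -/

section EntireFunctions

/-! The modified Jost function is an entire function of $z$ whose zeros are the Regge poles. Its
growth and its behaviour at $+\infty$ leave no freedom once the zeros are given.

Zeros and poles: the kernel $K_f$ carries the Bessel function $J_z(\sqrt\lambda e^{-x})$, which
solves the equation with potential $q_0$, to a solution $\psi(x,z)$ of the equation with potential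
$q$ (`transform_equation`, `isHalfLineSolution_jostSolution`). Since $Q_f$ is only bounded, $K_f$ is
never differentiated. The fixed-point equation presents it as a superposition of indicators of
characteristic triangles, so that the transform of a function becomes a superposition of differences
of its primitive, to which the fundamental theorem of calculus applies. Beyond the support, $\psi$
equals the Bessel function; for $\operatorname{Re} z>0$ it decays exponentially and is the Weyl
solution. Hence $M(-z^2)=\psi'(0,z)/\psi(0,z)$, a quotient of entire functions. They have no common
zero, because vanishing Cauchy data would force $\psi(\cdot,z)=0$. So poles and zeros agree with
multiplicity (`isReggePole_iff`).

Rigidity: the Weierstrass product of $1/\Gamma$ bounds $\psi(0,z)$ by $\exp(C(1+|z|)^{3/2})$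
(`hasGrowth_jostSolution`). Two such functions with the same zeros have quotient $e^h$ with $h$
entire. Jensen's formula and the Poisson integral give $\operatorname{Re} h\le C(1+|z|)^{3/2}$; as
$3/2<2$, $h$ is affine. Along the positive reals $\Gamma(x+1)(\sqrt\lambda/2)^{-x}\psi(0,x)\to1$ for
every potential (`tendsto_Gamma_mul_jostSolution`), so the quotient tends to $1$ and an exponential
of an affine function with this limit is identically $1$ (`eq_of_same_zeros`). -/

/-- `f` grows at most like `exp (C |z|^{3/2})`. -/
def HasGrowth (f : ℂ → ℂ) : Prop :=
  ∃ C : ℝ, 0 ≤ C ∧ ∀ z, ‖f z‖ ≤ Real.exp (C * (1 + ‖z‖) ^ (3 / 2 : ℝ))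

/-- Growth bounds $\log|f|$ only from above. Jensen's formula supplies the lower bound on average:
for $R\ge1$ the zeros contribute nonnegatively, which leaves the constant coming from the trailing
coefficient at $0$. -/
lemma HasGrowth.circleAverage_abs_log_le {f : ℂ → ℂ} (hf : Differentiable ℂ f)
    (hg : HasGrowth f) :
    ∃ C : ℝ, 0 ≤ C ∧ ∀ R : ℝ, 1 ≤ R →
      circleAverage (fun z => |Real.log ‖f z‖|) 0 R ≤ C * (1 + R) ^ (3 / 2 : ℝ) := by
  obtain ⟨C, hC, hb⟩ := hg
  set c : ℝ := |Real.log ‖meromorphicTrailingCoeffAt f 0‖| with hc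
  refine ⟨2 * C + c, by positivity, fun R hR => ?_⟩
  have han : AnalyticOnNhd ℂ f (closedBall 0 |R|) := fun z _ => hf.analyticAt z
  have hJ := han.meromorphicOn.circleAverage_log_norm (by linarith : R ≠ 0)
  have hint : CircleIntegrable (fun z => Real.log ‖f z‖) 0 R :=
    (han.mono sphere_subset_closedBall).meromorphicOn.circleIntegrable_log_norm
  have hpow : 1 ≤ (1 + R) ^ (3 / 2 : ℝ) := Real.one_le_rpow (by linarith) (by norm_num)
  have hdiv : 0 ≤ MeromorphicOn.divisor f (closedBall 0 |R|) :=
    MeromorphicOn.AnalyticOnNhd.divisor_nonneg han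
  have hlow : -c ≤ circleAverage (fun z => Real.log ‖f z‖) 0 R := by
    rw [hJ]
    have h1 : 0 ≤ ∑ᶠ u, (MeromorphicOn.divisor f (closedBall 0 |R|) u : ℝ)
        * Real.log (R * ‖(0 : ℂ) - u‖⁻¹) := by
      refine finsum_nonneg fun u => ?_
      by_cases hu : u ∈ closedBall (0 : ℂ) |R|
      · refine mul_nonneg (by exact_mod_cast hdiv u) ?_
        rcases eq_or_ne u 0 with rfl | hu0
        · simp
        · refine Real.log_nonneg ?_
          have : 0 < ‖(0 : ℂ) - u‖ := by simpa using hu0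
          rw [← div_eq_mul_inv, one_le_div this]
          have := mem_closedBall_zero_iff.1 hu
          rw [abs_of_nonneg (by linarith)] at this
          simpa using this
      · simp [hu]
    have h2 : 0 ≤ (MeromorphicOn.divisor f (closedBall 0 |R|) 0 : ℝ) * Real.log R :=
      mul_nonneg (by exact_mod_cast hdiv 0) (Real.log_nonneg hR)
    have := neg_abs_le (Real.log ‖meromorphicTrailingCoeffAt f 0‖)
    linarith
  -- If $L\le M$ and $M\ge0$, then $|L|\le 2M-L$; this trades the absolute value for the average of
  -- $L$, already bounded below.
  have hle : circleAverage (fun z => |Real.log ‖f z‖|) 0 R ≤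
      circleAverage (fun z => (2 * C * (1 + R) ^ (3 / 2 : ℝ)) + -Real.log ‖f z‖) 0 R := by
    refine circleAverage_mono hint.abs ((circleIntegrable_const _ _ _).add hint.neg) ?_
    intro z hz
    have hzn : ‖z‖ = R := by
      have := mem_sphere_zero_iff_norm.1 hz
      rwa [abs_of_nonneg (by linarith)] at this
    have hup : Real.log ‖f z‖ ≤ C * (1 + R) ^ (3 / 2 : ℝ) := by
      rcases eq_or_ne (f z) 0 with h0 | h0
      · simp only [h0, norm_zero, Real.log_zero]; positivity
      · rw [Real.log_le_iff_le_exp (by simpa using h0), ← hzn]; exact hb z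
    have hpos : 0 ≤ C * (1 + R) ^ (3 / 2 : ℝ) := by positivity
    rw [abs_le]
    constructor <;> nlinarith
  have hsplit : circleAverage (fun z => (2 * C * (1 + R) ^ (3 / 2 : ℝ)) + -Real.log ‖f z‖) 0 R
      = circleAverage (fun _ => 2 * C * (1 + R) ^ (3 / 2 : ℝ)) 0 R
        + circleAverage (fun z => -Real.log ‖f z‖) 0 R :=
    circleAverage_fun_add (circleIntegrable_const _ _ _) hint.neg
  rw [hsplit, circleAverage_const] at hle
  have hneg : circleAverage (fun z => -Real.log ‖f z‖) 0 R
      = -circleAverage (fun z => Real.log ‖f z‖) 0 R := by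
    simpa using circleAverage_fun_smul (a := (-1 : ℝ)) (f := fun z => Real.log ‖f z‖)
      (c := 0) (R := R)
  rw [hneg] at hle
  have : 0 ≤ c := abs_nonneg _
  nlinarith

/-- An entire function `h` such that `exp h` is a quotient of functions of order at most `3/2`
has real part bounded by `C (1+|z|)^{3/2}`. -/
lemma re_le_of_exp_mul_eq {f₁ f₂ h : ℂ → ℂ} (hf₁ : Differentiable ℂ f₁)
    (hf₂ : Differentiable ℂ f₂) (hg₁ : HasGrowth f₁) (hg₂ : HasGrowth f₂)
    (hh : Differentiable ℂ h) (heq : ∀ z, f₁ z = Complex.exp (h z) * f₂ z) {z₀ : ℂ}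
    (hz₀ : f₂ z₀ ≠ 0) :
    ∃ C : ℝ, 0 ≤ C ∧ ∀ z, (h z).re ≤ C * (1 + ‖z‖) ^ (3 / 2 : ℝ) := by
  obtain ⟨C₁, hC₁, hb₁⟩ := hg₁.circleAverage_abs_log_le hf₁
  obtain ⟨C₂, hC₂, hb₂⟩ := hg₂.circleAverage_abs_log_le hf₂
  refine ⟨3 * (C₁ + C₂) * 2 ^ (3 / 2 : ℝ), by positivity, fun w => ?_⟩
  -- With this radius the Poisson kernel is at most $(R+|w|)/(R-|w|)\le3$, and $1+R=2(1+|w|)$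
  -- explains the factor $2^{3/2}$.
  set R : ℝ := 2 * ‖w‖ + 1 with hRdef
  have hw0 := norm_nonneg w
  have hR : 1 ≤ R := by linarith
  have hwR : w ∈ ball (0 : ℂ) R := by
    rw [mem_ball_zero_iff]; linarith
  have hharm : InnerProductSpace.HarmonicOnNhd (fun z => (h z).re) (closedBall 0 R) :=
    fun z _ => (hh.analyticAt z).harmonicAt_re
  have hP := hharm.circleAverage_re_herglotzRieszKernel_smul hwR
  have hcont : Continuous fun z => (h z).re := Complex.continuous_re.comp hh.continuous
  have hint : CircleIntegrable (fun z => |(h z).re|) 0 R :=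
    hcont.abs.continuousOn.circleIntegrable (by linarith)
  have hker : ∀ z ∈ sphere (0 : ℂ) |R|,
      0 ≤ (herglotzRieszKernel 0 w z).re ∧ (herglotzRieszKernel 0 w z).re ≤ 3 := by
    intro z hz
    rw [abs_of_nonneg (by linarith)] at hz
    have h1 := re_herglotzRieszKernel_le hz hwR
    have h2 := le_re_herglotzRieszKernel hz hwR
    rw [← herglotzRieszKernel_def] at h1 h2
    simp only [sub_zero] at h1 h2
    constructor
    · refine le_trans ?_ h2
      apply div_nonneg <;> linarith
    · refine h1.trans ?_
      rw [div_le_iff₀ (by linarith)]; linarith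
  have hker_cont : ContinuousOn (herglotzRieszKernel 0 w) (sphere (0 : ℂ) R) := by
    rw [herglotzRieszKernel_fun_def]
    refine ContinuousOn.div (by fun_prop) (by fun_prop) ?_
    intro z hz h0
    have hzn := mem_sphere_zero_iff_norm.1 hz
    have : z = w := by simpa [sub_eq_zero] using h0
    subst this
    linarith
  have hint2 : CircleIntegrable ((Complex.re ∘ herglotzRieszKernel 0 w) • fun z => (h z).re) 0 R := by
    refine ContinuousOn.circleIntegrable (by linarith) ?_
    exact (Complex.continuous_re.comp_continuousOn hker_cont).smul hcont.continuousOn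
  have h3 : (h w).re ≤ circleAverage (fun z => 3 * |(h z).re|) 0 R := by
    rw [← hP]
    refine circleAverage_mono hint2 (hint.const_smul (a := (3:ℝ))) ?_
    intro z hz
    obtain ⟨k0, k3⟩ := hker z hz
    simp only [Pi.smul_apply', Function.comp_apply, smul_eq_mul]
    calc _ ≤ (herglotzRieszKernel 0 w z).re * |(h z).re| := by gcongr; exact le_abs_self _
      _ ≤ _ := by gcongr
  have h4 : circleAverage (fun z => 3 * |(h z).re|) 0 R
      = 3 * circleAverage (fun z => |(h z).re|) 0 R := by
    simpa using circleAverage_fun_smul (a := (3 : ℝ)) (f := fun z => |(h z).re|) (c := 0) (R := R)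
  have hi₁ : CircleIntegrable (fun z => Real.log ‖f₁ z‖) 0 R :=
    MeromorphicOn.circleIntegrable_log_norm fun z _ => (hf₁.analyticAt z).meromorphicAt
  have hi₂ : CircleIntegrable (fun z => Real.log ‖f₂ z‖) 0 R :=
    MeromorphicOn.circleIntegrable_log_norm fun z _ => (hf₂.analyticAt z).meromorphicAt
  have h5 : circleAverage (fun z => |(h z).re|) 0 R
      = circleAverage (fun z => |Real.log ‖f₁ z‖ - Real.log ‖f₂ z‖|) 0 R := by
    -- The identity $\operatorname{Re} h=\log|f_1|-\log|f_2|$ may fail at zeros of $f_2$, where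
    -- `Real.log` takes its default value $0$; such points are discrete and do not affect the
    -- average.
    refine circleAverage_congr_codiscreteWithin ?_ (by linarith)
    have hcod : (f₂ ⁻¹' {0})ᶜ ∈ codiscrete ℂ :=
      AnalyticOnNhd.preimage_zero_mem_codiscrete (x := z₀) (fun z _ => hf₂.analyticAt z) hz₀
    filter_upwards [codiscreteWithin_mono (subset_univ _) hcod] with z hz
    have hz' : f₂ z ≠ 0 := hz
    rw [heq z, norm_mul, Complex.norm_exp, Real.log_mul (by positivity) (by simpa using hz'),
      Real.log_exp]
    simp
  have h6 : circleAverage (fun z => |Real.log ‖f₁ z‖ - Real.log ‖f₂ z‖|) 0 R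
      ≤ circleAverage (fun z => |Real.log ‖f₁ z‖| + |Real.log ‖f₂ z‖|) 0 R := by
    refine circleAverage_mono (CircleIntegrable.abs (hi₁.sub hi₂)) (hi₁.abs.add hi₂.abs) ?_
    intro z _
    exact abs_sub _ _
  have hsplit : circleAverage (fun z => |Real.log ‖f₁ z‖| + |Real.log ‖f₂ z‖|) 0 R
      = circleAverage (fun z => |Real.log ‖f₁ z‖|) 0 R
        + circleAverage (fun z => |Real.log ‖f₂ z‖|) 0 R :=
    circleAverage_fun_add hi₁.abs hi₂.abs
  rw [hsplit] at h6
  have h7 := hb₁ R hR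
  have h8 := hb₂ R hR
  have h9 : (1 + R) ^ (3 / 2 : ℝ) = 2 ^ (3 / 2 : ℝ) * (1 + ‖w‖) ^ (3 / 2 : ℝ) := by
    rw [← Real.mul_rpow (by norm_num) (by positivity)]; congr 1; rw [hRdef]; ring
  rw [h9] at h7 h8
  calc (h w).re ≤ 3 * (C₁ * (2 ^ (3 / 2 : ℝ) * (1 + ‖w‖) ^ (3 / 2 : ℝ))
        + C₂ * (2 ^ (3 / 2 : ℝ) * (1 + ‖w‖) ^ (3 / 2 : ℝ))) := by linarith
    _ = _ := by ring

/-- An entire function whose real part is at most `C (1+|z|)^{3/2}` is affine. -/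
lemma affine_of_re_le {h : ℂ → ℂ} (hh : Differentiable ℂ h) {C : ℝ} (hC : 0 ≤ C)
    (hb : ∀ z, (h z).re ≤ C * (1 + ‖z‖) ^ (3 / 2 : ℝ)) :
    ∃ A B : ℂ, ∀ z, h z = A * z + B := by
  have hnorm : ∀ R : ℝ, 1 ≤ R → ∀ z ∈ closedBall (0 : ℂ) R,
      ‖h z‖ ≤ (2 * (C * 3 ^ (3 / 2 : ℝ) + 1) + 3 * ‖h 0‖) * R ^ (3 / 2 : ℝ) := by
    intro R hR z hz
    rw [mem_closedBall_zero_iff] at hz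
    set M : ℝ := (C * 3 ^ (3 / 2 : ℝ) + 1) * R ^ (3 / 2 : ℝ) with hM
    have hR1 : 1 ≤ R ^ (3 / 2 : ℝ) := Real.one_le_rpow hR (by norm_num)
    have hM0 : 0 < M := by positivity
    -- Borel–Carathéodory on the disc of radius $2R$ turns the one-sided bound into a bound for
    -- $|h|$ on the disc of radius $R$; the $+1$ in `M` only ensures positivity.
    have := Complex.borelCaratheodory (f := h) (R := 2 * R) (z := z) hM0 hh.differentiableOn ?_
      (by linarith) (by rw [mem_ball_zero_iff]; linarith)
    · refine this.trans ?_
      have hz0 := norm_nonneg z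
      have e1 : 2 * M * ‖z‖ / (2 * R - ‖z‖) ≤ 2 * M := by
        rw [div_le_iff₀ (by linarith)]
        nlinarith
      have e2 : ‖h 0‖ * (2 * R + ‖z‖) / (2 * R - ‖z‖) ≤ 3 * ‖h 0‖ := by
        rw [div_le_iff₀ (by linarith)]
        nlinarith [norm_nonneg (h 0)]
      nlinarith [norm_nonneg (h 0)]
    · intro x hx
      rw [mem_ball_zero_iff] at hx
      refine (hb x).trans ?_
      have : (1 + ‖x‖) ^ (3 / 2 : ℝ) ≤ 3 ^ (3 / 2 : ℝ) * R ^ (3 / 2 : ℝ) := by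
        rw [← Real.mul_rpow (by norm_num) (by linarith)]
        exact Real.rpow_le_rpow (by positivity) (by linarith) (by norm_num)
      calc C * (1 + ‖x‖) ^ (3 / 2 : ℝ) ≤ C * (3 ^ (3 / 2 : ℝ) * R ^ (3 / 2 : ℝ)) := by gcongr
        _ ≤ M := by rw [hM]; nlinarith
  set D := 2 * (C * 3 ^ (3 / 2 : ℝ) + 1) + 3 * ‖h 0‖ with hD
  have hD0 : 0 ≤ D := by positivity
  -- Cauchy's estimate on the circle of radius $R$ about $c$ gives $O(R^{3/2}/R^2)$, which tends to
  -- $0$.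
  have hd2 : ∀ c, iteratedDeriv 2 h c = 0 := by
    intro c
    have hlim : Tendsto (fun R : ℝ => (2 * D * 2 ^ (3 / 2 : ℝ)) * R ^ (-(1 / 2) : ℝ)) atTop
        (𝓝 ((2 * D * 2 ^ (3 / 2 : ℝ)) * 0)) :=
      (tendsto_rpow_neg_atTop (by norm_num)).const_mul _
    rw [mul_zero] at hlim
    have hle : ∀ᶠ R : ℝ in atTop,
        ‖iteratedDeriv 2 h c‖ ≤ (2 * D * 2 ^ (3 / 2 : ℝ)) * R ^ (-(1 / 2) : ℝ) := by
      filter_upwards [eventually_ge_atTop 1, eventually_ge_atTop ‖c‖] with R h1 h2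
      have hR0 : 0 < R := by linarith
      have := Complex.norm_iteratedDeriv_le_of_forall_mem_sphere_norm_le (f := h) (c := c) (R := R)
        (C := D * (2 * R) ^ (3 / 2 : ℝ)) 2 hR0 hh.diffContOnCl ?_
      · refine this.trans (le_of_eq ?_)
        rw [Real.mul_rpow (by norm_num) hR0.le, div_eq_iff (by positivity)]
        have : R ^ (-(1 / 2) : ℝ) * R ^ 2 = R ^ (3 / 2 : ℝ) := by
          rw [← Real.rpow_natCast, ← Real.rpow_add hR0]; norm_num
        rw [mul_assoc (2 * D * 2 ^ (3 / 2 : ℝ)), this]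
        norm_num [Nat.factorial]; ring
      · intro z hz
        refine hnorm (2 * R) (by linarith) z ?_
        rw [mem_closedBall_zero_iff]
        have : ‖z - c‖ = R := mem_sphere_iff_norm.1 hz
        have := norm_le_norm_sub_add z c
        linarith
    have := ge_of_tendsto hlim hle
    exact norm_le_zero_iff.1 this
  have hd1 : Differentiable ℂ (deriv h) := hh.deriv
  have hconst : ∀ z, deriv h z = deriv h 0 := fun z =>
    is_const_of_deriv_eq_zero hd1 (fun x => by
      have := hd2 x; rwa [iteratedDeriv_succ, iteratedDeriv_one] at this) z 0
  refine ⟨deriv h 0, h 0, fun z => ?_⟩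
  have hk : ∀ x, HasDerivAt (fun x => h x - deriv h 0 * x) 0 x := by
    intro x
    have h1 := (hh x).hasDerivAt.sub ((hasDerivAt_id x).const_mul (deriv h 0))
    rw [hconst x, mul_one, sub_self] at h1
    exact h1
  have := is_const_of_deriv_eq_zero (fun x => (hk x).differentiableAt) (fun x => (hk x).deriv) z 0
  simp only [mul_zero, sub_zero] at this
  linear_combination this

/-- A zero-free entire function is an exponential. -/
lemma exists_exp_eq {g : ℂ → ℂ} (hg : Differentiable ℂ g) (h0 : ∀ z, g z ≠ 0) :
    ∃ h : ℂ → ℂ, Differentiable ℂ h ∧ ∀ z, g z = Complex.exp (h z) := by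
  have hq : Differentiable ℂ fun z => deriv g z / g z := hg.deriv.div hg h0
  -- A primitive of $g'/g$ is a logarithm of $g$ up to an additive constant, because $g e^{-k}$ has
  -- zero derivative.
  obtain ⟨k, hk⟩ := hq.isExactOn_univ
  have hk' : ∀ z, HasDerivAt k (deriv g z / g z) z := fun z => hk z (mem_univ z)
  have hc : ∀ z, HasDerivAt (fun z => g z * Complex.exp (-k z)) 0 z := by
    intro z
    have h1 := (hg z).hasDerivAt.mul (hk' z).neg.cexp
    convert! h1 using 1
    field_simp [h0 z]
    ring
  refine ⟨fun z => Complex.log (g 0 * Complex.exp (-k 0)) + k z, ?_, fun z => ?_⟩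
  · exact (differentiable_const _).add fun z => (hk' z).differentiableAt
  · have h2 := is_const_of_deriv_eq_zero (fun x => (hc x).differentiableAt)
      (fun x => (hc x).deriv) z 0
    rw [Complex.exp_add, Complex.exp_log (mul_ne_zero (h0 0) (Complex.exp_ne_zero _)), ← h2,
      mul_assoc, ← Complex.exp_add]
    simp

/-- Two entire functions with the same zeros, counted with multiplicity, differ by a zero-free
entire factor. -/
lemma exists_entire_quotient {f₁ f₂ : ℂ → ℂ} (hf₁ : Differentiable ℂ f₁)
    (hf₂ : Differentiable ℂ f₂) (hne : ∀ z, analyticOrderAt f₂ z ≠ ⊤)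
    (hord : ∀ z, analyticOrderAt f₁ z = analyticOrderAt f₂ z) :
    ∃ g : ℂ → ℂ, Differentiable ℂ g ∧ (∀ z, g z ≠ 0) ∧ ∀ z, f₁ z = g z * f₂ z := by
  have hm₁ : MeromorphicOn f₁ univ := fun z _ => (hf₁.analyticAt z).meromorphicAt
  have hm₂ : MeromorphicOn f₂ univ := fun z _ => (hf₂.analyticAt z).meromorphicAt
  have hm : MeromorphicOn (f₁ / f₂) univ := hm₁.div hm₂
  -- The normal form removes the singularities of $f_1/f_2$; its order is $0$ everywhere, so it is
  -- entire without zeros.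
  set g := toMeromorphicNFOn (f₁ / f₂) univ with hgdef
  have hgN : MeromorphicNFOn g univ := meromorphicNFOn_toMeromorphicNFOn _ _
  have hg0 : ∀ z, meromorphicOrderAt g z = 0 := by
    intro z
    rw [hgdef, meromorphicOrderAt_toMeromorphicNFOn hm (mem_univ z),
      meromorphicOrderAt_div (hm₁ z (mem_univ z)) (hm₂ z (mem_univ z)),
      (hf₁.analyticAt z).meromorphicOrderAt_eq, (hf₂.analyticAt z).meromorphicOrderAt_eq, hord z]
    obtain ⟨n, hn⟩ := ENat.ne_top_iff_exists.1 (hne z)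
    rw [← hn]
    simp only [ENat.map_natCast]
    rw [← WithTop.LinearOrderedAddCommGroup.coe_sub]
    simp
  have hgA : ∀ z, AnalyticAt ℂ g z := fun z =>
    (hgN (mem_univ z)).meromorphicOrderAt_nonneg_iff_analyticAt.1 (hg0 z).ge
  refine ⟨g, fun z => (hgA z).differentiableAt, fun z =>
    (hgN (mem_univ z)).meromorphicOrderAt_eq_zero_iff.1 (hg0 z), fun z => ?_⟩
  have h1 : f₁ =ᶠ[𝓝[≠] z] fun x => g x * f₂ x := by
    have h2 := hm.toMeromorphicNFOn_eq_self_on_nhdsNE (mem_univ z)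
    have h3 : ∀ᶠ x in 𝓝[≠] z, f₂ x ≠ 0 :=
      (meromorphicOrderAt_ne_top_iff_eventually_ne_zero (hm₂ z (mem_univ z))).1 (by
        rw [(hf₂.analyticAt z).meromorphicOrderAt_eq]
        obtain ⟨n, hn⟩ := ENat.ne_top_iff_exists.1 (hne z)
        rw [← hn]; simp)
    filter_upwards [h2, h3] with x hx hx3
    rw [hgdef, hx, Pi.div_apply, div_mul_cancel₀ _ hx3]
  have h4 := (hf₁.continuous.continuousAt (x := z)).eventuallyEq_nhds_iff_eventuallyEq_nhdsNE
    ((hgA z).continuousAt.mul hf₂.continuous.continuousAt)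
  exact (h4.1 h1).eq_of_nhds

/-- Two entire functions of order at most `3/2` with the same zeros, counted with multiplicity, and
quotient tending to `1` along the positive reals are equal. -/
theorem eq_of_same_zeros {f₁ f₂ : ℂ → ℂ} (hf₁ : Differentiable ℂ f₁)
    (hf₂ : Differentiable ℂ f₂) (hg₁ : HasGrowth f₁) (hg₂ : HasGrowth f₂)
    (hord : ∀ z, analyticOrderAt f₁ z = analyticOrderAt f₂ z)
    (hlim : Tendsto (fun x : ℝ => f₁ x / f₂ x) atTop (𝓝 1)) :
    ∀ z, f₁ z = f₂ z := by
  obtain ⟨x₀, hx₀⟩ : ∃ x₀ : ℝ, f₂ x₀ ≠ 0 := by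
    have h1 : ∀ᶠ x : ℝ in atTop, f₁ x / f₂ x ≠ 0 := hlim.eventually_ne one_ne_zero
    obtain ⟨x, hx⟩ := h1.exists
    exact ⟨x, fun h => hx (by simp [h])⟩
  have hne : ∀ z, analyticOrderAt f₂ z ≠ ⊤ := by
    intro z htop
    have han : AnalyticOnNhd ℂ f₂ univ := fun z _ => hf₂.analyticAt z
    have := han.eqOn_zero_of_preconnected_of_eventuallyEq_zero isPreconnected_univ (mem_univ z)
      (analyticOrderAt_eq_top.1 htop)
    exact hx₀ (this (mem_univ _))
  obtain ⟨g, hg, hg0, hgeq⟩ := exists_entire_quotient hf₁ hf₂ hne hord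
  obtain ⟨h, hh, hgexp⟩ := exists_exp_eq hg hg0
  obtain ⟨C, hC, hre⟩ := re_le_of_exp_mul_eq hf₁ hf₂ hg₁ hg₂ hh
    (fun z => by rw [hgeq z, hgexp z]) hx₀
  obtain ⟨A, B, hAB⟩ := affine_of_re_le hh hC hre
  have hlimg : Tendsto (fun x : ℝ => g x) atTop (𝓝 1) := by
    refine hlim.congr' ?_
    filter_upwards [hlim.eventually_ne one_ne_zero] with x hx
    have : f₂ x ≠ 0 := fun h => hx (by simp [h])
    rw [hgeq x, mul_div_cancel_right₀ _ this]
  -- For affine $h$ the ratio $g(x+s)/g(x)$ is independent of $x$, and its limit as $x\to\infty$ is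
  -- $1$. Differentiating in $s$ at $0$ then gives $A=0$.
  have hexp : ∀ s : ℝ, Complex.exp (A * s) = 1 := by
    intro s
    have h1 : Tendsto (fun x : ℝ => g (x + s : ℝ) / g x) atTop (𝓝 (1 / 1)) :=
      (hlimg.comp (tendsto_atTop_add_const_right _ s tendsto_id)).div hlimg one_ne_zero
    have h2 : ∀ x : ℝ, g (x + s : ℝ) / g x = Complex.exp (A * s) := by
      intro x
      rw [hgexp, hgexp, ← Complex.exp_sub, hAB, hAB]
      congr 1; push_cast; ring
    simp only [h2, div_one] at h1
    exact tendsto_nhds_unique tendsto_const_nhds h1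
  have hA : A = 0 := by
    have h1 : HasDerivAt (fun s : ℝ => Complex.exp (A * s)) (Complex.exp (A * (0 : ℝ)) * (A * 1)) 0 :=
      (((Complex.ofRealCLM.hasDerivAt (x := (0 : ℝ))).const_mul A).cexp)
    have h2 : HasDerivAt (fun s : ℝ => Complex.exp (A * s)) 0 0 := by
      simp only [hexp]; exact hasDerivAt_const _ _
    have := h1.unique h2
    simpa using this
  have hconst : ∀ z, g z = Complex.exp B := fun z => by rw [hgexp, hAB, hA]; simp
  simp only [hconst] at hlimg
  have hB : Complex.exp B = 1 := tendsto_nhds_unique tendsto_const_nhds hlimg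
  intro z
  rw [hgeq z, hconst z, hB, one_mul]

end EntireFunctions

/-! ### Bounds for the reciprocal Gamma function -/

section GammaBounds

/-- The genus-one factor is $1+O(|u|^2)$ for small $u$ and at most $e^{2|u|}$ for large $u$. The
exponent $3/2$ lies between $1$ and $2$, hence serves both ranges, and it exceeds $1$, so that
$\sum_j|z/j|^{3/2}$ converges. -/
lemma norm_one_add_mul_exp_neg_le (u : ℂ) :
    ‖(1 + u) * Complex.exp (-u)‖ ≤ Real.exp (3 * ‖u‖ ^ (3 / 2 : ℝ)) := by
  have hu0 := norm_nonneg u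
  rcases le_total ‖u‖ 1 with hu | hu
  · have h1 : ‖Complex.exp (-u) - 1 - (-u)‖ ≤ ‖-u‖ ^ 2 :=
      Complex.norm_exp_sub_one_sub_id_le (by simpa using hu)
    rw [norm_neg] at h1
    have h2 : (1 + u) * Complex.exp (-u)
        = 1 + (-(u ^ 2) + (1 + u) * (Complex.exp (-u) - 1 - (-u))) := by ring
    have h3 : ‖u‖ ^ 2 ≤ ‖u‖ ^ (3 / 2 : ℝ) := by
      rw [← Real.rpow_natCast]
      rcases hu0.eq_or_lt with h | h
      · rw [← h]; norm_num
      · exact Real.rpow_le_rpow_of_exponent_ge h hu (by norm_num)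
    have h4 : ‖1 + u‖ ≤ 2 := (norm_add_le _ _).trans (by rw [norm_one]; linarith)
    calc ‖(1 + u) * Complex.exp (-u)‖
        ≤ 1 + (‖u‖ ^ 2 + 2 * ‖u‖ ^ 2) := by
          rw [h2]
          refine (norm_add_le _ _).trans ?_
          rw [norm_one]
          gcongr
          refine (norm_add_le _ _).trans ?_
          rw [norm_neg, norm_pow, norm_mul]
          gcongr
      _ ≤ 3 * ‖u‖ ^ (3 / 2 : ℝ) + 1 := by linarith
      _ ≤ _ := Real.add_one_le_exp _
  · have h3 : ‖u‖ ≤ ‖u‖ ^ (3 / 2 : ℝ) := by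
      conv_lhs => rw [← Real.rpow_one ‖u‖]
      exact Real.rpow_le_rpow_of_exponent_le hu (by norm_num)
    calc ‖(1 + u) * Complex.exp (-u)‖ ≤ (‖u‖ + 1) * Real.exp ‖u‖ := by
          rw [norm_mul]
          gcongr
          · refine (norm_add_le _ _).trans ?_
            rw [norm_one, add_comm]
          · rw [Complex.norm_exp]
            exact Real.exp_le_exp.2 ((Complex.re_le_norm _).trans (by rw [norm_neg]))
      _ ≤ Real.exp ‖u‖ * Real.exp ‖u‖ := by gcongr; exact Real.add_one_le_exp _
      _ = Real.exp (2 * ‖u‖) := by rw [← Real.exp_add]; ring_nf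
      _ ≤ _ := Real.exp_le_exp.2 (by linarith)

/-- The reciprocal of Euler's sequence for the Gamma function as a Weierstrass product. -/
lemma inv_GammaSeq_eq (s : ℂ) {n : ℕ} (hn : n ≠ 0) :
    (Complex.GammaSeq s n)⁻¹ = s * (∏ j ∈ Finset.range n,
      ((1 + s / ((j : ℂ) + 1)) * Complex.exp (-(s / ((j : ℂ) + 1))))) *
      Complex.exp (s * ((eulerMascheroniSeq' n : ℝ) : ℂ)) := by
  -- The convergence factors $e^{-s/(j+1)}$ multiply to $e^{-sH_n}$, and $e^{s(H_n-\log n)}$ turns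
  -- this into $n^{-s}$.
  have hfac : (n.factorial : ℂ) = ∏ j ∈ Finset.range n, ((j : ℂ) + 1) := by
    rw [← Finset.prod_range_add_one_eq_factorial]; push_cast; rfl
  have hpow : (n : ℂ) ^ s = Complex.exp (s * (Real.log n : ℝ)) := by
    rw [Complex.cpow_def_of_ne_zero (by exact_mod_cast hn), Complex.natCast_log, mul_comm]
  have hj : ∀ j : ℕ, (j : ℂ) + 1 ≠ 0 := fun j => by exact_mod_cast j.succ_ne_zero
  have hexp : ∏ j ∈ Finset.range n, Complex.exp (-(s / ((j : ℂ) + 1)))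
      = Complex.exp (-(s * ((harmonic n : ℚ) : ℝ))) := by
    rw [← Complex.exp_sum]
    congr 1
    rw [Finset.sum_neg_distrib, harmonic]
    push_cast
    rw [Finset.mul_sum]
    simp [div_eq_mul_inv]
  have heul : eulerMascheroniSeq' n = (harmonic n : ℝ) - Real.log n := by
    simp [eulerMascheroniSeq', hn]
  rw [Finset.prod_mul_distrib, hexp, Complex.GammaSeq, heul, hpow, hfac, Finset.prod_range_succ',
    inv_div, Finset.prod_congr rfl (fun j _ => show s + ((j + 1 : ℕ) : ℂ)
      = (1 + s / ((j : ℂ) + 1)) * ((j : ℂ) + 1) by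
        push_cast; field_simp [hj j]; ring), Finset.prod_mul_distrib]
  have hP : ∏ j ∈ Finset.range n, ((j : ℂ) + 1) ≠ 0 := Finset.prod_ne_zero_iff.2 fun j _ => hj j
  have he : Complex.exp (-(s * ((harmonic n : ℚ) : ℝ)))
      * Complex.exp (s * (((harmonic n : ℝ) - Real.log n : ℝ) : ℂ))
      = (Complex.exp (s * (Real.log n : ℝ)))⁻¹ := by
    rw [← Complex.exp_add, ← Complex.exp_neg]; congr 1; push_cast; ring
  rw [mul_assoc s, mul_assoc (∏ j ∈ Finset.range n, (1 + s / ((j : ℂ) + 1))) (Complex.exp _), he]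
  field_simp
  simp only [Nat.cast_zero, add_zero]
  ring

lemma eulerMascheroniSeq'_mem_Icc {n : ℕ} (hn : n ≠ 0) :
    0 ≤ eulerMascheroniSeq' n ∧ eulerMascheroniSeq' n ≤ 1 := by
  constructor
  · have := eulerMascheroniConstant_lt_eulerMascheroniSeq' n
    have := one_half_lt_eulerMascheroniConstant
    linarith
  · rw [← eulerMascheroniSeq'_one]
    exact strictAnti_eulerMascheroniSeq'.antitone (Nat.one_le_iff_ne_zero.2 hn)

/-- The reciprocal Gamma function has order at most `3/2`. -/
theorem hasGrowth_inv_Gamma : HasGrowth fun z => (Complex.Gamma z)⁻¹ := by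
  have hsum : Summable fun j : ℕ => 1 / ((j : ℝ) + 1) ^ (3 / 2 : ℝ) := by
    have h := (summable_nat_add_iff 1).2 (Real.summable_one_div_nat_rpow.2
      (by norm_num : (1 : ℝ) < 3 / 2))
    simpa using h
  set S : ℝ := ∑' j : ℕ, 1 / ((j : ℝ) + 1) ^ (3 / 2 : ℝ) with hS
  have hS0 : 0 ≤ S := tsum_nonneg fun j => by positivity
  refine ⟨2 + 3 * S, by positivity, fun z => ?_⟩
  have hz0 := norm_nonneg z
  have hz1 : ‖z‖ ≤ (1 + ‖z‖) ^ (3 / 2 : ℝ) := by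
    calc ‖z‖ ≤ (1 + ‖z‖) ^ (1 : ℝ) := by rw [Real.rpow_one]; linarith
      _ ≤ _ := Real.rpow_le_rpow_of_exponent_le (by linarith) (by norm_num)
  have hz2 : ‖z‖ ^ (3 / 2 : ℝ) ≤ (1 + ‖z‖) ^ (3 / 2 : ℝ) :=
    Real.rpow_le_rpow hz0 (by linarith) (by norm_num)
  -- This occurs only at the poles, where `Complex.Gamma` is $0$ by convention; its inverse is then
  -- $0$ too.
  by_cases hΓ : Complex.Gamma z = 0
  · simp only [hΓ, inv_zero, norm_zero]; positivity
  have hlim := ((Complex.GammaSeq_tendsto_Gamma z).inv₀ hΓ).norm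
  refine le_of_tendsto hlim ?_
  filter_upwards [eventually_ne_atTop 0] with n hn
  rw [inv_GammaSeq_eq z hn, norm_mul, norm_mul, norm_prod]
  have h1 : ∏ j ∈ Finset.range n,
      ‖(1 + z / ((j : ℂ) + 1)) * Complex.exp (-(z / ((j : ℂ) + 1)))‖
      ≤ Real.exp (3 * S * ‖z‖ ^ (3 / 2 : ℝ)) := by
    calc _ ≤ ∏ j ∈ Finset.range n,
          Real.exp (3 * ‖z‖ ^ (3 / 2 : ℝ) * (1 / ((j : ℝ) + 1) ^ (3 / 2 : ℝ))) := by
          refine Finset.prod_le_prod (fun _ _ => norm_nonneg _) fun j _ => ?_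
          refine (norm_one_add_mul_exp_neg_le _).trans (le_of_eq ?_)
          have : ‖(j : ℂ) + 1‖ = (j : ℝ) + 1 := by
            have : (j : ℂ) + 1 = ((j + 1 : ℕ) : ℂ) := by push_cast; rfl
            rw [this, Complex.norm_natCast]; push_cast; rfl
          rw [norm_div, this, Real.div_rpow hz0 (by positivity)]
          ring_nf
      _ = Real.exp (3 * ‖z‖ ^ (3 / 2 : ℝ) *
            ∑ j ∈ Finset.range n, (1 / ((j : ℝ) + 1) ^ (3 / 2 : ℝ))) := by
          rw [← Real.exp_sum, Finset.mul_sum]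
      _ ≤ Real.exp (3 * ‖z‖ ^ (3 / 2 : ℝ) * S) := by
          gcongr
          exact hsum.sum_le_tsum _ fun j _ => by positivity
      _ = _ := by ring_nf
  have h2 : ‖Complex.exp (z * ((eulerMascheroniSeq' n : ℝ) : ℂ))‖ ≤ Real.exp ‖z‖ := by
    obtain ⟨e0, e1⟩ := eulerMascheroniSeq'_mem_Icc hn
    rw [Complex.norm_exp]
    refine Real.exp_le_exp.2 ((Complex.re_le_norm _).trans ?_)
    rw [norm_mul, Complex.norm_real, Real.norm_eq_abs, abs_of_nonneg e0]
    exact mul_le_of_le_one_right hz0 e1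
  have h3 : ‖z‖ ≤ Real.exp ‖z‖ := by linarith [Real.add_one_le_exp ‖z‖]
  calc _ ≤ Real.exp ‖z‖ * Real.exp (3 * S * ‖z‖ ^ (3 / 2 : ℝ)) * Real.exp ‖z‖ := by gcongr
    _ = Real.exp (2 * ‖z‖ + 3 * S * ‖z‖ ^ (3 / 2 : ℝ)) := by
      rw [← Real.exp_add, ← Real.exp_add]; ring_nf
    _ ≤ _ := by
      refine Real.exp_le_exp.2 ?_
      nlinarith

/-- A bound for `1 / Γ(z + m + 1)` which is uniform in `m`. -/
theorem norm_inv_Gamma_add_natCast_le :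
    ∃ C : ℝ, 0 ≤ C ∧ ∀ (z : ℂ) (m : ℕ),
      ‖(Complex.Gamma (z + m + 1))⁻¹‖ ≤ Real.exp (C * (1 + ‖z‖) ^ (3 / 2 : ℝ)) := by
  obtain ⟨C, hC, hb⟩ := hasGrowth_inv_Gamma
  refine ⟨C * 3 ^ (3 / 2 : ℝ), by positivity, fun z m => ?_⟩
  have hz0 := norm_nonneg z
  -- For $k\le|z|+1$ one has $1+|z+k+1|\le3(1+|z|)$, whence the factor $3^{3/2}$.
  have key : ∀ k : ℕ, (k : ℝ) ≤ ‖z‖ + 1 → ‖(Complex.Gamma (z + k + 1))⁻¹‖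
      ≤ Real.exp (C * 3 ^ (3 / 2 : ℝ) * (1 + ‖z‖) ^ (3 / 2 : ℝ)) := by
    intro k hk
    refine (hb _).trans (Real.exp_le_exp.2 ?_)
    rw [mul_assoc, ← Real.mul_rpow (by norm_num) (by positivity)]
    gcongr
    have : ‖z + k + 1‖ ≤ ‖z‖ + k + 1 := by
      refine (norm_add_le _ _).trans ?_
      rw [norm_one]
      gcongr
      refine (norm_add_le _ _).trans ?_
      rw [Complex.norm_natCast]
    linarith
  rcases le_total m ⌈‖z‖⌉₊ with hm | hm
  · refine key m ?_
    have h1 : (m : ℝ) ≤ (⌈‖z‖⌉₊ : ℝ) := by exact_mod_cast hm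
    linarith [(Nat.ceil_lt_add_one hz0)]
  -- Once $m\ge|z|$, the identity $1/\Gamma(s)=s/\Gamma(s+1)$ with $|s|=|z+m+1|\ge1$ shows that
  -- $|1/\Gamma(z+m+1)|$ no longer increases with $m$.
  · induction m, hm using Nat.le_induction with
    | base => exact key _ (Nat.ceil_lt_add_one hz0).le
    | succ m hm ih =>
      refine le_trans ?_ ih
      have hmz : ‖z‖ ≤ m := (Nat.le_ceil _).trans (by exact_mod_cast hm)
      have h1 : 1 ≤ ‖z + m + 1‖ := by
        have h2 : ‖((m + 1 : ℕ) : ℂ)‖ ≤ ‖z + m + 1‖ + ‖z‖ := by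
          have : ((m + 1 : ℕ) : ℂ) = (z + m + 1) - z := by push_cast; ring
          rw [this]; exact norm_sub_le _ _
        rw [Complex.norm_natCast] at h2
        push_cast at h2
        linarith
      have h3 := Complex.one_div_Gamma_eq_self_mul_one_div_Gamma_add_one (z + m + 1)
      push_cast
      rw [← add_assoc]
      rw [h3, norm_mul]
      exact le_mul_of_one_le_left (norm_nonneg _) h1

end GammaBounds

/-! ### Bessel functions of complex order -/

section BesselSeries

/-- Coefficients of the Bessel series. -/
def besselCoeff (z : ℂ) (m : ℕ) : ℂ := (-1) ^ m / ((m.factorial : ℂ) * Complex.Gamma (z + m + 1))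

/-- The terms of the `k`-th derivative in `y` of `J_z (2 e^y)`. -/
def besselTerm (k : ℕ) (z : ℂ) (y : ℝ) (m : ℕ) : ℂ :=
  (z + 2 * m) ^ k * besselCoeff z m * Complex.exp ((z + 2 * m) * y)

/-- The `k`-th derivative in `y` of `J_z (2 e^y)`. -/
def besselSeries (k : ℕ) (z : ℂ) (y : ℝ) : ℂ := ∑' m, besselTerm k z y m

lemma exists_norm_besselCoeff_le :
    ∃ C : ℝ, 0 ≤ C ∧ ∀ (z : ℂ) (m : ℕ),
      ‖besselCoeff z m‖ ≤ Real.exp (C * (1 + ‖z‖) ^ (3 / 2 : ℝ)) / m.factorial := by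
  obtain ⟨C, hC, hb⟩ := norm_inv_Gamma_add_natCast_le
  refine ⟨C, hC, fun z m => ?_⟩
  rw [besselCoeff, norm_div, norm_mul, norm_pow, norm_neg, norm_one, one_pow, Complex.norm_natCast,
    one_div, mul_inv, mul_comm, ← norm_inv, ← div_eq_mul_inv]
  gcongr
  exact hb z m

/-- The growth constant of the Bessel coefficients. -/
def besselGrowth : ℝ := exists_norm_besselCoeff_le.choose

lemma besselGrowth_nonneg : 0 ≤ besselGrowth := exists_norm_besselCoeff_le.choose_spec.1

lemma norm_besselCoeff_le (z : ℂ) (m : ℕ) :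
    ‖besselCoeff z m‖ ≤ Real.exp (besselGrowth * (1 + ‖z‖) ^ (3 / 2 : ℝ)) / m.factorial :=
  exists_norm_besselCoeff_le.choose_spec.2 z m

/-- A bound for the size of the Bessel series, up to the exponential factor in `y`. -/
def besselBound (k : ℕ) (r : ℝ) : ℝ :=
  Real.exp (k * r) * Real.exp (besselGrowth * (1 + r) ^ (3 / 2 : ℝ))

lemma besselBound_pos (k : ℕ) (r : ℝ) : 0 < besselBound k r := by
  unfold besselBound; positivity

lemma besselBound_mono (k : ℕ) {r s : ℝ} (hr : 0 ≤ r) (h : r ≤ s) :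
    besselBound k r ≤ besselBound k s := by
  have := besselGrowth_nonneg
  unfold besselBound
  gcongr

/-- The polynomial factor $(z+2m)^k$ is absorbed by $e^{k(|z|+2m)}$, so all derivatives are
dominated by one exponential series in $e^{2k+2y}$. -/
lemma norm_besselTerm_le (k : ℕ) (z : ℂ) (y : ℝ) (m : ℕ) :
    ‖besselTerm k z y m‖ ≤ besselBound k ‖z‖ * Real.exp (z.re * y)
      * ((Real.exp (2 * k + 2 * y)) ^ m / m.factorial) := by
  have h1 : ‖z + 2 * m‖ ≤ ‖z‖ + 2 * m := by
    refine (norm_add_le _ _).trans ?_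
    rw [norm_mul, Complex.norm_natCast]; norm_num
  have h2 : ‖(z + 2 * m) ^ k‖ ≤ Real.exp (k * ‖z‖) * Real.exp (2 * k) ^ m := by
    rw [norm_pow]
    calc ‖z + 2 * m‖ ^ k ≤ (Real.exp (‖z‖ + 2 * m)) ^ k := by
          gcongr
          linarith [Real.add_one_le_exp (‖z‖ + 2 * (m : ℝ))]
      _ = _ := by
          rw [← Real.exp_nat_mul, ← Real.exp_nat_mul, ← Real.exp_add]; ring_nf
  have h3 : ‖Complex.exp ((z + 2 * m) * y)‖ = Real.exp (z.re * y) * Real.exp (2 * y) ^ m := by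
    rw [Complex.norm_exp, ← Real.exp_nat_mul, ← Real.exp_add]
    congr 1
    simp
    ring
  rw [besselTerm, norm_mul, norm_mul, h3]
  calc _ ≤ (Real.exp (k * ‖z‖) * Real.exp (2 * k) ^ m) *
        (Real.exp (besselGrowth * (1 + ‖z‖) ^ (3 / 2 : ℝ)) / m.factorial) *
        (Real.exp (z.re * y) * Real.exp (2 * y) ^ m) := by
        gcongr
        exact norm_besselCoeff_le z m
    _ = _ := by
      rw [Real.exp_add, mul_pow, besselBound]; ring

lemma summable_besselTerm (k : ℕ) (z : ℂ) (y : ℝ) : Summable (besselTerm k z y) :=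
  Summable.of_norm_bounded ((Real.summable_pow_div_factorial _).mul_left _)
    (norm_besselTerm_le k z y)

lemma norm_besselSeries_le (k : ℕ) (z : ℂ) (y : ℝ) :
    ‖besselSeries k z y‖ ≤ besselBound k ‖z‖ * Real.exp (z.re * y)
      * Real.exp (Real.exp (2 * k + 2 * y)) := by
  have hs := (Real.summable_pow_div_factorial (Real.exp (2 * k + 2 * y))).mul_left
    (besselBound k ‖z‖ * Real.exp (z.re * y))
  refine (tsum_of_norm_bounded hs.hasSum (norm_besselTerm_le k z y)).trans (le_of_eq ?_)
  rw [tsum_mul_left, Real.exp_eq_exp_ℝ, NormedSpace.exp_eq_tsum_div]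

lemma hasDerivAt_besselSeries (k : ℕ) (z : ℂ) (y : ℝ) :
    HasDerivAt (besselSeries k z) (besselSeries (k + 1) z y) y := by
  have hu : Summable fun m : ℕ => besselBound (k + 1) ‖z‖ * Real.exp (‖z‖ * (|y| + 1))
      * ((Real.exp (2 * (k + 1 : ℕ) + 2 * (|y| + 1))) ^ m / m.factorial) :=
    (Real.summable_pow_div_factorial _).mul_left _
  refine hasDerivAt_tsum_of_isPreconnected hu isOpen_ball
    (convex_ball y 1).isPreconnected (g := fun m x => besselTerm k z x m)
    (g' := fun m x => besselTerm (k + 1) z x m) ?_ ?_ (mem_ball_self one_pos)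
    (summable_besselTerm k z y) (mem_ball_self one_pos)
  · intro m x _
    have h1 : HasDerivAt (fun x : ℝ => Complex.exp ((z + 2 * m) * x))
        (Complex.exp ((z + 2 * m) * x) * ((z + 2 * m) * 1)) x :=
      ((Complex.ofRealCLM.hasDerivAt (x := x)).const_mul (z + 2 * (m : ℂ))).cexp
    convert! h1.const_mul ((z + 2 * (m : ℂ)) ^ k * besselCoeff z m) using 1
    simp only [besselTerm]; ring
  · intro m x hx
    refine (norm_besselTerm_le (k + 1) z x m).trans ?_
    rw [mem_ball, Real.dist_eq] at hx
    have hx1 : |x| ≤ |y| + 1 := by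
      have := abs_sub_abs_le_abs_sub x y
      linarith
    have h0 := (besselBound_pos (k + 1) ‖z‖).le
    have h1 : z.re * x ≤ ‖z‖ * (|y| + 1) := by
      calc z.re * x ≤ |z.re| * |x| := by rw [← abs_mul]; exact le_abs_self _
        _ ≤ _ := by gcongr; exact Complex.abs_re_le_norm z
    have h2 : x ≤ |y| + 1 := (le_abs_self x).trans hx1
    have h3 := Real.exp_le_exp.2 h1
    gcongr

lemma continuous_besselSeries (k : ℕ) (z : ℂ) : Continuous (besselSeries k z) :=
  continuous_iff_continuousAt.2 fun y => (hasDerivAt_besselSeries k z y).continuousAt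

lemma differentiable_besselSeries (k : ℕ) (y : ℝ) :
    Differentiable ℂ fun z => besselSeries k z y := by
  intro z
  have hu : Summable fun m : ℕ => besselBound k (‖z‖ + 1) * Real.exp ((‖z‖ + 1) * |y|)
      * ((Real.exp (2 * k + 2 * y)) ^ m / m.factorial) :=
    (Real.summable_pow_div_factorial _).mul_left _
  refine (Complex.differentiableOn_tsum_of_summable_norm hu (F := fun m z => besselTerm k z y m)
    (U := ball 0 (‖z‖ + 1)) ?_ isOpen_ball ?_).differentiableAt
    (isOpen_ball.mem_nhds (by simp))
  · intro m
    have h1 : Differentiable ℂ fun z : ℂ => (Complex.Gamma (z + m + 1))⁻¹ :=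
      Complex.differentiable_one_div_Gamma.comp ((differentiable_id.add_const _).add_const _)
    have h2 : (fun z => besselTerm k z y m) = fun z : ℂ => (z + 2 * m) ^ k
        * (((-1) ^ m / (m.factorial : ℂ)) * (Complex.Gamma (z + m + 1))⁻¹)
        * Complex.exp ((z + 2 * m) * y) := by
      funext z
      simp only [besselTerm, besselCoeff, div_eq_mul_inv, mul_inv]
      ring
    rw [h2]
    apply Differentiable.differentiableOn
    fun_prop
  · intro m w hw
    rw [mem_ball_zero_iff] at hw
    refine (norm_besselTerm_le k w y m).trans ?_
    have h0 := besselBound_mono k (norm_nonneg w) hw.le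
    have h1 := (besselBound_pos k (‖z‖ + 1)).le
    have h2 : w.re * y ≤ (‖z‖ + 1) * |y| := by
      calc w.re * y ≤ |w.re| * |y| := by rw [← abs_mul]; exact le_abs_self _
        _ ≤ _ := by gcongr; exact (Complex.abs_re_le_norm w).trans hw.le
    have h3 := Real.exp_le_exp.2 h2
    gcongr

/-- This is the functional equation of $1/\Gamma$, which holds at the poles of $\Gamma$ as well, so
negative integer orders need no separate treatment. -/
lemma besselCoeff_succ (z : ℂ) (m : ℕ) :
    ((m : ℂ) + 1) * (z + m + 1) * besselCoeff z (m + 1) = -besselCoeff z m := by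
  have h := Complex.one_div_Gamma_eq_self_mul_one_div_Gamma_add_one (z + m + 1)
  have h1 : z + ((m + 1 : ℕ) : ℂ) + 1 = z + m + 1 + 1 := by push_cast; ring
  have hm : (m.factorial : ℂ) ≠ 0 := by exact_mod_cast m.factorial_ne_zero
  have hm1 : (m : ℂ) + 1 ≠ 0 := by exact_mod_cast m.succ_ne_zero
  simp only [besselCoeff, div_eq_mul_inv, mul_inv]
  rw [h1, h, Nat.factorial_succ]
  push_cast
  field_simp
  ring

/-- Bessel's equation in logarithmic coordinates. -/
lemma besselSeries_two (z : ℂ) (y : ℝ) :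
    besselSeries 2 z y = (z ^ 2 - 4 * Complex.exp (2 * y)) * besselSeries 0 z y := by
  have h2 := (summable_besselTerm 2 z y)
  have h0 := (summable_besselTerm 0 z y)
  -- Since $(z+2m)^2-z^2=4m(z+m)$, the term $m=0$ drops out; the recurrence identifies the term
  -- $m+1$ with $-4e^{2y}$ times the term $m$ of the original series.
  have hd : ∀ m, besselTerm 2 z y m - z ^ 2 * besselTerm 0 z y m
      = 4 * m * (z + m) * besselCoeff z m * Complex.exp ((z + 2 * m) * y) := by
    intro m; simp only [besselTerm]; ring
  have h3 : besselSeries 2 z y - z ^ 2 * besselSeries 0 z y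
      = ∑' m : ℕ, (besselTerm 2 z y m - z ^ 2 * besselTerm 0 z y m) := by
    rw [(h2.tsum_sub (h0.mul_left _)), tsum_mul_left]; rfl
  have h4 : ∑' m : ℕ, (besselTerm 2 z y m - z ^ 2 * besselTerm 0 z y m)
      = ∑' m : ℕ, -4 * Complex.exp (2 * y) * besselTerm 0 z y m := by
    rw [(h2.sub (h0.mul_left (z ^ 2))).tsum_eq_zero_add]
    have : besselTerm 2 z y 0 - z ^ 2 * besselTerm 0 z y 0 = 0 := by rw [hd]; simp
    rw [this, zero_add]
    refine tsum_congr fun m => ?_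
    rw [hd]
    have he : Complex.exp ((z + 2 * ((m + 1 : ℕ) : ℂ)) * y)
        = Complex.exp (2 * y) * Complex.exp ((z + 2 * m) * y) := by
      rw [← Complex.exp_add]; congr 1; push_cast; ring
    rw [he]
    simp only [besselTerm]
    push_cast
    linear_combination 4 * Complex.exp (2 * y) * Complex.exp ((z + 2 * m) * y) * besselCoeff_succ z m
  rw [h4, tsum_mul_left] at h3
  have h5 : ∑' m, besselTerm 0 z y m = besselSeries 0 z y := rfl
  rw [h5] at h3
  linear_combination h3

/-- In the coordinate $y=\log(t/2)$ the powers $(t/2)^{z+2m}$ are exponentials, and differentiation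
in $y$ multiplies each term by $z+2m$. -/
lemma besselJ_eq_besselSeries {lam : ℝ} (hlam : 0 < lam) (z : ℂ) (x : ℝ) :
    besselJ z (Real.sqrt lam * Real.exp (-x))
      = besselSeries 0 z (Real.log (Real.sqrt lam / 2) - x) := by
  have hs : 0 < Real.sqrt lam / 2 := by positivity
  rw [besselJ, besselSeries]
  refine tsum_congr fun m => ?_
  have h : Real.sqrt lam * Real.exp (-x) / 2 = Real.exp (Real.log (Real.sqrt lam / 2) - x) := by
    rw [sub_eq_add_neg, Real.exp_add, Real.exp_log hs]; ring
  rw [h, besselTerm, pow_zero, one_mul, besselCoeff,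
    Complex.cpow_def_of_ne_zero (by exact_mod_cast (Real.exp_pos _).ne'), ← Complex.ofReal_log
      (Real.exp_pos _).le, Real.log_exp, mul_comm (z + 2 * (m : ℂ))]

/-- For a negative integer order the first coefficients vanish; for $m>|z|$ the argument of $\Gamma$
has positive real part. -/
lemma exists_besselCoeff_ne_zero (z : ℂ) : ∃ m, besselCoeff z m ≠ 0 := by
  obtain ⟨m, hm⟩ := exists_nat_gt ‖z‖
  refine ⟨m, ?_⟩
  have h1 : 0 < (z + m + 1).re := by
    have := Complex.abs_re_le_norm z
    have := neg_abs_le z.re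
    simp
    linarith
  have h2 := Complex.Gamma_ne_zero_of_re_pos h1
  have hm : (m.factorial : ℂ) ≠ 0 := by exact_mod_cast m.factorial_ne_zero
  unfold besselCoeff
  exact div_ne_zero (pow_ne_zero _ (by norm_num)) (mul_ne_zero hm h2)

/-- The Bessel function does not vanish identically near the singular point `0`. -/
lemma exists_besselSeries_ne_zero (z : ℂ) (Y : ℝ) : ∃ y ≤ Y, besselSeries 0 z y ≠ 0 := by
  classical
  have hex := exists_besselCoeff_ne_zero z
  set m₀ := Nat.find hex with hm₀
  have hne : besselCoeff z m₀ ≠ 0 := Nat.find_spec hex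
  have hlt : ∀ m < m₀, besselCoeff z m = 0 := fun m hm => not_not.1 (Nat.find_min hex hm)
  -- Factoring out the first nonzero term leaves a power series in $e^{2y}$ that tends to
  -- $c_{m_0}\ne0$ as $y\to-\infty$.
  have hS : ∀ y, besselSeries 0 z y = Complex.exp ((z + 2 * m₀) * y)
      * ∑' j : ℕ, besselCoeff z (j + m₀) * (Complex.exp (2 * y)) ^ j := by
    intro y
    rw [besselSeries, ← (summable_besselTerm 0 z y).sum_add_tsum_nat_add m₀, ← tsum_mul_left]
    rw [Finset.sum_eq_zero fun m hm => by
      rw [besselTerm, hlt m (Finset.mem_range.1 hm)]; simp, zero_add]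
    refine tsum_congr fun j => ?_
    rw [besselTerm, ← Complex.exp_nat_mul, mul_left_comm, ← Complex.exp_add]
    simp only [pow_zero, one_mul]
    congr 2
    push_cast; ring
  have hlim : Tendsto (fun y : ℝ => ∑' j : ℕ, besselCoeff z (j + m₀) * (Complex.exp (2 * y)) ^ j)
      atBot (𝓝 (∑' j : ℕ, besselCoeff z (j + m₀) * 0 ^ j)) := by
    refine tendsto_tsum_of_dominated_convergence
      (bound := fun j : ℕ => Real.exp (besselGrowth * (1 + ‖z‖) ^ (3 / 2 : ℝ)) *
        (1 ^ j / (j.factorial : ℝ))) ((Real.summable_pow_div_factorial 1).mul_left _) ?_ ?_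
    · intro j
      refine Tendsto.const_mul _ (Tendsto.pow ?_ j)
      rw [tendsto_zero_iff_norm_tendsto_zero]
      have : ∀ y : ℝ, ‖Complex.exp (2 * y)‖ = Real.exp (2 * y) := by
        intro y; rw [Complex.norm_exp]; simp
      simp only [this]
      exact Real.tendsto_exp_atBot.comp (tendsto_id.const_mul_atBot (by norm_num))
    · filter_upwards [eventually_le_atBot 0] with y hy j
      have h1 : ‖Complex.exp (2 * y)‖ ≤ 1 := by
        rw [Complex.norm_exp, Real.exp_le_one_iff]; simp; linarith
      rw [norm_mul, norm_pow, one_pow]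
      calc _ ≤ Real.exp (besselGrowth * (1 + ‖z‖) ^ (3 / 2 : ℝ)) / ((j + m₀).factorial : ℝ) * 1 := by
            gcongr
            · exact norm_besselCoeff_le z _
            · exact pow_le_one₀ (norm_nonneg _) h1
        _ ≤ Real.exp (besselGrowth * (1 + ‖z‖) ^ (3 / 2 : ℝ)) / (j.factorial : ℝ) * 1 := by
            gcongr; omega
        _ = _ := by ring
  have h0 : ∑' j : ℕ, besselCoeff z (j + m₀) * (0 : ℂ) ^ j = besselCoeff z m₀ := by
    rw [tsum_eq_single 0 fun j hj => by simp [hj]]; simp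
  rw [h0] at hlim
  obtain ⟨y, hy, hyY⟩ := ((hlim.eventually_ne hne).and (eventually_le_atBot Y)).exists
  exact ⟨y, hyY, by rw [hS]; exact mul_ne_zero (Complex.exp_ne_zero _) hy⟩

/-- Rests on $\Gamma(x+m+2)\ge(x+1)\Gamma(x+1)$. The gain $1/(x+1)$ makes every term after the
leading one negligible for large order. -/
lemma Gamma_mul_besselCoeff_norm_le {x : ℝ} (hx : 0 ≤ x) (m : ℕ) :
    ‖Complex.Gamma (x + 1) * besselCoeff x (m + 1)‖ ≤ 1 / (x + 1) / (m + 1).factorial := by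
  have hreal : ∀ k : ℕ, Complex.Gamma ((x : ℂ) + k + 1) = (Real.Gamma (x + k + 1) : ℂ) := by
    intro k; rw [← Complex.Gamma_ofReal]; push_cast; rfl
  have hpos : ∀ k : ℕ, 0 < Real.Gamma (x + k + 1) := fun k => Real.Gamma_pos_of_pos (by positivity)
  have hrec : ∀ k : ℕ, (x + 1) * Real.Gamma (x + 1) ≤ Real.Gamma (x + (k + 1 : ℕ) + 1) := by
    intro k
    induction k with
    | zero =>
      have := Real.Gamma_add_one (s := x + 1) (by positivity)
      simp only [zero_add, Nat.cast_one]
      rw [this]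
    | succ k ih =>
      have := Real.Gamma_add_one (s := x + (k + 1 : ℕ) + 1) (by positivity)
      have h2 : x + ((k + 1 + 1 : ℕ) : ℝ) + 1 = x + ((k + 1 : ℕ) : ℝ) + 1 + 1 := by push_cast; ring
      rw [h2, this]
      have := hpos (k + 1)
      refine ih.trans (le_mul_of_one_le_left this.le ?_)
      have : (0 : ℝ) ≤ ((k + 1 : ℕ) : ℝ) := by positivity
      linarith
  have h0 := hreal 0
  simp only [Nat.cast_zero, add_zero] at h0
  have hp0 : 0 < Real.Gamma (x + 1) := Real.Gamma_pos_of_pos (by positivity)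
  rw [besselCoeff, hreal, h0, norm_mul, norm_div, norm_mul, norm_pow, norm_neg, norm_one, one_pow,
    Complex.norm_natCast, Complex.norm_real, Complex.norm_real, Real.norm_eq_abs, Real.norm_eq_abs,
    abs_of_pos hp0, abs_of_pos (hpos _)]
  have hf : (0 : ℝ) < (m + 1).factorial := by positivity
  have hx1 : 0 < x + 1 := by linarith
  rw [mul_one_div, div_div, div_le_div_iff₀ (mul_pos hf (hpos _)) (mul_pos hx1 hf)]
  nlinarith [hrec m]

/-- Asymptotics of the Bessel function for large positive order. -/
lemma norm_Gamma_mul_besselSeries_sub_le {x : ℝ} (hx : 0 ≤ x) (y : ℝ) :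
    ‖Complex.Gamma (x + 1) * besselSeries 0 x y - Complex.exp (x * y)‖
      ≤ Real.exp (x * y) * (Real.exp (Real.exp (2 * y)) / (x + 1)) := by
  have hs := summable_besselTerm 0 (x : ℂ) y
  have hsucc : Summable fun m => Complex.Gamma (x + 1) * besselTerm 0 x y (m + 1) :=
    ((summable_nat_add_iff 1).2 hs).mul_left _
  have hΓ : Complex.Gamma ((x : ℂ) + 1) ≠ 0 :=
    Complex.Gamma_ne_zero_of_re_pos (by simp; linarith)
  have h1 : Complex.Gamma (x + 1) * besselSeries 0 x y - Complex.exp (x * y)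
      = ∑' m : ℕ, Complex.Gamma (x + 1) * besselTerm 0 x y (m + 1) := by
    rw [besselSeries, hs.tsum_eq_zero_add, tsum_mul_left]
    simp only [besselTerm, besselCoeff]
    simp
    field_simp
    ring_nf
  rw [h1]
  have hsum : Summable fun m : ℕ => Real.exp (2 * y) ^ (m + 1) / ((m + 1).factorial : ℝ) :=
    (summable_nat_add_iff 1).2 (Real.summable_pow_div_factorial (Real.exp (2 * y)))
  refine (tsum_of_norm_bounded ((hsum.mul_left (Real.exp (x * y) * (1 / (x + 1)))).hasSum)
    fun m => ?_).trans ?_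
  · rw [besselTerm, pow_zero, one_mul, ← mul_assoc, norm_mul]
    have he : ‖Complex.exp (((x : ℂ) + 2 * ((m + 1 : ℕ) : ℂ)) * y)‖
        = Real.exp (x * y) * Real.exp (2 * y) ^ (m + 1) := by
      rw [Complex.norm_exp, ← Real.exp_nat_mul, ← Real.exp_add]
      congr 1
      simp
      ring
    rw [he]
    calc _ ≤ 1 / (x + 1) / (m + 1).factorial * (Real.exp (x * y) * Real.exp (2 * y) ^ (m + 1)) := by
          gcongr
          exact Gamma_mul_besselCoeff_norm_le hx m
      _ = _ := by ring
  · rw [tsum_mul_left]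
    have h2 : ∑' m : ℕ, Real.exp (2 * y) ^ (m + 1) / ((m + 1).factorial : ℝ)
        ≤ Real.exp (Real.exp (2 * y)) := by
      have h3 : Real.exp (Real.exp (2 * y))
          = ∑' m : ℕ, Real.exp (2 * y) ^ m / (m.factorial : ℝ) := by
        rw [Real.exp_eq_exp_ℝ, NormedSpace.exp_eq_tsum_div]
      rw [h3, (Real.summable_pow_div_factorial (Real.exp (2 * y))).tsum_eq_zero_add]
      simp
    calc _ ≤ Real.exp (x * y) * (1 / (x + 1)) * Real.exp (Real.exp (2 * y)) := by gcongr
      _ = _ := by ring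

end BesselSeries

/-! ### Existence of the kernel of the transformation operator -/

section TransformationKernel

/-- `Q` is a bounded measurable potential supported in `(0, a]`. -/
structure IsCompactPotential (Q : ℝ → ℝ) (a C : ℝ) : Prop where
  measurable : Measurable Q
  a_pos : 0 < a
  bound_nonneg : 0 ≤ C
  abs_le : ∀ s, |Q s| ≤ C
  eq_zero_of_le : ∀ s, s ≤ 0 → Q s = 0
  eq_zero_of_lt : ∀ s, a < s → Q s = 0

lemma IsCompactPotential.integrable {Q : ℝ → ℝ} {a C : ℝ} (h : IsCompactPotential Q a C) :
    Integrable Q := by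
  have h1 : Integrable ((Icc 0 a).indicator fun _ : ℝ => C) :=
    (integrable_indicator_iff measurableSet_Icc).2 (integrableOn_const (by simp))
  refine h1.mono' h.measurable.aestronglyMeasurable (Eventually.of_forall fun s => ?_)
  by_cases hs : s ∈ Icc 0 a
  · rw [indicator_of_mem hs]; exact h.abs_le s
  · rw [indicator_of_notMem hs]
    rcases le_or_gt s 0 with h0 | h0
    · simp [h.eq_zero_of_le s h0]
    · have : a < s := by
        by_contra hh
        exact hs ⟨h0.le, not_lt.1 hh⟩
      simp [h.eq_zero_of_lt s this]

lemma continuous_setIntegral_Ioi {φ : ℝ → ℝ} (hφ : Integrable φ) :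
    Continuous fun x => ∫ s in Ioi x, φ s := by
  simp_rw [← integral_indicator measurableSet_Ioi]
  refine continuous_iff_continuousAt.2 fun x₀ => ?_
  refine continuousAt_of_dominated (bound := fun s => ‖φ s‖)
    (Eventually.of_forall fun x => (hφ.indicator measurableSet_Ioi).aestronglyMeasurable)
    (Eventually.of_forall fun x => Eventually.of_forall fun s => norm_indicator_le_norm_self _ _)
    hφ.norm ?_
  have hne : ∀ᵐ s : ℝ, s ≠ x₀ := by simp [ae_iff]
  filter_upwards [hne] with s hs
  rcases lt_or_gt_of_ne hs with h | h
  · refine (continuousAt_const (y := (0 : ℝ))).congr ?_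
    filter_upwards [lt_mem_nhds h] with x hx
    rw [indicator_of_notMem (by simpa using hx.le)]
  · refine (continuousAt_const (y := φ s)).congr ?_
    filter_upwards [gt_mem_nhds h] with x hx
    rw [indicator_of_mem (by simpa using hx)]

/-- The integral over the quadrant strip `(p.1, ∞) × (0, p.2]` depends continuously on `p`. -/
lemma continuous_setIntegral_Ioi_prod_Ioc {φ : ℝ × ℝ → ℝ} (hφ : Integrable φ) :
    Continuous fun p : ℝ × ℝ => ∫ r in Ioi p.1 ×ˢ Ioc 0 p.2, φ r := by
  have hm : ∀ p : ℝ × ℝ, MeasurableSet (Ioi p.1 ×ˢ Ioc 0 p.2) :=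
    fun p => measurableSet_Ioi.prod measurableSet_Ioc
  have hind : ∀ p : ℝ × ℝ, ∫ r in Ioi p.1 ×ˢ Ioc 0 p.2, φ r
      = ∫ r, (Ioi p.1 ×ˢ Ioc 0 p.2).indicator φ r := fun p => (integral_indicator (hm p)).symm
  simp_rw [hind]
  refine continuous_iff_continuousAt.2 fun p₀ => ?_
  refine continuousAt_of_dominated (bound := fun s => ‖φ s‖)
    (Eventually.of_forall fun x => (hφ.indicator (hm x)).aestronglyMeasurable)
    (Eventually.of_forall fun x => Eventually.of_forall fun s => norm_indicator_le_norm_self _ _)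
    hφ.norm ?_
  -- Away from the null lines $r_1=p_{0,1}$ and $r_2=p_{0,2}$ the indicator at $r$ is constant for
  -- $p$ near $p_0$.
  have hne₁ : ∀ᵐ r : ℝ × ℝ, r.1 ≠ p₀.1 :=
    Measure.quasiMeasurePreserving_fst.ae (p := fun s : ℝ => s ≠ p₀.1) (by simp [ae_iff])
  have hne₂ : ∀ᵐ r : ℝ × ℝ, r.2 ≠ p₀.2 :=
    Measure.quasiMeasurePreserving_snd.ae (p := fun s : ℝ => s ≠ p₀.2) (by simp [ae_iff])
  filter_upwards [hne₁, hne₂] with r h1 h2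
  by_cases hr : r ∈ Ioi p₀.1 ×ˢ Ioc 0 p₀.2
  · obtain ⟨hr1, hr2, hr3⟩ := hr
    refine (continuousAt_const (y := φ r)).congr ?_
    filter_upwards [continuous_fst.continuousAt.eventually (gt_mem_nhds hr1),
      continuous_snd.continuousAt.eventually (lt_mem_nhds (lt_of_le_of_ne hr3 h2))] with p hp1 hp2
    exact (indicator_of_mem (show r ∈ Ioi p.1 ×ˢ Ioc 0 p.2 from ⟨hp1, hr2, hp2.le⟩) φ).symm
  · refine (continuousAt_const (y := (0 : ℝ))).congr ?_
    by_cases hr1 : p₀.1 < r.1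
    · by_cases hr2 : 0 < r.2
      · have hr3 : p₀.2 < r.2 := by
          by_contra hh
          exact hr ⟨hr1, hr2, not_lt.1 hh⟩
        filter_upwards [continuous_snd.continuousAt.eventually (gt_mem_nhds hr3)] with p hp
        rw [indicator_of_notMem]
        rintro ⟨_, _, h⟩
        exact absurd hp (not_lt.2 h)
      · filter_upwards with p
        rw [indicator_of_notMem]
        rintro ⟨_, h, _⟩
        exact hr2 h
    · have : r.1 < p₀.1 := lt_of_le_of_ne (not_lt.1 hr1) h1
      filter_upwards [continuous_fst.continuousAt.eventually (lt_mem_nhds this)] with p hp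
      rw [indicator_of_notMem]
      rintro ⟨h, _⟩
      exact absurd hp (not_lt.2 (le_of_lt h))

/-- The coefficient of the kernel equation in characteristic coordinates, cut off to the
triangle where the kernel lives. -/
def kernelWeight (lam : ℝ) (Q : ℝ → ℝ) (a : ℝ) : ℝ × ℝ → ℝ :=
  {r : ℝ × ℝ | 0 < r.2 ∧ r.2 < r.1 ∧ r.1 < a}.indicator fun r =>
    (referencePotential lam (r.1 - r.2) + Q (r.1 - r.2)) - referencePotential lam (r.1 + r.2)

lemma measurableSet_triangle (a : ℝ) :
    MeasurableSet {r : ℝ × ℝ | 0 < r.2 ∧ r.2 < r.1 ∧ r.1 < a} :=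
  (measurableSet_lt measurable_const measurable_snd).inter
    ((measurableSet_lt measurable_snd measurable_fst).inter
      (measurableSet_lt measurable_fst measurable_const))

lemma measurable_referencePotential (lam : ℝ) : Measurable (referencePotential lam) := by
  unfold referencePotential; fun_prop

lemma abs_referencePotential_le {lam : ℝ} (hlam : 0 < lam) {x : ℝ} (hx : 0 ≤ x) :
    |referencePotential lam x| ≤ lam := by
  rw [referencePotential, abs_mul, abs_neg, abs_of_pos hlam, abs_of_pos (Real.exp_pos _)]
  exact mul_le_of_le_one_right hlam.le (Real.exp_le_one_iff.2 (by linarith))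

variable {lam : ℝ} {Q : ℝ → ℝ} {a C : ℝ}

lemma measurable_kernelWeight (hQ : IsCompactPotential Q a C) :
    Measurable (kernelWeight lam Q a) := by
  refine Measurable.indicator ?_ (measurableSet_triangle a)
  have := hQ.measurable
  have := measurable_referencePotential lam
  fun_prop

lemma abs_kernelWeight_le (hlam : 0 < lam) (hQ : IsCompactPotential Q a C) (r : ℝ × ℝ) :
    |kernelWeight lam Q a r| ≤ C + 2 * lam := by
  have := hQ.bound_nonneg
  unfold kernelWeight
  by_cases hr : r ∈ {r : ℝ × ℝ | 0 < r.2 ∧ r.2 < r.1 ∧ r.1 < a}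
  · rw [indicator_of_mem hr]
    obtain ⟨h1, h2, _⟩ := hr
    have e1 := abs_referencePotential_le hlam (show 0 ≤ r.1 - r.2 by linarith)
    have e2 := abs_referencePotential_le hlam (show 0 ≤ r.1 + r.2 by linarith)
    have e3 := hQ.abs_le (r.1 - r.2)
    rw [abs_le] at e1 e2 e3 ⊢
    constructor <;> linarith [e1.1, e1.2, e2.1, e2.2, e3.1, e3.2]
  · rw [indicator_of_notMem hr, abs_zero]; positivity

lemma kernelWeight_eq_zero {r : ℝ × ℝ} (h : ¬(0 < r.2 ∧ r.2 < r.1 ∧ r.1 < a)) :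
    kernelWeight lam Q a r = 0 :=
  indicator_of_notMem (s := {r : ℝ × ℝ | 0 < r.2 ∧ r.2 < r.1 ∧ r.1 < a}) h _

lemma integrable_kernelWeight_mul (hlam : 0 < lam) (hQ : IsCompactPotential Q a C)
    {F : ℝ × ℝ → ℝ} (hF : Continuous F) : Integrable fun r => kernelWeight lam Q a r * F r := by
  have h1 : IntegrableOn F (Icc 0 a ×ˢ Icc 0 a) :=
    hF.continuousOn.integrableOn_compact (isCompact_Icc.prod isCompact_Icc)
  have h2 : Integrable ((Icc 0 a ×ˢ Icc 0 a).indicator F) :=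
    (integrable_indicator_iff (measurableSet_Icc.prod measurableSet_Icc)).2 h1
  refine (h2.bdd_mul (c := C + 2 * lam)
    (measurable_kernelWeight (lam := lam) hQ).aestronglyMeasurable
    (Eventually.of_forall fun r => abs_kernelWeight_le hlam hQ r)).congr
    (Eventually.of_forall fun r => ?_)
  by_cases hr : 0 < r.2 ∧ r.2 < r.1 ∧ r.1 < a
  · have : r ∈ Icc 0 a ×ˢ Icc 0 a :=
      ⟨⟨by linarith [hr.1, hr.2.1], hr.2.2.le⟩, ⟨hr.1.le, by linarith [hr.2.1, hr.2.2]⟩⟩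
    simp only [indicator_of_mem this]
  · simp only [kernelWeight_eq_zero hr, zero_mul]

/-- The inhomogeneous term of the kernel equation. -/
def kernelSource (Q : ℝ → ℝ) (x : ℝ) : ℝ := 1 / 2 * ∫ s in Ioi x, Q s

lemma kernelSource_eq_zero (hQ : IsCompactPotential Q a C) {x : ℝ} (hx : a ≤ x) :
    kernelSource Q x = 0 := by
  have : ∫ s in Ioi x, Q s = 0 := setIntegral_eq_zero_of_forall_eq_zero fun s hs =>
    hQ.eq_zero_of_lt s (lt_of_le_of_lt hx hs)
  rw [kernelSource, this, mul_zero]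

/-- The integral equation for the kernel in characteristic coordinates, after multiplication
by the exponential weight `exp (μ α)`. -/
def weightedKernelMap (lam : ℝ) (Q : ℝ → ℝ) (a μ : ℝ) (G : ℝ × ℝ → ℝ) (p : ℝ × ℝ) : ℝ :=
  Real.exp (μ * p.1) * (kernelSource Q p.1
    + ∫ r in Ioi p.1 ×ˢ Ioc 0 p.2, kernelWeight lam Q a r * (Real.exp (-μ * r.1) * G r))

lemma continuous_weightedKernelMap (hlam : 0 < lam) (hQ : IsCompactPotential Q a C) (μ : ℝ)
    {G : ℝ × ℝ → ℝ} (hG : Continuous G) : Continuous (weightedKernelMap lam Q a μ G) := by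
  have h1 := continuous_setIntegral_Ioi_prod_Ioc (integrable_kernelWeight_mul hlam hQ
    (F := fun r => Real.exp (-μ * r.1) * G r) (by fun_prop))
  have h2 : Continuous (kernelSource Q) := continuous_const.mul
    (continuous_setIntegral_Ioi hQ.integrable)
  unfold weightedKernelMap
  fun_prop

/-- The integral of $e^{-\mu\alpha}$ over $\alpha>p_1$ is $e^{-\mu p_1}/\mu$: the prefactor cancels
the exponential and a small factor $1/\mu$ remains. The $\beta$-integral costs at most $a$, as the
coefficient lives on a triangle. This is the source of the contraction. -/
lemma abs_weighted_integral_le (hlam : 0 < lam) (hQ : IsCompactPotential Q a C) {μ : ℝ}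
    (hμ : 0 < μ) {G : ℝ × ℝ → ℝ} {N : ℝ} (hN : ∀ r, |G r| ≤ N) (p : ℝ × ℝ) :
    |Real.exp (μ * p.1) *
      ∫ r in Ioi p.1 ×ˢ Ioc 0 p.2, kernelWeight lam Q a r * (Real.exp (-μ * r.1) * G r)|
      ≤ (C + 2 * lam) * a / μ * N := by
  have hC := hQ.bound_nonneg
  have ha := hQ.a_pos
  have hN0 : 0 ≤ N := (abs_nonneg _).trans (hN p)
  set g : ℝ × ℝ → ℝ := fun r => Real.exp (-μ * r.1) * (Ioc 0 a).indicator (fun _ => 1) r.2 with hg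
  have hprod : ∫ r in Ioi p.1 ×ˢ (univ : Set ℝ), g r = Real.exp (-μ * p.1) / μ * a := by
    rw [hg, Measure.volume_eq_prod, setIntegral_prod_mul (fun x : ℝ => Real.exp (-μ * x))
      ((Ioc 0 a).indicator fun _ => (1 : ℝ)) (Ioi p.1) univ]
    rw [integral_exp_mul_Ioi (by linarith : -μ < 0)]
    rw [Measure.restrict_univ, integral_indicator measurableSet_Ioc]
    simp [ha.le]
  have hgint : IntegrableOn g (Ioi p.1 ×ˢ (univ : Set ℝ)) := by
    rw [IntegrableOn, Measure.volume_eq_prod, ← Measure.prod_restrict]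
    refine Integrable.mul_prod (integrableOn_exp_mul_Ioi (by linarith) _) ?_
    rw [Measure.restrict_univ]
    exact (integrable_indicator_iff measurableSet_Ioc).2 (integrableOn_const (by simp))
  have hle : |∫ r in Ioi p.1 ×ˢ Ioc 0 p.2, kernelWeight lam Q a r * (Real.exp (-μ * r.1) * G r)|
      ≤ (C + 2 * lam) * N * (Real.exp (-μ * p.1) / μ * a) := by
    rw [← hprod, ← integral_const_mul]
    rw [← Real.norm_eq_abs]
    refine (norm_integral_le_of_norm_le (g := fun r => (C + 2 * lam) * N * g r)
      (μ := volume.restrict (Ioi p.1 ×ˢ Ioc 0 p.2))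
      ((hgint.mono_set (prod_mono_right (subset_univ _))).const_mul _)
      (Eventually.of_forall fun r => ?_)).trans ?_
    · by_cases hr : 0 < r.2 ∧ r.2 < r.1 ∧ r.1 < a
      · have hr2 : r.2 ∈ Ioc 0 a := ⟨hr.1, by linarith [hr.2.1, hr.2.2]⟩
        simp only [hg, indicator_of_mem hr2, norm_mul, Real.norm_eq_abs, Real.abs_exp, mul_one]
        calc |kernelWeight lam Q a r| * (Real.exp (-μ * r.1) * |G r|)
            ≤ (C + 2 * lam) * (Real.exp (-μ * r.1) * N) := by
              gcongr
              · exact abs_kernelWeight_le hlam hQ r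
              · exact hN r
          _ = _ := by ring
      · rw [kernelWeight_eq_zero hr, zero_mul, norm_zero]
        have : 0 ≤ (Ioc 0 a).indicator (fun _ => (1 : ℝ)) r.2 :=
          indicator_nonneg (fun _ _ => zero_le_one) _
        simp only [hg]
        positivity
    · refine setIntegral_mono_set (hgint.const_mul _) (Eventually.of_forall fun r => ?_)
        (prod_mono_right (subset_univ _)).eventuallyLE
      have : 0 ≤ (Ioc 0 a).indicator (fun _ => (1 : ℝ)) r.2 :=
        indicator_nonneg (fun _ _ => zero_le_one) _
      simp only [hg, Pi.zero_apply]
      positivity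
  rw [abs_mul, Real.abs_exp]
  calc _ ≤ Real.exp (μ * p.1) * ((C + 2 * lam) * N * (Real.exp (-μ * p.1) / μ * a)) := by gcongr
    _ = (Real.exp (μ * p.1) * Real.exp (-μ * p.1)) * ((C + 2 * lam) * a / μ * N) := by ring
    _ = _ := by rw [← Real.exp_add]; simp

/-- The weight is unbounded as $x\to\infty$, but the source vanishes for $x\ge a$. -/
lemma abs_weighted_source_le (hQ : IsCompactPotential Q a C) {μ : ℝ} (hμ : 0 < μ) (x : ℝ) :
    |Real.exp (μ * x) * kernelSource Q x| ≤ Real.exp (μ * a) * ∫ s, |Q s| := by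
  have hI : 0 ≤ ∫ s, |Q s| := integral_nonneg fun s => abs_nonneg _
  rcases le_or_gt a x with h | h
  · rw [kernelSource_eq_zero hQ h, mul_zero, abs_zero]; positivity
  · rw [abs_mul, Real.abs_exp]
    gcongr
    rw [kernelSource, abs_mul]
    have h1 : |∫ s in Ioi x, Q s| ≤ ∫ s, |Q s| :=
      (norm_integral_le_integral_norm _).trans
        (setIntegral_le_integral hQ.integrable.norm (Eventually.of_forall fun s => norm_nonneg _))
    have h2 : |(1 / 2 : ℝ)| = 1 / 2 := by norm_num
    rw [h2]
    linarith

/-- The fixed point of the weighted kernel equation. -/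
lemma exists_weighted_fixed_point (hlam : 0 < lam) (hQ : IsCompactPotential Q a C) :
    ∃ (μ : ℝ) (G : ℝ × ℝ → ℝ), Continuous G ∧ ∀ p, G p = weightedKernelMap lam Q a μ G p := by
  have hC := hQ.bound_nonneg
  have ha := hQ.a_pos
  -- Large enough for the contraction constant to be at most $1/2$.
  set μ : ℝ := 2 * ((C + 2 * lam) * a) + 1 with hμ
  have hμ0 : 0 < μ := by positivity
  have hhalf : (C + 2 * lam) * a / μ ≤ 1 / 2 := by
    rw [div_le_iff₀ hμ0]; linarith
  have hsplit : ∀ (G : ℝ × ℝ → ℝ) (p : ℝ × ℝ), weightedKernelMap lam Q a μ G p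
      = Real.exp (μ * p.1) * kernelSource Q p.1 + Real.exp (μ * p.1) *
        ∫ r in Ioi p.1 ×ˢ Ioc 0 p.2, kernelWeight lam Q a r * (Real.exp (-μ * r.1) * G r) := by
    intro G p; rw [weightedKernelMap, mul_add]
  let Φ : BoundedContinuousFunction (ℝ × ℝ) ℝ → BoundedContinuousFunction (ℝ × ℝ) ℝ := fun G =>
    BoundedContinuousFunction.ofNormedAddCommGroup (weightedKernelMap lam Q a μ G)
      (continuous_weightedKernelMap hlam hQ μ G.continuous)
      (Real.exp (μ * a) * (∫ s, |Q s|) + (C + 2 * lam) * a / μ * ‖G‖) (fun p => by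
        rw [hsplit]
        exact (norm_add_le _ _).trans (add_le_add (abs_weighted_source_le hQ hμ0 _)
          (abs_weighted_integral_le hlam hQ hμ0 (fun r => G.norm_coe_le_norm r) p)))
  have hΦ : ContractingWith (1 / 2) Φ := by
    refine ⟨by norm_num [← NNReal.coe_lt_coe], LipschitzWith.of_dist_le_mul fun G₁ G₂ => ?_⟩
    rw [BoundedContinuousFunction.dist_le (by positivity)]
    intro p
    have e : Φ G₁ p - Φ G₂ p = Real.exp (μ * p.1) * ∫ r in Ioi p.1 ×ˢ Ioc 0 p.2,
        kernelWeight lam Q a r * (Real.exp (-μ * r.1) * (G₁ r - G₂ r)) := by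
      change weightedKernelMap lam Q a μ G₁ p - weightedKernelMap lam Q a μ G₂ p = _
      rw [hsplit, hsplit, add_sub_add_left_eq_sub, ← mul_sub, ← integral_sub]
      · simp_rw [mul_sub]
      · exact (integrable_kernelWeight_mul hlam hQ
          (F := fun r => Real.exp (-μ * r.1) * G₁ r) (by fun_prop)).integrableOn
      · exact (integrable_kernelWeight_mul hlam hQ
          (F := fun r => Real.exp (-μ * r.1) * G₂ r) (by fun_prop)).integrableOn
    rw [Real.dist_eq, e]
    refine (abs_weighted_integral_le hlam hQ hμ0 (G := fun r => G₁ r - G₂ r) (N := dist G₁ G₂)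
      (fun r => by rw [← Real.dist_eq]; exact BoundedContinuousFunction.dist_coe_le_dist r)
      p).trans ?_
    have : ((1 / 2 : NNReal) : ℝ) = 1 / 2 := by norm_num
    rw [this]
    gcongr
  refine ⟨μ, hΦ.fixedPoint, (hΦ.fixedPoint (f := Φ)).continuous, fun p => ?_⟩
  exact (congrArg (fun G : BoundedContinuousFunction (ℝ × ℝ) ℝ => G p)
    hΦ.fixedPoint_isFixedPt).symm

/-- Existence of the kernel of the transformation operator. -/
theorem exists_isTransformationKernel (hlam : 0 < lam) (hQ : IsCompactPotential Q a C) :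
    ∃ K, IsTransformationKernel lam Q K := by
  obtain ⟨μ, G, hG, hfix⟩ := exists_weighted_fixed_point hlam hQ
  -- Undoing the weight gives the kernel in the characteristic coordinates $\alpha=(t+x)/2$,
  -- $\beta=(t-x)/2$.
  set H : ℝ × ℝ → ℝ := fun r => Real.exp (-μ * r.1) * G r with hH
  have hHc : Continuous H := by fun_prop
  have hHfix : ∀ p : ℝ × ℝ, H p = kernelSource Q p.1
      + ∫ r in Ioi p.1 ×ˢ Ioc 0 p.2, kernelWeight lam Q a r * H r := by
    intro p
    have : H p = Real.exp (-μ * p.1) * G p := rfl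
    rw [this, hfix p, weightedKernelMap, ← mul_assoc, ← Real.exp_add]
    simp [hH]
  have hH0 : ∀ p : ℝ × ℝ, a ≤ p.1 → H p = 0 := by
    intro p hp
    rw [hHfix, kernelSource_eq_zero hQ hp, zero_add]
    refine setIntegral_eq_zero_of_forall_eq_zero fun r hr => ?_
    rw [kernelWeight_eq_zero, zero_mul]
    rintro ⟨_, _, h⟩
    have : p.1 < r.1 := hr.1
    linarith
  refine ⟨fun x t => H ((t + x) / 2, (t - x) / 2), ?_, ⟨a, hQ.a_pos, ?_⟩, ?_⟩
  · exact Continuous.continuousOn (by fun_prop)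
  · intro x t _ _ h
    exact hH0 _ (by simp only; linarith)
  · intro x t hx hxt
    rw [hHfix, kernelMap, kernelSource]
    congr 1
    have hint := integrable_kernelWeight_mul (lam := lam) hlam hQ hHc
    rw [Measure.volume_eq_prod, setIntegral_prod _ (by
      rw [← Measure.volume_eq_prod]; exact hint.integrableOn)]
    refine setIntegral_congr_fun measurableSet_Ioi fun α hα => ?_
    rw [intervalIntegral.integral_of_le (by linarith)]
    refine setIntegral_congr_fun measurableSet_Ioc fun β hβ => ?_
    have hα' : (t + x) / 2 < α := hα
    rw [show (α + β + (α - β)) / 2 = α by ring, show (α + β - (α - β)) / 2 = β by ring]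
    -- The cut-off coefficient differs from the true one only for $\alpha\ge a$, where $H$ vanishes;
    -- the condition $\beta<\alpha$ is automatic from $x\ge0$.
    rcases le_or_gt a α with h | h
    · rw [hH0 _ h, mul_zero, mul_zero]
    · congr 1
      exact indicator_of_mem (show (α, β) ∈ {r : ℝ × ℝ | 0 < r.2 ∧ r.2 < r.1 ∧ r.1 < a} from
        ⟨hβ.1, by simp only; linarith [hβ.2], h⟩) _

end TransformationKernel

/-! ### Superpositions of free solutions -/

section LayerIntegral

/-- The superposition, with density `ω`, of the functions `x ↦ F (S p) (Y p - x)`, cut off at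
`x = Y p`. -/
def layerIntegral {Ω : Type*} [MeasurableSpace Ω] (μ : Measure Ω) (ω : Ω → ℂ) (Y S : Ω → ℝ)
    (F : ℝ → ℝ → ℂ) (x : ℝ) : ℂ :=
  ∫ p, ω p * (if x < Y p then F (S p) (Y p - x) else 0) ∂μ

/-- The data of a layer integral: an integrable density, concentrated where `Y` and `S` are
bounded. -/
structure IsLayerData {Ω : Type*} [MeasurableSpace Ω] (μ : Measure Ω) (ω : Ω → ℂ) (Y S : Ω → ℝ)
    (M : ℝ) : Prop where
  integrable : Integrable ω μ
  measurable_left : Measurable Y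
  measurable_right : Measurable S
  abs_le_and : ∀ p, ω p ≠ 0 → |Y p| ≤ M ∧ |S p| ≤ M

/-- The fundamental theorem of calculus for $y\mapsto F(Y-y)$ on $[0,x]$, cut off at $y=Y$. The last
term is the jump $F(0)$, picked up when the cut-off point lies in $(0,x]$. -/
lemma layer_pointwise {F κ : ℝ → ℂ} (hκ : Continuous κ) (hF : ∀ h, HasDerivAt F (κ h) h)
    (Y : ℝ) {x : ℝ} (hx : 0 ≤ x) :
    (if 0 < Y then F (Y - 0) else 0) = (if x < Y then F (Y - x) else 0)
      + (∫ y in (0 : ℝ)..x, if y < Y then κ (Y - y) else 0)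
      + (if 0 < Y ∧ Y ≤ x then F 0 else 0) := by
  have hderiv : ∀ y, HasDerivAt (fun y => F (Y - y)) (-κ (Y - y)) y := by
    intro y
    have := (hF (Y - y)).scomp y ((hasDerivAt_id y).const_sub Y)
    rw [neg_smul, one_smul] at this
    exact this
  have hint : ∀ m, ∫ y in (0 : ℝ)..m, κ (Y - y) = F Y - F (Y - m) := by
    intro m
    have := intervalIntegral.integral_eq_sub_of_hasDerivAt (a := 0) (b := m)
      (fun y _ => hderiv y) (Continuous.intervalIntegrable (by fun_prop) _ _)
    rw [intervalIntegral.integral_neg] at this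
    simp only [sub_zero] at this
    linear_combination -this
  rcases le_or_gt Y 0 with hY | hY
  · have h0 : ∫ y in (0 : ℝ)..x, (if y < Y then κ (Y - y) else 0) = 0 := by
      rw [intervalIntegral.integral_congr (g := fun _ => 0)]
      · simp
      · intro y hy
        rw [uIcc_of_le hx] at hy
        simp [not_lt.2 (hY.trans hy.1)]
    rw [h0, if_neg (not_lt.2 hY), if_neg (not_lt.2 (hY.trans hx)), if_neg (fun h => not_lt.2 hY h.1)]
    simp
  rcases lt_or_ge x Y with hxY | hxY
  · have h0 : ∫ y in (0 : ℝ)..x, (if y < Y then κ (Y - y) else 0) = F Y - F (Y - x) := by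
      rw [← hint]
      refine intervalIntegral.integral_congr fun y hy => ?_
      rw [uIcc_of_le hx] at hy
      simp [lt_of_le_of_lt hy.2 hxY]
    rw [h0, if_pos hY, if_pos hxY, if_neg (fun h => not_lt.2 h.2 hxY)]
    simp
  · have h0 : ∫ y in (0 : ℝ)..x, (if y < Y then κ (Y - y) else 0) = F Y - F 0 := by
      have e1 := hint Y
      rw [sub_self] at e1
      have e2 : (fun y => if y < Y then κ (Y - y) else 0)
          = (Iio Y).indicator fun y => κ (Y - y) := by
        funext y; simp [indicator_apply]
      have e3 : Ioc 0 x ∩ Iio Y = Ioo 0 Y := by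
        ext y
        simp only [mem_inter_iff, mem_Ioc, mem_Iio, mem_Ioo]
        constructor
        · rintro ⟨⟨h1, _⟩, h3⟩; exact ⟨h1, h3⟩
        · rintro ⟨h1, h3⟩; exact ⟨⟨h1, by linarith⟩, h3⟩
      rw [← e1, intervalIntegral.integral_of_le hx, intervalIntegral.integral_of_le hY.le, e2,
        setIntegral_indicator measurableSet_Iio, e3, integral_Ioc_eq_integral_Ioo]
    rw [h0, if_pos hY, if_neg (not_lt.2 hxY), if_pos ⟨hY, hxY⟩]
    simp

variable {Ω : Type*} [MeasurableSpace Ω] {μ : Measure Ω} {ω : Ω → ℂ} {Y S : Ω → ℝ} {M : ℝ}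

lemma IsLayerData.exists_bound (h : IsLayerData μ ω Y S M) {F : ℝ → ℝ → ℂ}
    (hF : Continuous fun p : ℝ × ℝ => F p.1 p.2) {X : ℝ} :
    ∃ B, 0 ≤ B ∧ ∀ p, ∀ x ∈ Icc 0 X,
      ‖ω p * (if x < Y p then F (S p) (Y p - x) else 0)‖ ≤ B * ‖ω p‖ := by
  obtain ⟨B, hB⟩ := ((isCompact_Icc (a := -M) (b := M)).prod
    (isCompact_Icc (a := -M - X) (b := M))).exists_bound_of_continuousOn hF.continuousOn
  refine ⟨max B 0, le_max_right _ _, fun p x hx => ?_⟩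
  rw [norm_mul, mul_comm]
  by_cases hp : ω p = 0
  · simp [hp]
  gcongr
  obtain ⟨h1, h2⟩ := h.abs_le_and p hp
  split_ifs with hlt
  · refine (hB (S p, Y p - x) ⟨abs_le.1 h2, ?_, ?_⟩).trans (le_max_left _ _)
    · have := (abs_le.1 h1).1; simp only; linarith [hx.2]
    · have := (abs_le.1 h1).2; simp only; linarith [hx.1]
  · simp

lemma IsLayerData.aestronglyMeasurable_uncurry (h : IsLayerData μ ω Y S M) {F : ℝ → ℝ → ℂ}
    (hF : Continuous fun p : ℝ × ℝ => F p.1 p.2) (ν : Measure ℝ) [SFinite ν] [SFinite μ] :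
    AEStronglyMeasurable (fun q : Ω × ℝ =>
      ω q.1 * (if q.2 < Y q.1 then F (S q.1) (Y q.1 - q.2) else 0)) (μ.prod ν) := by
  refine (h.integrable.aestronglyMeasurable.comp_fst).mul ?_
  refine Measurable.aestronglyMeasurable ?_
  refine Measurable.ite ?_ ?_ measurable_const
  · exact measurableSet_lt measurable_snd (h.measurable_left.comp measurable_fst)
  · exact hF.measurable.comp ((h.measurable_right.comp measurable_fst).prodMk
      ((h.measurable_left.comp measurable_fst).sub measurable_snd))

lemma IsLayerData.integrable_slice [SFinite μ] (h : IsLayerData μ ω Y S M) {F : ℝ → ℝ → ℂ}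
    (hF : Continuous fun p : ℝ × ℝ => F p.1 p.2) {x : ℝ} (hx : 0 ≤ x) :
    Integrable (fun p => ω p * (if x < Y p then F (S p) (Y p - x) else 0)) μ := by
  obtain ⟨B, hB, hb⟩ := h.exists_bound (X := x) hF
  refine (h.integrable.norm.const_mul B).mono' ?_
    (Eventually.of_forall fun p => hb p x ⟨hx, le_rfl⟩)
  refine h.integrable.aestronglyMeasurable.mul (Measurable.aestronglyMeasurable ?_)
  refine Measurable.ite ?_ ?_ measurable_const
  · exact measurableSet_lt measurable_const h.measurable_left
  · exact hF.measurable.comp (h.measurable_right.prodMk (h.measurable_left.sub measurable_const))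

lemma IsLayerData.integrable_prod [SFinite μ] (h : IsLayerData μ ω Y S M) {F : ℝ → ℝ → ℂ}
    (hF : Continuous fun p : ℝ × ℝ => F p.1 p.2) {X : ℝ} :
    Integrable (fun q : Ω × ℝ => ω q.1 * (if q.2 < Y q.1 then F (S q.1) (Y q.1 - q.2) else 0))
      (μ.prod (volume.restrict (Ioc 0 X))) := by
  obtain ⟨B, hB, hb⟩ := h.exists_bound (X := X) hF
  have h1 : Integrable (fun q : Ω × ℝ => B * (‖ω q.1‖ * 1)) (μ.prod (volume.restrict (Ioc 0 X))) :=
    (h.integrable.norm.mul_prod (integrable_const 1)).const_mul B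
  refine h1.mono' (h.aestronglyMeasurable_uncurry hF _) ?_
  have h2 : ∀ᵐ q ∂(μ.prod (volume.restrict (Ioc 0 X))), q.2 ∈ Ioc 0 X :=
    Measure.quasiMeasurePreserving_snd.ae (p := fun s : ℝ => s ∈ Ioc 0 X)
      (ae_restrict_mem measurableSet_Ioc)
  filter_upwards [h2] with q hq
  rw [mul_one]
  exact hb q.1 q.2 ⟨hq.1.le, hq.2⟩

lemma IsLayerData.intervalIntegrable [SFinite μ] (h : IsLayerData μ ω Y S M) {F : ℝ → ℝ → ℂ}
    (hF : Continuous fun p : ℝ × ℝ => F p.1 p.2) {X : ℝ} (hX : 0 ≤ X) :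
    IntervalIntegrable (layerIntegral μ ω Y S F) volume 0 X := by
  rw [intervalIntegrable_iff_integrableOn_Ioc_of_le hX]
  exact (h.integrable_prod hF).integral_prod_right

/-- Duhamel's formula for layer integrals. -/
lemma IsLayerData.layerIntegral_zero_eq [SFinite μ] (h : IsLayerData μ ω Y S M)
    {F κ : ℝ → ℝ → ℂ} (hF : Continuous fun p : ℝ × ℝ => F p.1 p.2)
    (hκ : Continuous fun p : ℝ × ℝ => κ p.1 p.2) (hd : ∀ s r, HasDerivAt (F s) (κ s r) r)
    {x : ℝ} (hx : 0 ≤ x) :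
    layerIntegral μ ω Y S F 0 = layerIntegral μ ω Y S F x
      + (∫ y in (0 : ℝ)..x, layerIntegral μ ω Y S κ y)
      + ∫ p, ω p * (if 0 < Y p ∧ Y p ≤ x then F (S p) 0 else 0) ∂μ := by
  have hpt : ∀ p, ω p * (if 0 < Y p ∧ Y p ≤ x then F (S p) 0 else 0)
      = ω p * (if 0 < Y p then F (S p) (Y p - 0) else 0)
        - ω p * (if x < Y p then F (S p) (Y p - x) else 0)
        - ∫ y in Ioc 0 x, ω p * (if y < Y p then κ (S p) (Y p - y) else 0) := by
    intro p
    have := layer_pointwise (F := F (S p)) (κ := κ (S p)) (by fun_prop) (hd (S p)) (Y p) hx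
    rw [integral_const_mul, this, intervalIntegral.integral_of_le hx]
    ring
  have hi := h.integrable_prod (X := x) hκ
  have h3 : ∫ p, (∫ y in Ioc 0 x, ω p * (if y < Y p then κ (S p) (Y p - y) else 0)) ∂μ
      = ∫ y in (0 : ℝ)..x, layerIntegral μ ω Y S κ y := by
    rw [intervalIntegral.integral_of_le hx]
    exact integral_integral_swap hi
  rw [integral_congr_ae (Eventually.of_forall hpt), integral_sub, integral_sub, h3]
  · simp only [layerIntegral]; ring
  · exact h.integrable_slice hF le_rfl
  · exact h.integrable_slice hF hx
  · exact (h.integrable_slice hF le_rfl).sub (h.integrable_slice hF hx)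
  · exact hi.integral_prod_left

/-- The kernel which is superposed from characteristic functions of intervals acts on a function
`u` with primitive `U` as a layer integral. -/
lemma IsLayerData.integral_kernel_mul [SFinite μ] (h : IsLayerData μ ω Y S M)
    (hYS : ∀ p, ω p ≠ 0 → Y p ≤ S p) {u U : ℝ → ℂ} (hu : Continuous u)
    (hU : ∀ t, HasDerivAt U (u t) t) {x : ℝ} :
    IntegrableOn (fun t => (∫ p, ω p *
        (if S p - (Y p - x) ≤ t ∧ t < S p + (Y p - x) then 1 else 0) ∂μ) * u t) (Ici x) ∧
    ∫ t in Ici x, (∫ p, ω p *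
        (if S p - (Y p - x) ≤ t ∧ t < S p + (Y p - x) then 1 else 0) ∂μ) * u t
      = layerIntegral μ ω Y S (fun s r => U (s + r) - U (s - r)) x := by
  have hi : Integrable (fun q : ℝ × Ω => ω q.2 *
      (if S q.2 - (Y q.2 - x) ≤ q.1 ∧ q.1 < S q.2 + (Y q.2 - x) then 1 else 0) * u q.1)
      ((volume.restrict (Ici x)).prod μ) := by
    have hb : IntegrableOn (fun t => ‖u t‖) (Icc x (2 * M - x)) :=
      hu.norm.continuousOn.integrableOn_compact isCompact_Icc
    have hb' : Integrable ((Icc x (2 * M - x)).indicator fun t => ‖u t‖)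
        (volume.restrict (Ici x)) :=
      ((integrable_indicator_iff measurableSet_Icc).2 hb).restrict
    refine (hb'.mul_prod h.integrable.norm).mono' ?_ ?_
    · refine (h.integrable.aestronglyMeasurable.comp_snd.mul
        (Measurable.aestronglyMeasurable ?_)).mul (hu.measurable.comp measurable_fst).aestronglyMeasurable
      refine Measurable.ite ?_ measurable_const measurable_const
      have hY : Measurable fun q : ℝ × Ω => Y q.2 := h.measurable_left.comp measurable_snd
      have hS : Measurable fun q : ℝ × Ω => S q.2 := h.measurable_right.comp measurable_snd
      exact (measurableSet_le (hS.sub (hY.sub_const x)) measurable_fst).inter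
        (measurableSet_lt measurable_fst (hS.add (hY.sub_const x)))
    · have h2 : ∀ᵐ q ∂((volume.restrict (Ici x)).prod μ), q.1 ∈ Ici x :=
        Measure.quasiMeasurePreserving_fst.ae (p := fun s : ℝ => s ∈ Ici x)
          (ae_restrict_mem measurableSet_Ici)
      filter_upwards [h2] with q hq
      have hnn : 0 ≤ (Icc x (2 * M - x)).indicator (fun t => ‖u t‖) q.1 :=
        indicator_nonneg (fun _ _ => norm_nonneg _) _
      by_cases hp : ω q.2 = 0
      · simp [hp]
      split_ifs with hlt
      · have hmem : q.1 ∈ Icc x (2 * M - x) := by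
          refine ⟨hq, ?_⟩
          obtain ⟨h1, h2⟩ := h.abs_le_and q.2 hp
          linarith [(abs_le.1 h1).2, (abs_le.1 h2).2, hlt.2]
        rw [indicator_of_mem hmem, mul_one, norm_mul, mul_comm]
      · simp only [mul_zero, zero_mul, norm_zero]
        positivity
  have hswap := integral_integral_swap (f := fun t p => ω p *
    (if S p - (Y p - x) ≤ t ∧ t < S p + (Y p - x) then 1 else 0) * u t) hi
  have hint := hi.integral_prod_left
  simp only [integral_mul_const] at hint hswap
  refine ⟨hint, ?_⟩
  rw [hswap, layerIntegral]
  refine integral_congr_ae (Eventually.of_forall fun p => ?_)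
  by_cases hp : ω p = 0
  · simp [hp]
  -- Because $Y\le S$, the interval of the indicator lies in $[x,\infty)$ and is not truncated by
  -- the domain of integration.
  have hl : x ≤ S p - (Y p - x) := by linarith [hYS p hp]
  have h1 : ∀ t, ω p * (if S p - (Y p - x) ≤ t ∧ t < S p + (Y p - x) then 1 else 0) * u t
      = (Ico (S p - (Y p - x)) (S p + (Y p - x))).indicator (fun t => ω p * u t) t := by
    intro t
    by_cases ht : S p - (Y p - x) ≤ t ∧ t < S p + (Y p - x)
    · rw [if_pos ht, indicator_of_mem (show t ∈ Ico _ _ from ht), mul_one]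
    · rw [if_neg ht, indicator_of_notMem (show t ∉ Ico _ _ from ht), mul_zero, zero_mul]
  simp only [h1]
  rw [integral_indicator measurableSet_Ico, Measure.restrict_restrict measurableSet_Ico,
    inter_eq_left.2 (show Ico (S p - (Y p - x)) (S p + (Y p - x)) ⊆ Ici x from
      fun t ht => hl.trans ht.1), integral_const_mul]
  congr 1
  by_cases hxY : x < Y p
  · rw [if_pos hxY, integral_Ico_eq_integral_Ioc, ← intervalIntegral.integral_of_le (by linarith),
      intervalIntegral.integral_eq_sub_of_hasDerivAt (fun t _ => hU t) (hu.intervalIntegrable _ _)]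
  · rw [if_neg hxY, Ico_eq_empty (by linarith)]
    simp

end LayerIntegral

/-! ### The transformed equation -/

section TransformEquation

/-- `K` is a kernel of the transformation operator, extended continuously to the plane. -/
structure IsExtendedKernel (lam : ℝ) (Q : ℝ → ℝ) (a : ℝ) (K : ℝ → ℝ → ℝ) : Prop where
  continuous : Continuous fun p : ℝ × ℝ => K p.1 p.2
  eq_zero : ∀ x t : ℝ, 0 ≤ x → x ≤ t → 2 * a ≤ x + t → K x t = 0
  fixed_point : ∀ x t : ℝ, 0 ≤ x → x ≤ t → K x t = kernelMap lam Q K x t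

/-- Retracting the plane onto the sector $0\le x\le t$ extends the kernel continuously, and the
integral equation samples it only in the sector. Enlarging $a$ gives a common cut-off for $Q$ and
the kernel. -/
lemma IsTransformationKernel.exists_isExtendedKernel {lam : ℝ} {Q : ℝ → ℝ} {a₀ C : ℝ}
    {K₀ : ℝ → ℝ → ℝ} (hQ : IsCompactPotential Q a₀ C) (hK : IsTransformationKernel lam Q K₀) :
    ∃ a K, IsCompactPotential Q a C ∧ IsExtendedKernel lam Q a K ∧
      ∀ x t, 0 ≤ x → x ≤ t → K₀ x t = K x t := by
  obtain ⟨a₁, ha₁, hsupp⟩ := hK.support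
  have hKK : ∀ x t, 0 ≤ x → x ≤ t → K₀ x t = K₀ (max x 0) (max (max x 0) t) := by
    intro x t hx hxt
    rw [max_eq_left hx, max_eq_right hxt]
  refine ⟨max a₀ a₁, fun x t => K₀ (max x 0) (max (max x 0) t), ?_, ⟨?_, ?_, ?_⟩, hKK⟩
  · exact { hQ with
      a_pos := lt_max_of_lt_left hQ.a_pos
      eq_zero_of_lt := fun s hs => hQ.eq_zero_of_lt s ((le_max_left _ _).trans_lt hs) }
  · refine hK.continuousOn.comp_continuous
      (f := fun p : ℝ × ℝ => (max p.1 0, max (max p.1 0) p.2)) (by fun_prop) fun p => ?_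
    exact ⟨le_max_right _ _, le_max_left _ _⟩
  · intro x t hx hxt h
    rw [← hKK x t hx hxt]
    refine hsupp x t hx hxt (le_trans ?_ h)
    gcongr
    exact le_max_right _ _
  · intro x t hx hxt
    rw [← hKK x t hx hxt, hK.fixed_point x t hx hxt, kernelMap, kernelMap]
    congr 1
    refine setIntegral_congr_fun measurableSet_Ioi fun α hα => ?_
    have hα' : (t + x) / 2 < α := hα
    refine intervalIntegral.integral_congr fun β hβ => ?_
    rw [uIcc_of_le (by linarith)] at hβ
    rw [hKK (α - β) (α + β) (by linarith [hβ.2]) (by linarith [hβ.1])]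

variable {lam : ℝ} {Q : ℝ → ℝ} {a C : ℝ} {K : ℝ → ℝ → ℝ}

/-- The density of the first layer in the kernel: the potential on the diagonal. -/
def diagonalDensity (Q : ℝ → ℝ) (s : ℝ) : ℂ := ((1 / 2 * Q s : ℝ) : ℂ)

/-- The density of the second layer in the kernel, in characteristic coordinates. -/
def interiorDensity (lam : ℝ) (Q : ℝ → ℝ) (a : ℝ) (K : ℝ → ℝ → ℝ) (r : ℝ × ℝ) : ℂ :=
  ((kernelWeight lam Q a r * K (r.1 - r.2) (r.1 + r.2) : ℝ) : ℂ)

lemma isLayerData_diagonal (hQ : IsCompactPotential Q a C) :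
    IsLayerData volume (diagonalDensity Q) (fun s => s) (fun s => s) (2 * a) := by
  have ha := hQ.a_pos
  refine ⟨(hQ.integrable.const_mul _).ofReal, measurable_id, measurable_id, fun s hs => ?_⟩
  have h1 : Q s ≠ 0 := by
    intro h; exact hs (by simp [diagonalDensity, h])
  have h2 : 0 < s := by
    by_contra h; exact h1 (hQ.eq_zero_of_le s (not_lt.1 h))
  have h3 : s ≤ a := by
    by_contra h; exact h1 (hQ.eq_zero_of_lt s (not_le.1 h))
  rw [abs_of_pos h2]
  constructor <;> linarith

lemma mem_triangle_of_interiorDensity_ne_zero {r : ℝ × ℝ}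
    (h : interiorDensity lam Q a K r ≠ 0) : 0 < r.2 ∧ r.2 < r.1 ∧ r.1 < a := by
  by_contra hr
  exact h (by simp [interiorDensity, kernelWeight_eq_zero hr])

lemma integrable_interiorDensity_re (hlam : 0 < lam) (hQ : IsCompactPotential Q a C)
    (hK : IsExtendedKernel lam Q a K) :
    Integrable fun r : ℝ × ℝ => kernelWeight lam Q a r * K (r.1 - r.2) (r.1 + r.2) :=
  integrable_kernelWeight_mul hlam hQ (hK.continuous.comp
    ((continuous_fst.sub continuous_snd).prodMk (continuous_fst.add continuous_snd)))

lemma isLayerData_interior (hlam : 0 < lam) (hQ : IsCompactPotential Q a C)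
    (hK : IsExtendedKernel lam Q a K) :
    IsLayerData volume (interiorDensity lam Q a K) (fun r => r.1 - r.2) (fun r => r.1 + r.2)
      (2 * a) := by
  refine ⟨(integrable_interiorDensity_re hlam hQ hK).ofReal, by fun_prop, by fun_prop,
    fun r hr => ?_⟩
  obtain ⟨h1, h2, h3⟩ := mem_triangle_of_interiorDensity_ne_zero hr
  rw [abs_of_pos (by linarith), abs_of_pos (by linarith)]
  constructor <;> linarith

/-- The sum of the two layer integrals which represent the transformation operator. -/
def kernelLayer (lam : ℝ) (Q : ℝ → ℝ) (a : ℝ) (K : ℝ → ℝ → ℝ) (F : ℝ → ℝ → ℂ) (x : ℝ) : ℂ :=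
  layerIntegral volume (diagonalDensity Q) (fun s => s) (fun s => s) F x
    + layerIntegral volume (interiorDensity lam Q a K) (fun r => r.1 - r.2) (fun r => r.1 + r.2) F x

/-- A source at $(Y,S)=(\alpha-\beta,\alpha+\beta)$ reaches $(x,t)$ when $t$ lies within distance
$Y-x$ of $S$. In these terms the fixed-point equation exhibits $K$ as a sum over sources, with
density $\tfrac12Q$ on the diagonal and coefficient times $K$ inside. -/
lemma kernel_eq_layers (hlam : 0 < lam) (hQ : IsCompactPotential Q a C)
    (hK : IsExtendedKernel lam Q a K) {x t : ℝ} (hx : 0 ≤ x) (hxt : x ≤ t) :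
    (K x t : ℂ) = (∫ s, diagonalDensity Q s *
        (if s - (s - x) ≤ t ∧ t < s + (s - x) then 1 else 0)) +
      ∫ r : ℝ × ℝ, interiorDensity lam Q a K r *
        (if r.1 + r.2 - (r.1 - r.2 - x) ≤ t ∧ t < r.1 + r.2 + (r.1 - r.2 - x) then 1 else 0) := by
  have h1 : ∀ s, diagonalDensity Q s * (if s - (s - x) ≤ t ∧ t < s + (s - x) then 1 else 0)
      = (((Ioi ((t + x) / 2)).indicator (fun s => 1 / 2 * Q s) s : ℝ) : ℂ) := by
    intro s
    by_cases hs : (t + x) / 2 < s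
    · rw [indicator_of_mem (show s ∈ Ioi _ from hs), if_pos ⟨by linarith, by linarith⟩, mul_one]
      rfl
    · rw [indicator_of_notMem (show s ∉ Ioi _ from hs), if_neg (fun h => hs (by linarith [h.2]))]
      simp
  have h2 : ∀ r : ℝ × ℝ, interiorDensity lam Q a K r *
      (if r.1 + r.2 - (r.1 - r.2 - x) ≤ t ∧ t < r.1 + r.2 + (r.1 - r.2 - x) then 1 else 0)
      = (((Ioi ((t + x) / 2) ×ˢ Ioc 0 ((t - x) / 2)).indicator
        (fun r => kernelWeight lam Q a r * K (r.1 - r.2) (r.1 + r.2)) r : ℝ) : ℂ) := by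
    intro r
    by_cases hr : r ∈ Ioi ((t + x) / 2) ×ˢ Ioc 0 ((t - x) / 2)
    · have hr1 : (t + x) / 2 < r.1 := hr.1
      have hr2 : 0 < r.2 ∧ r.2 ≤ (t - x) / 2 := hr.2
      rw [indicator_of_mem hr, if_pos ⟨by linarith [hr2.2], by linarith⟩, mul_one]
      rfl
    · rw [indicator_of_notMem hr]
      by_cases h0 : interiorDensity lam Q a K r = 0
      · rw [h0]; simp
      · obtain ⟨h3, _, _⟩ := mem_triangle_of_interiorDensity_ne_zero h0
        rw [if_neg]
        · simp
        · rintro ⟨h4, h5⟩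
          exact hr ⟨show (t + x) / 2 < r.1 by linarith, h3, by linarith⟩
  rw [integral_congr_ae (Eventually.of_forall h1), integral_congr_ae (Eventually.of_forall h2),
    integral_complex_ofReal, integral_complex_ofReal, integral_indicator measurableSet_Ioi,
    integral_indicator (measurableSet_Ioi.prod measurableSet_Ioc), integral_const_mul,
    hK.fixed_point x t hx hxt, kernelMap]
  rw [← Complex.ofReal_add]
  congr 2
  have hint := integrable_interiorDensity_re hlam hQ hK
  rw [Measure.volume_eq_prod, setIntegral_prod _ (by
    rw [← Measure.volume_eq_prod]; exact hint.integrableOn)]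
  refine setIntegral_congr_fun measurableSet_Ioi fun α hα => ?_
  have hα' : (t + x) / 2 < α := hα
  simp only
  rw [intervalIntegral.integral_of_le (by linarith)]
  refine setIntegral_congr_fun measurableSet_Ioc fun β hβ => ?_
  -- Again the cut-off of the coefficient is harmless because the kernel vanishes where $\alpha\ge
  -- a$.
  rcases le_or_gt a α with h | h
  · rw [hK.eq_zero (α - β) (α + β) (by linarith [hβ.2]) (by linarith [hβ.1]) (by linarith),
      mul_zero, mul_zero]
  · rw [kernelWeight, indicator_of_mem (show (α, β) ∈
      {r : ℝ × ℝ | 0 < r.2 ∧ r.2 < r.1 ∧ r.1 < a} from ⟨hβ.1, by simp only; linarith [hβ.2], h⟩)]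

/-- The transformation operator as a layer integral. -/
lemma integral_kernel_mul_eq (hlam : 0 < lam) (hQ : IsCompactPotential Q a C)
    (hK : IsExtendedKernel lam Q a K) {u U : ℝ → ℂ} (hu : Continuous u)
    (hU : ∀ t, HasDerivAt U (u t) t) {x : ℝ} (hx : 0 ≤ x) :
    IntegrableOn (fun t => (K x t : ℂ) * u t) (Ioi x) ∧
    ∫ t in Ioi x, (K x t : ℂ) * u t
      = kernelLayer lam Q a K (fun s r => U (s + r) - U (s - r)) x := by
  obtain ⟨i1, e1⟩ := (isLayerData_diagonal hQ).integral_kernel_mul (fun _ _ => le_rfl) hu hU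
    (x := x)
  obtain ⟨i2, e2⟩ := (isLayerData_interior hlam hQ hK).integral_kernel_mul (fun r hr => by
    have := (mem_triangle_of_interiorDensity_ne_zero hr).1
    linarith) hu hU (x := x)
  have hc : EqOn (fun t => (K x t : ℂ) * u t) (fun t => (∫ s, diagonalDensity Q s *
        (if s - (s - x) ≤ t ∧ t < s + (s - x) then 1 else 0)) * u t +
      (∫ r : ℝ × ℝ, interiorDensity lam Q a K r *
        (if r.1 + r.2 - (r.1 - r.2 - x) ≤ t ∧ t < r.1 + r.2 + (r.1 - r.2 - x) then 1 else 0))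
        * u t) (Ici x) := by
    intro t ht
    simp only
    rw [kernel_eq_layers hlam hQ hK hx ht, add_mul]
  constructor
  · exact ((i1.add i2).congr_fun hc.symm measurableSet_Ici).mono_set Ioi_subset_Ici_self
  · rw [← integral_Ici_eq_integral_Ioi, setIntegral_congr_fun measurableSet_Ici hc,
      integral_add i1 i2, e1, e2]
    rfl

/-- The interior layer in the original coordinates. -/
lemma integral_interiorDensity_mul (hlam : 0 < lam) (hQ : IsCompactPotential Q a C)
    (hK : IsExtendedKernel lam Q a K) {u : ℝ → ℂ} (hu : Continuous u) {x : ℝ} (hx : 0 ≤ x) :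
    IntervalIntegrable (fun y => ∫ t in Ioi y,
      ((referencePotential lam y + Q y - referencePotential lam t : ℝ) : ℂ) * (K y t * u t))
      volume 0 x ∧
    ∫ r : ℝ × ℝ, interiorDensity lam Q a K r *
        (if 0 < r.1 - r.2 ∧ r.1 - r.2 ≤ x then u (r.1 + r.2 + 0) + u (r.1 + r.2 - 0) else 0)
      = ∫ y in (0 : ℝ)..x, ∫ t in Ioi y,
        ((referencePotential lam y + Q y - referencePotential lam t : ℝ) : ℂ) * (K y t * u t) := by
  set φ : ℝ × ℝ → ℂ := fun r => interiorDensity lam Q a K r *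
        (if 0 < r.1 - r.2 ∧ r.1 - r.2 ≤ x then u (r.1 + r.2 + 0) + u (r.1 + r.2 - 0) else 0)
    with hφ
  set g : ℝ → ℝ → ℂ := fun y t =>
    ((referencePotential lam y + Q y - referencePotential lam t : ℝ) : ℂ) * (K y t * u t) with hg
  have hdata := isLayerData_interior hlam hQ hK
  have hφi : Integrable φ := by
    obtain ⟨B, hB⟩ := (isCompact_Icc (a := -(2 * a)) (b := 2 * a)).exists_bound_of_continuousOn
      hu.continuousOn
    refine (hdata.integrable.norm.mul_const (2 * max B 0)).mono' ?_ (Eventually.of_forall fun r => ?_)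
    · refine hdata.integrable.aestronglyMeasurable.mul (Measurable.aestronglyMeasurable ?_)
      refine Measurable.ite ?_ (by have := hu.measurable; fun_prop) measurable_const
      have hm : Measurable fun r : ℝ × ℝ => r.1 - r.2 := by fun_prop
      exact (measurableSet_lt measurable_const hm).inter (measurableSet_le hm measurable_const)
    · rw [hφ, norm_mul]
      by_cases hr : interiorDensity lam Q a K r = 0
      · simp [hr]
      · gcongr
        have hb : ‖u (r.1 + r.2)‖ ≤ max B 0 :=
          (hB _ (abs_le.1 (hdata.abs_le_and r hr).2)).trans (le_max_left _ _)
        split_ifs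
        · simp only [add_zero, sub_zero]
          refine (norm_add_le _ _).trans ?_
          linarith
        · rw [norm_zero]; positivity
  -- The shear passes from $(\alpha,\beta)$ to $(y,\beta)$ with $y=\alpha-\beta$; the original
  -- variable is then $t=y+2\beta$.
  have hmp : MeasurePreserving (fun z : ℝ × ℝ => (z.1 + z.2, z.2)) volume volume :=
    measurePreserving_add_prod volume volume
  have hψi : Integrable fun z : ℝ × ℝ => φ (z.1 + z.2, z.2) := hmp.integrable_comp_of_integrable hφi
  have hφψ : ∫ r, φ r = ∫ z : ℝ × ℝ, φ (z.1 + z.2, z.2) := by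
    have h := integral_map (μ := volume) (φ := fun z : ℝ × ℝ => (z.1 + z.2, z.2)) (f := φ)
      hmp.measurable.aemeasurable (by rw [hmp.map_eq]; exact hφi.aestronglyMeasurable)
    rw [hmp.map_eq] at h
    exact h
  have hinner : ∀ y, ∫ β, φ (y + β, β) = (Ioc 0 x).indicator (fun y => ∫ t in Ioi y, g y t) y := by
    intro y
    by_cases hy : y ∈ Ioc 0 x
    · rw [indicator_of_mem hy]
      -- At $r=0$ the two values of $u$ coincide, giving the factor $2$; it cancels against
      -- $d\beta=\tfrac12dt$.
      have hpt : ∀ β, φ (y + β, β) = 2 * (Ioi y).indicator (g y) (y + 2 * β) := by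
        intro β
        have e1 : y + β - β = y := by ring
        have e2 : y + β + β = y + 2 * β := by ring
        have hyx : 0 < y ∧ y ≤ x := hy
        simp only [hφ, interiorDensity, e1, e2, if_pos hyx, add_zero, sub_zero]
        by_cases hβ : 0 < β
        · have hmem : y + 2 * β ∈ Ioi y := by simpa using hβ
          rw [indicator_of_mem hmem]
          rcases lt_or_ge (y + β) a with h | h
          · have : kernelWeight lam Q a (y + β, β)
                = referencePotential lam y + Q y - referencePotential lam (y + 2 * β) := by
              rw [kernelWeight, indicator_of_mem (show (y + β, β) ∈
                {r : ℝ × ℝ | 0 < r.2 ∧ r.2 < r.1 ∧ r.1 < a} from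
                ⟨hβ, by simpa using hy.1, h⟩)]
              simp only [e1, e2]
            rw [this, hg]
            push_cast
            ring
          · rw [hK.eq_zero y (y + 2 * β) hy.1.le (by linarith) (by linarith), hg]
            simp only
            rw [hK.eq_zero y (y + 2 * β) hy.1.le (by linarith) (by linarith)]
            simp
        · have hmem : y + 2 * β ∉ Ioi y := by simpa using hβ
          rw [indicator_of_notMem hmem, kernelWeight_eq_zero (fun h => hβ h.1)]
          simp
      simp_rw [hpt]
      rw [integral_const_mul, Measure.integral_comp_mul_left
        (fun b => (Ioi y).indicator (g y) (y + b)) 2,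
        integral_add_left_eq_self ((Ioi y).indicator (g y)) y, integral_indicator measurableSet_Ioi]
      norm_num
      ring
    · rw [indicator_of_notMem hy]
      have hyx : ¬(0 < y ∧ y ≤ x) := hy
      have hpt : ∀ β, φ (y + β, β) = 0 := by
        intro β
        simp only [hφ, add_sub_cancel_right, if_neg hyx, mul_zero]
      simp [hpt]
  have hint := hψi.integral_prod_left
  simp only [hinner] at hint
  constructor
  · rw [intervalIntegrable_iff_integrableOn_Ioc_of_le hx]
    exact (integrable_indicator_iff measurableSet_Ioc).1 hint
  · rw [hφψ, Measure.volume_eq_prod, integral_prod _ (by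
      rw [← Measure.volume_eq_prod]; exact hψi)]
    simp only [hinner]
    rw [integral_indicator measurableSet_Ioc, intervalIntegral.integral_of_le hx]

/-- The transformation operator intertwines the reference equation and the perturbed one. -/
lemma transform_equation (hlam : 0 < lam) (hQ : IsCompactPotential Q a C)
    (hK : IsExtendedKernel lam Q a K) {u v U : ℝ → ℂ} (hu : Continuous u)
    (hU : ∀ t, HasDerivAt U (u t) t) (huv : ∀ t, HasDerivAt u (v t) t) {z : ℂ}
    (hv : ∀ t, HasDerivAt v (((referencePotential lam t : ℂ) + z ^ 2) * u t) t)
    {x : ℝ} (hx : 0 ≤ x) :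
    IntervalIntegrable (kernelLayer lam Q a K fun s r => u (s + r) + u (s - r)) volume 0 x ∧
    (∫ t in Ioi x, (K x t : ℂ) * u t) = (∫ t in Ioi 0, (K 0 t : ℂ) * u t)
      - ∫ y in (0 : ℝ)..x, kernelLayer lam Q a K (fun s r => u (s + r) + u (s - r)) y ∧
    IntervalIntegrable (fun y => (Q y : ℂ) * u y + ((Q y + referencePotential lam y : ℝ) + z ^ 2)
        * ∫ t in Ioi y, (K y t : ℂ) * u t) volume 0 x ∧
    kernelLayer lam Q a K (fun s r => u (s + r) + u (s - r)) x
      = kernelLayer lam Q a K (fun s r => u (s + r) + u (s - r)) 0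
      - ∫ y in (0 : ℝ)..x, ((Q y : ℂ) * u y + ((Q y + referencePotential lam y : ℝ) + z ^ 2)
        * ∫ t in Ioi y, (K y t : ℂ) * u t) := by
  have d1 := isLayerData_diagonal hQ
  have d2 := isLayerData_interior hlam hQ hK
  have hvc : Continuous v := continuous_iff_continuousAt.2 fun t => (hv t).continuousAt
  have hUc : Continuous U := continuous_iff_continuousAt.2 fun t => (hU t).continuousAt
  have hqc : Continuous (referencePotential lam) := by unfold referencePotential; fun_prop
  have hadd : ∀ s r : ℝ, HasDerivAt (fun r => s + r) 1 r := fun s r => (hasDerivAt_id r).const_add s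
  have hsub : ∀ s r : ℝ, HasDerivAt (fun r => s - r) (-1) r := fun s r =>
    (hasDerivAt_id r).const_sub s
  have hF1 : ∀ s r, HasDerivAt (fun r => U (s + r) - U (s - r)) (u (s + r) + u (s - r)) r := by
    intro s r
    have := ((hU (s + r)).scomp r (hadd s r)).sub ((hU (s - r)).scomp r (hsub s r))
    rw [one_smul, neg_smul, one_smul, sub_neg_eq_add] at this
    exact this
  have hF2 : ∀ s r, HasDerivAt (fun r => u (s + r) + u (s - r)) (v (s + r) - v (s - r)) r := by
    intro s r
    have := ((huv (s + r)).scomp r (hadd s r)).add ((huv (s - r)).scomp r (hsub s r))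
    rw [one_smul, neg_smul, one_smul, ← sub_eq_add_neg] at this
    exact this
  have c1 : Continuous fun p : ℝ × ℝ => U (p.1 + p.2) - U (p.1 - p.2) := by fun_prop
  have c2 : Continuous fun p : ℝ × ℝ => u (p.1 + p.2) + u (p.1 - p.2) := by fun_prop
  have c3 : Continuous fun p : ℝ × ℝ => v (p.1 + p.2) - v (p.1 - p.2) := by fun_prop
  have i1 := d1.intervalIntegrable (F := fun s r => u (s + r) + u (s - r)) c2 hx
  have i2 := d2.intervalIntegrable (F := fun s r => u (s + r) + u (s - r)) c2 hx
  have j1 := d1.intervalIntegrable (F := fun s r => v (s + r) - v (s - r)) c3 hx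
  have j2 := d2.intervalIntegrable (F := fun s r => v (s + r) - v (s - r)) c3 hx
  -- First derivative: $U(s+r)-U(s-r)$ vanishes at $r=0$, so the cut-off contributes no jump.
  have A1 := d1.layerIntegral_zero_eq (F := fun s r => U (s + r) - U (s - r))
    (κ := fun s r => u (s + r) + u (s - r)) c1 c2 hF1 hx
  have A2 := d2.layerIntegral_zero_eq (F := fun s r => U (s + r) - U (s - r))
    (κ := fun s r => u (s + r) + u (s - r)) c1 c2 hF1 hx
  -- Second derivative: here the jump is $2u(s)$. On the diagonal it produces $Qu$, in the interior
  -- $\int(q(y)-q_0(t))K(y,t)u(t)\,dt$.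
  have B1 := d1.layerIntegral_zero_eq (F := fun s r => u (s + r) + u (s - r))
    (κ := fun s r => v (s + r) - v (s - r)) c2 c3 hF2 hx
  have B2 := d2.layerIntegral_zero_eq (F := fun s r => u (s + r) + u (s - r))
    (κ := fun s r => v (s + r) - v (s - r)) c2 c3 hF2 hx
  obtain ⟨iP, eP⟩ := integral_interiorDensity_mul hlam hQ hK hu hx
  -- As $v$ is a primitive of $(q_0+z^2)u$, the layer of $v(s+r)-v(s-r)$ is the transform of
  -- $(q_0+z^2)u$. Its $q_0(t)$ cancels the one in the interior jump and leaves $q(y)+z^2$ times the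
  -- transform of $u$.
  have hsplit : ∀ y ∈ Ioc 0 x,
      (Q y : ℂ) * u y + ((Q y + referencePotential lam y : ℝ) + z ^ 2)
        * (∫ t in Ioi y, (K y t : ℂ) * u t)
      = (Q y : ℂ) * u y
        + (layerIntegral volume (diagonalDensity Q) (fun s => s) (fun s => s)
            (fun s r => v (s + r) - v (s - r)) y
          + layerIntegral volume (interiorDensity lam Q a K) (fun r => r.1 - r.2)
            (fun r => r.1 + r.2) (fun s r => v (s + r) - v (s - r)) y)
        + ∫ t in Ioi y,
          ((referencePotential lam y + Q y - referencePotential lam t : ℝ) : ℂ) * (K y t * u t) := by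
    intro y hy
    obtain ⟨k1, _⟩ := integral_kernel_mul_eq hlam hQ hK hu hU hy.1.le
    obtain ⟨k2, e2⟩ := integral_kernel_mul_eq hlam hQ hK
      (u := fun t => ((referencePotential lam t : ℂ) + z ^ 2) * u t) (by fun_prop) hv hy.1.le
    have k3 : IntegrableOn (fun t => ((referencePotential lam y + Q y - referencePotential lam t : ℝ)
        : ℂ) * (K y t * u t)) (Ioi y) := by
      have := (k1.const_mul ((referencePotential lam y + Q y + z ^ 2 : ℂ))).sub k2
      refine this.congr (Eventually.of_forall fun t => ?_)
      simp only [Pi.sub_apply]; push_cast; ring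
    have e3 : layerIntegral volume (diagonalDensity Q) (fun s => s) (fun s => s)
            (fun s r => v (s + r) - v (s - r)) y
          + layerIntegral volume (interiorDensity lam Q a K) (fun r => r.1 - r.2)
            (fun r => r.1 + r.2) (fun s r => v (s + r) - v (s - r)) y
        = ∫ t in Ioi y, (K y t : ℂ) * (((referencePotential lam t : ℂ) + z ^ 2) * u t) := e2.symm
    rw [e3, add_assoc, ← integral_add k2 k3, ← integral_const_mul]
    congr 1
    refine integral_congr_ae (Eventually.of_forall fun t => ?_)
    simp only
    push_cast
    ring
  have iQ : IntervalIntegrable (fun y => (Q y : ℂ) * u y) volume 0 x :=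
    (hQ.integrable.ofReal.intervalIntegrable).mul_continuousOn hu.continuousOn
  have iS := (iQ.add (j1.add j2)).add iP
  refine ⟨i1.add i2, ?_, ?_, ?_⟩
  · rw [(integral_kernel_mul_eq hlam hQ hK hu hU hx).2,
      (integral_kernel_mul_eq hlam hQ hK hu hU le_rfl).2]
    simp only [kernelLayer]
    rw [intervalIntegral.integral_add i1 i2, A1, A2]
    simp
    ring
  · rw [intervalIntegrable_iff_integrableOn_Ioc_of_le hx] at iS ⊢
    exact iS.congr_fun (fun y hy => (hsplit y hy).symm) measurableSet_Ioc
  · have hcongr : ∫ y in (0 : ℝ)..x, ((Q y : ℂ) * u y +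
          ((Q y + referencePotential lam y : ℝ) + z ^ 2) * ∫ t in Ioi y, (K y t : ℂ) * u t)
        = ∫ y in (0 : ℝ)..x, ((Q y : ℂ) * u y
        + (layerIntegral volume (diagonalDensity Q) (fun s => s) (fun s => s)
            (fun s r => v (s + r) - v (s - r)) y
          + layerIntegral volume (interiorDensity lam Q a K) (fun r => r.1 - r.2)
            (fun r => r.1 + r.2) (fun s r => v (s + r) - v (s - r)) y)
        + ∫ t in Ioi y, ((referencePotential lam y + Q y - referencePotential lam t : ℝ) : ℂ)
          * (K y t * u t)) := by
      rw [intervalIntegral.integral_of_le hx, intervalIntegral.integral_of_le hx]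
      exact setIntegral_congr_fun measurableSet_Ioc hsplit
    have hdiag : ∫ s, diagonalDensity Q s *
        (if 0 < s ∧ s ≤ x then u (s + 0) + u (s - 0) else 0) = ∫ y in (0 : ℝ)..x, (Q y : ℂ) * u y := by
      rw [intervalIntegral.integral_of_le hx, ← integral_indicator measurableSet_Ioc]
      refine integral_congr_ae (Eventually.of_forall fun s => ?_)
      by_cases hs : 0 < s ∧ s ≤ x
      · simp only [if_pos hs, indicator_of_mem (show s ∈ Ioc 0 x from hs), diagonalDensity, add_zero,
          sub_zero]
        push_cast; ring
      · simp only [if_neg hs, indicator_of_notMem (show s ∉ Ioc 0 x from hs), mul_zero]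
    rw [hcongr, intervalIntegral.integral_add (iQ.add (j1.add j2)) iP,
      intervalIntegral.integral_add iQ (j1.add j2), intervalIntegral.integral_add j1 j2]
    simp only [kernelLayer]
    rw [B1, B2, hdiag, eP]
    ring

end TransformEquation

/-! ### The perturbed solution -/

section PerturbedSolution

/-- An integral depending holomorphically on a parameter. -/
lemma differentiable_integral_of_bounded {Ω : Type*} [MeasurableSpace Ω] {μ : Measure Ω}
    {F : ℂ → Ω → ℂ} (hF : ∀ p, Differentiable ℂ fun z => F z p)
    (hm : ∀ z, AEStronglyMeasurable (F z) μ)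
    (hb : ∀ R : ℝ, ∃ b : Ω → ℝ, Integrable b μ ∧ ∀ᵐ p ∂μ, ∀ z, ‖z‖ ≤ R → ‖F z p‖ ≤ b p) :
    Differentiable ℂ fun z => ∫ p, F z p ∂μ := by
  intro z₀
  -- Radius $1$ for the neighbourhood of $z_0$ and $1$ more for the circle in Cauchy's estimate,
  -- which makes the same bound control the derivative.
  obtain ⟨b, hbi, hb⟩ := hb (‖z₀‖ + 2)
  -- The derivative is a pointwise limit of difference quotients, hence measurable.
  have hmd : AEStronglyMeasurable (fun p => deriv (fun z => F z p) z₀) μ := by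
    refine aestronglyMeasurable_of_tendsto_ae (u := atTop)
      (f := fun (n : ℕ) p => ((1 / ((n : ℂ) + 1)))⁻¹ • (F (z₀ + 1 / ((n : ℂ) + 1)) p - F z₀ p))
      (fun n => ((hm (z₀ + 1 / ((n : ℂ) + 1))).sub (hm z₀)).const_smul (1 / ((n : ℂ) + 1))⁻¹) (Eventually.of_forall fun p => ?_)
    have h1 := ((hF p) z₀).hasDerivAt.tendsto_slope_zero
    refine h1.comp (tendsto_nhdsWithin_iff.2 ⟨tendsto_one_div_add_atTop_nhds_zero_nat, ?_⟩)
    exact Eventually.of_forall fun n => one_div_ne_zero (by exact_mod_cast n.succ_ne_zero)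
  refine (hasDerivAt_integral_of_dominated_loc_of_deriv_le (bound := b) (s := ball z₀ 1)
    (F' := fun z p => deriv (fun z => F z p) z) (ball_mem_nhds z₀ one_pos)
    (Eventually.of_forall hm) ?_ hmd ?_ hbi ?_).2.differentiableAt
  · exact hbi.mono' (hm z₀) (hb.mono fun p hp => hp z₀ (by linarith))
  · filter_upwards [hb] with p hp z hz
    have := Complex.norm_deriv_le_of_forall_mem_sphere_norm_le (f := fun z => F z p) (c := z)
      (R := 1) (C := b p) one_pos (hF p).diffContOnCl fun w hw => hp w ?_
    · simpa using this
    · have h1 : ‖w - z‖ = 1 := mem_sphere_iff_norm.1 hw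
      have h2 : ‖z - z₀‖ < 1 := mem_ball_iff_norm.1 hz
      have h3 := norm_le_norm_sub_add w z
      have h4 := norm_le_norm_sub_add z z₀
      linarith
  · exact Eventually.of_forall fun p z _ => ((hF p) z).hasDerivAt

/-- A bound for the Bessel series on compact sets. -/
def besselCompactBound (k : ℕ) (r L : ℝ) : ℝ :=
  besselBound k r * Real.exp (r * L) * Real.exp (Real.exp (2 * k + 2 * L))

lemma besselCompactBound_pos (k : ℕ) (r L : ℝ) : 0 < besselCompactBound k r L := by
  have := besselBound_pos k r
  unfold besselCompactBound; positivity

lemma norm_besselSeries_le_compact (k : ℕ) {z : ℂ} {y r L : ℝ} (hz : ‖z‖ ≤ r) (hy : |y| ≤ L) :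
    ‖besselSeries k z y‖ ≤ besselCompactBound k r L := by
  refine (norm_besselSeries_le k z y).trans ?_
  have hr : 0 ≤ r := (norm_nonneg z).trans hz
  have h1 := besselBound_mono k (norm_nonneg z) hz
  have h2 : z.re * y ≤ r * L := by
    calc z.re * y ≤ |z.re| * |y| := by rw [← abs_mul]; exact le_abs_self _
      _ ≤ _ := by gcongr; exact (Complex.abs_re_le_norm z).trans hz
  have h3 := Real.exp_le_exp.2 h2
  have h4 := (besselBound_pos k r).le
  have h5 : y ≤ L := (le_abs_self y).trans hy
  unfold besselCompactBound
  gcongr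

/-- The logarithmic coordinate of the Bessel function at `x = 0`. -/
def logShift (lam : ℝ) : ℝ := Real.log (Real.sqrt lam / 2)

/-- The free solution `J_z (√lam e^{-x})`. -/
def freeSolution (lam : ℝ) (z : ℂ) (x : ℝ) : ℂ := besselSeries 0 z (logShift lam - x)

/-- The derivative of the free solution. -/
def freeSolutionDeriv (lam : ℝ) (z : ℂ) (x : ℝ) : ℂ := -besselSeries 1 z (logShift lam - x)

lemma continuous_freeSolution (lam : ℝ) (z : ℂ) : Continuous (freeSolution lam z) :=
  (continuous_besselSeries 0 z).comp (by fun_prop)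

lemma hasDerivAt_freeSolution (lam : ℝ) (z : ℂ) (x : ℝ) :
    HasDerivAt (freeSolution lam z) (freeSolutionDeriv lam z x) x := by
  have := (hasDerivAt_besselSeries 0 z (logShift lam - x)).scomp x
    ((hasDerivAt_id x).const_sub (logShift lam))
  rw [neg_smul, one_smul] at this
  exact this

lemma hasDerivAt_freeSolutionDeriv {lam : ℝ} (hlam : 0 < lam) (z : ℂ) (x : ℝ) :
    HasDerivAt (freeSolutionDeriv lam z)
      (((referencePotential lam x : ℂ) + z ^ 2) * freeSolution lam z x) x := by
  have h := ((hasDerivAt_besselSeries 1 z (logShift lam - x)).scomp x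
    ((hasDerivAt_id x).const_sub (logShift lam))).neg
  rw [neg_smul, one_smul, neg_neg, besselSeries_two] at h
  -- The shift $\log(\sqrt\lambda/2)$ is chosen so that $4e^{2y}=\lambda e^{-2x}$.
  have he : 4 * Complex.exp (2 * ((logShift lam - x : ℝ) : ℂ)) = -(referencePotential lam x : ℂ) := by
    have hs : 0 < Real.sqrt lam / 2 := by positivity
    have h1 : 4 * Real.exp (2 * (logShift lam - x)) = lam * Real.exp (-2 * x) := by
      rw [mul_sub, sub_eq_add_neg, Real.exp_add, two_mul (logShift lam), Real.exp_add, logShift,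
        Real.exp_log hs, ← neg_mul]
      have := Real.mul_self_sqrt hlam.le
      linear_combination Real.exp (-2 * x) * this
    have h2 : ((4 * Real.exp (2 * (logShift lam - x)) : ℝ) : ℂ) = ((lam * Real.exp (-2 * x) : ℝ) : ℂ) := by
      rw [h1]
    rw [referencePotential]
    push_cast at h2 ⊢
    rw [h2]; ring
  have h2 : (z ^ 2 - 4 * Complex.exp (2 * ((logShift lam - x : ℝ) : ℂ)))
      = (referencePotential lam x : ℂ) + z ^ 2 := by rw [he]; ring
  rw [h2] at h
  exact h

lemma differentiable_freeSolution (lam x : ℝ) : Differentiable ℂ fun z => freeSolution lam z x :=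
  differentiable_besselSeries 0 _

lemma norm_freeSolution_le {lam : ℝ} {z : ℂ} {r M x : ℝ} (hz : ‖z‖ ≤ r) (hx : |x| ≤ M) :
    ‖freeSolution lam z x‖ ≤ besselCompactBound 0 r (|logShift lam| + M) :=
  norm_besselSeries_le_compact 0 hz ((abs_sub _ _).trans (by gcongr))

/-- Exponential decay of the Bessel series along the half-line. -/
lemma exists_norm_besselSeries_sub_le (k : ℕ) (ℓ : ℝ) (z : ℂ) :
    ∃ c, 0 ≤ c ∧ ∀ x, 0 ≤ x → ‖besselSeries k z (ℓ - x)‖ ≤ c * Real.exp (-z.re * x) := by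
  have hb := (besselBound_pos k ‖z‖).le
  refine ⟨besselBound k ‖z‖ * Real.exp (z.re * ℓ) * Real.exp (Real.exp (2 * k + 2 * ℓ)),
    by positivity, fun x hx => (norm_besselSeries_le k z _).trans ?_⟩
  have h1 : Real.exp (z.re * (ℓ - x)) = Real.exp (z.re * ℓ) * Real.exp (-z.re * x) := by
    rw [← Real.exp_add]; ring_nf
  rw [h1]
  calc _ ≤ besselBound k ‖z‖ * (Real.exp (z.re * ℓ) * Real.exp (-z.re * x))
        * Real.exp (Real.exp (2 * k + 2 * ℓ)) := by gcongr; linarith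
    _ = _ := by ring

/-- `v` solves the Schrödinger equation on the half-line and `v'` is its derivative. -/
structure IsHalfLineSolution (lam : ℝ) (Q : ℝ → ℝ) (z : ℂ) (v v' : ℝ → ℂ) : Prop where
  continuousOn : ContinuousOn v (Ici 0)
  continuousOn_deriv : ContinuousOn v' (Ici 0)
  eq_integral_deriv : ∀ x : ℝ, 0 ≤ x → v x = v 0 + ∫ s in (0 : ℝ)..x, v' s
  equation : ∀ x : ℝ, 0 ≤ x →
    v' x = v' 0 + ∫ s in (0 : ℝ)..x, (((Q s + referencePotential lam s : ℝ) : ℂ) + z ^ 2) * v s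

/-- The perturbed solution, in terms of an extended kernel. -/
def jostSolution (lam : ℝ) (K : ℝ → ℝ → ℝ) (z : ℂ) (x : ℝ) : ℂ :=
  freeSolution lam z x + ∫ t in Ioi x, (K x t : ℂ) * freeSolution lam z t

/-- The derivative of the perturbed solution. -/
def jostSolutionDeriv (lam : ℝ) (Q : ℝ → ℝ) (a : ℝ) (K : ℝ → ℝ → ℝ) (z : ℂ) (x : ℝ) : ℂ :=
  freeSolutionDeriv lam z x
    - kernelLayer lam Q a K (fun s r => freeSolution lam z (s + r) + freeSolution lam z (s - r)) x

lemma continuousOn_Ici_of_eq_integral {f g : ℝ → ℂ}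
    (hg : ∀ x, 0 ≤ x → IntervalIntegrable g volume 0 x)
    (h : ∀ x, 0 ≤ x → f x = f 0 + ∫ s in (0 : ℝ)..x, g s) : ContinuousOn f (Ici 0) := by
  intro x hx
  have hx0 : (0 : ℝ) ≤ x := hx
  have h1 : ContinuousOn (fun y => f 0 + ∫ s in (0 : ℝ)..y, g s) (Icc 0 (x + 1)) := by
    have := intervalIntegral.continuousOn_primitive_interval' (hg (x + 1) (by linarith))
      (left_mem_uIcc)
    rw [uIcc_of_le (by linarith)] at this
    exact continuousOn_const.add this
  have h2 : ContinuousOn f (Icc 0 (x + 1)) := h1.congr fun y hy => h y hy.1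
  refine (h2 x ⟨hx0, by linarith⟩).mono_of_mem_nhdsWithin ?_
  exact mem_nhdsWithin.2 ⟨Iio (x + 1), isOpen_Iio, by simp, fun y hy => ⟨hy.2, le_of_lt hy.1⟩⟩

variable {lam : ℝ} {Q : ℝ → ℝ} {a C : ℝ} {K : ℝ → ℝ → ℝ}

/-- The free solution fails the perturbed equation by the term $Qu$, which is exactly the
inhomogeneity in the equation for its transform. No restriction on $z$ enters, so the solution is
available on all of $\mathbb C$. -/
lemma isHalfLineSolution_jostSolution (hlam : 0 < lam) (hQ : IsCompactPotential Q a C)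
    (hK : IsExtendedKernel lam Q a K) (z : ℂ) :
    IsHalfLineSolution lam Q z (jostSolution lam K z) (jostSolutionDeriv lam Q a K z) := by
  have hu := continuous_freeSolution lam z
  have hu' : Continuous (freeSolutionDeriv lam z) :=
    continuous_iff_continuousAt.2 fun t => (hasDerivAt_freeSolutionDeriv hlam z t).continuousAt
  have hU : ∀ t, HasDerivAt (fun x => ∫ s in (0 : ℝ)..x, freeSolution lam z s)
      (freeSolution lam z t) t := fun t => hu.integral_hasStrictDerivAt 0 t |>.hasDerivAt
  have hq : Continuous (referencePotential lam) := by unfold referencePotential; fun_prop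
  have hT := fun (x : ℝ) (hx : 0 ≤ x) => transform_equation hlam hQ hK hu hU
    (hasDerivAt_freeSolution lam z) (hasDerivAt_freeSolutionDeriv hlam z) (x := x) hx
  have hint' : ∀ x, 0 ≤ x → IntervalIntegrable (jostSolutionDeriv lam Q a K z) volume 0 x :=
    fun x hx => (hu'.intervalIntegrable 0 x).sub (hT x hx).1
  have heq : ∀ x, 0 ≤ x → jostSolution lam K z x
      = jostSolution lam K z 0 + ∫ s in (0 : ℝ)..x, jostSolutionDeriv lam Q a K z s := by
    intro x hx
    obtain ⟨h1, h2, _, _⟩ := hT x hx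
    have h5 := intervalIntegral.integral_eq_sub_of_hasDerivAt (a := 0) (b := x)
      (fun y _ => hasDerivAt_freeSolution lam z y) (hu'.intervalIntegrable 0 x)
    simp only [jostSolution, jostSolutionDeriv]
    rw [intervalIntegral.integral_sub (hu'.intervalIntegrable 0 x) h1, h2, h5]
    ring
  have hg : ∀ x, 0 ≤ x → IntervalIntegrable
      (fun s => (((Q s + referencePotential lam s : ℝ) : ℂ) + z ^ 2) * jostSolution lam K z s)
      volume 0 x ∧ jostSolutionDeriv lam Q a K z x = jostSolutionDeriv lam Q a K z 0
        + ∫ s in (0 : ℝ)..x,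
          (((Q s + referencePotential lam s : ℝ) : ℂ) + z ^ 2) * jostSolution lam K z s := by
    intro x hx
    obtain ⟨_, _, h3, h4⟩ := hT x hx
    have hfree : IntervalIntegrable
        (fun s => ((referencePotential lam s : ℂ) + z ^ 2) * freeSolution lam z s) volume 0 x :=
      Continuous.intervalIntegrable (by fun_prop) _ _
    have hsum : ∀ s, (((Q s + referencePotential lam s : ℝ) : ℂ) + z ^ 2) * jostSolution lam K z s
        = ((referencePotential lam s : ℂ) + z ^ 2) * freeSolution lam z s
          + ((Q s : ℂ) * freeSolution lam z s + ((Q s + referencePotential lam s : ℝ) + z ^ 2)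
          * ∫ t in Ioi s, (K s t : ℂ) * freeSolution lam z t) := by
      intro s; simp only [jostSolution]; push_cast; ring
    simp only [hsum]
    refine ⟨hfree.add h3, ?_⟩
    have h5 := intervalIntegral.integral_eq_sub_of_hasDerivAt (a := 0) (b := x)
      (fun y _ => hasDerivAt_freeSolutionDeriv hlam z y) hfree
    rw [intervalIntegral.integral_add hfree h3, h5]
    simp only [jostSolutionDeriv]
    rw [h4]
    ring
  exact ⟨continuousOn_Ici_of_eq_integral hint' heq,
    continuousOn_Ici_of_eq_integral (fun x hx => (hg x hx).1) (fun x hx => (hg x hx).2), heq,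
    fun x hx => (hg x hx).2⟩

lemma jostSolution_eq_freeSolution (hQ : IsCompactPotential Q a C)
    (hK : IsExtendedKernel lam Q a K) (z : ℂ) {x : ℝ} (hx : a ≤ x) :
    jostSolution lam K z x = freeSolution lam z x := by
  have ha := hQ.a_pos
  have : ∫ t in Ioi x, (K x t : ℂ) * freeSolution lam z t = 0 :=
    setIntegral_eq_zero_of_forall_eq_zero fun t ht => by
      have ht' : x < t := ht
      rw [hK.eq_zero x t (by linarith) ht'.le (by linarith)]; simp
  rw [jostSolution, this, add_zero]

lemma jostSolutionDeriv_eq_freeSolutionDeriv (hQ : IsCompactPotential Q a C) (z : ℂ) {x : ℝ}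
    (hx : a ≤ x) : jostSolutionDeriv lam Q a K z x = freeSolutionDeriv lam z x := by
  have ha := hQ.a_pos
  rw [jostSolutionDeriv, kernelLayer, layerIntegral, layerIntegral, integral_eq_zero_of_ae,
    integral_eq_zero_of_ae]
  · simp
  · refine Eventually.of_forall fun r => ?_
    by_cases hr : interiorDensity lam Q a K r = 0
    · simp [hr]
    · obtain ⟨h1, h2, h3⟩ := mem_triangle_of_interiorDensity_ne_zero hr
      simp only
      rw [if_neg (by linarith)]
      simp
  · refine Eventually.of_forall fun s => ?_
    simp only
    split_ifs with h
    · simp [diagonalDensity, hQ.eq_zero_of_lt s (by linarith)]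
    · simp

lemma exists_norm_le_exp_of_eventually_eq {f g : ℝ → ℂ} {a σ : ℝ} (hf : ContinuousOn f (Ici 0))
    (hfg : ∀ x, a ≤ x → f x = g x)
    (hg : ∃ c, 0 ≤ c ∧ ∀ x, 0 ≤ x → ‖g x‖ ≤ c * Real.exp (-σ * x)) :
    ∃ c, 0 ≤ c ∧ ∀ x, 0 ≤ x → ‖f x‖ ≤ c * Real.exp (-σ * x) := by
  obtain ⟨c, hc, hb⟩ := hg
  have h1 : ContinuousOn (fun x : ℝ => Real.exp (σ * x) * ‖f x‖) (Icc 0 a) :=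
    (by fun_prop : Continuous fun x : ℝ => Real.exp (σ * x)).continuousOn.mul
      (hf.norm.mono Icc_subset_Ici_self)
  obtain ⟨B, hB⟩ := isCompact_Icc.exists_bound_of_continuousOn h1
  refine ⟨max c B, le_max_of_le_left hc, fun x hx => ?_⟩
  rcases le_or_gt a x with h | h
  · rw [hfg x h]
    exact (hb x hx).trans (by gcongr; exact le_max_left _ _)
  · have := hB x ⟨hx, h.le⟩
    rw [Real.norm_of_nonneg (by positivity)] at this
    calc ‖f x‖ = (Real.exp (σ * x) * ‖f x‖) * Real.exp (-σ * x) := by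
          rw [mul_right_comm, ← Real.exp_add]; simp
      _ ≤ _ := by gcongr; exact this.trans (le_max_right _ _)

lemma exists_norm_jostSolution_le (hlam : 0 < lam) (hQ : IsCompactPotential Q a C)
    (hK : IsExtendedKernel lam Q a K) (z : ℂ) :
    ∃ c, 0 ≤ c ∧ ∀ x, 0 ≤ x → ‖jostSolution lam K z x‖ ≤ c * Real.exp (-z.re * x) :=
  exists_norm_le_exp_of_eventually_eq (isHalfLineSolution_jostSolution hlam hQ hK z).continuousOn
    (fun _ hx => jostSolution_eq_freeSolution hQ hK z hx)
    (exists_norm_besselSeries_sub_le 0 (logShift lam) z)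

lemma exists_norm_jostSolutionDeriv_le (hlam : 0 < lam) (hQ : IsCompactPotential Q a C)
    (hK : IsExtendedKernel lam Q a K) (z : ℂ) :
    ∃ c, 0 ≤ c ∧ ∀ x, 0 ≤ x → ‖jostSolutionDeriv lam Q a K z x‖ ≤ c * Real.exp (-z.re * x) :=
  exists_norm_le_exp_of_eventually_eq
    (isHalfLineSolution_jostSolution hlam hQ hK z).continuousOn_deriv
    (fun _ hx => jostSolutionDeriv_eq_freeSolutionDeriv hQ z hx) (by
      obtain ⟨c, hc, h⟩ := exists_norm_besselSeries_sub_le 1 (logShift lam) z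
      exact ⟨c, hc, fun x hx => by rw [freeSolutionDeriv, norm_neg]; exact h x hx⟩)

/-- Beyond $a$ the solution is the Bessel function, which is not identically zero near its singular
point, that is, for large $x$. -/
lemma exists_jostSolution_ne_zero (hQ : IsCompactPotential Q a C)
    (hK : IsExtendedKernel lam Q a K) (z : ℂ) : ∃ x, 0 ≤ x ∧ jostSolution lam K z x ≠ 0 := by
  obtain ⟨y, hy, hne⟩ := exists_besselSeries_ne_zero z (logShift lam - a)
  have ha := hQ.a_pos
  refine ⟨logShift lam - y, by linarith, ?_⟩
  rw [jostSolution_eq_freeSolution hQ hK z (by linarith), freeSolution, sub_sub_cancel]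
  exact hne

lemma integrable_kernel_zero (hK : IsExtendedKernel lam Q a K) :
    Integrable ((Icc 0 (2 * a)).indicator fun t => |K 0 t|) := by
  refine (integrable_indicator_iff measurableSet_Icc).2 ?_
  have : Continuous fun t => |K 0 t| :=
    (hK.continuous.comp (Continuous.prodMk_right (0 : ℝ))).abs
  exact this.continuousOn.integrableOn_compact isCompact_Icc

lemma norm_kernel_mul_freeSolution_le (hK : IsExtendedKernel lam Q a K) {z : ℂ} {R t : ℝ}
    (hz : ‖z‖ ≤ R) (ht : 0 < t) :
    ‖(K 0 t : ℂ) * freeSolution lam z t‖ ≤ (Icc 0 (2 * a)).indicator (fun t => |K 0 t|) t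
      * besselCompactBound 0 R (|logShift lam| + 2 * a) := by
  rcases le_or_gt (2 * a) t with h | h
  · rw [hK.eq_zero 0 t le_rfl ht.le (by linarith)]
    have := (besselCompactBound_pos 0 R (|logShift lam| + 2 * a)).le
    have := indicator_nonneg (s := Icc 0 (2 * a)) (f := fun t => |K 0 t|)
      (fun _ _ => abs_nonneg _) t
    simp only [Complex.ofReal_zero, zero_mul, norm_zero]
    positivity
  · rw [indicator_of_mem (show t ∈ Icc 0 (2 * a) from ⟨ht.le, h.le⟩), norm_mul, Complex.norm_real,
      Real.norm_eq_abs]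
    gcongr
    exact norm_freeSolution_le hz (by rw [abs_of_pos ht]; exact h.le)

lemma continuous_kernel_mul_freeSolution (hK : IsExtendedKernel lam Q a K) (z : ℂ) :
    Continuous fun t => (K 0 t : ℂ) * freeSolution lam z t :=
  (Complex.continuous_ofReal.comp (hK.continuous.comp (Continuous.prodMk_right (0 : ℝ)))).mul
    (continuous_freeSolution lam z)

lemma differentiable_jostSolution (hK : IsExtendedKernel lam Q a K) :
    Differentiable ℂ fun z => jostSolution lam K z 0 := by
  refine (differentiable_freeSolution lam 0).add (differentiable_integral_of_bounded
    (fun t => (differentiable_freeSolution lam t).const_mul _)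
    (fun z => (continuous_kernel_mul_freeSolution hK z).aestronglyMeasurable) fun R =>
    ⟨fun t => (Icc 0 (2 * a)).indicator (fun t => |K 0 t|) t
      * besselCompactBound 0 R (|logShift lam| + 2 * a), ?_, ?_⟩)
  · exact (integrable_kernel_zero hK).restrict.mul_const _
  · filter_upwards [ae_restrict_mem measurableSet_Ioi] with t ht z hz
    exact norm_kernel_mul_freeSolution_le hK hz ht

lemma IsLayerData.differentiable_layerIntegral {Ω : Type*} [MeasurableSpace Ω] {μ : Measure Ω}
    [SFinite μ] {ω : Ω → ℂ} {Y S : Ω → ℝ} {M : ℝ} (h : IsLayerData μ ω Y S M) (lam : ℝ) :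
    Differentiable ℂ fun z => layerIntegral μ ω Y S
      (fun s r => freeSolution lam z (s + r) + freeSolution lam z (s - r)) 0 := by
  refine differentiable_integral_of_bounded (fun p => ?_) (fun z => ?_) fun R =>
    ⟨fun p => ‖ω p‖ * (2 * besselCompactBound 0 R (|logShift lam| + 2 * M)),
      h.integrable.norm.mul_const _, Eventually.of_forall fun p z hz => ?_⟩
  · split_ifs
    · exact ((differentiable_freeSolution lam _).add (differentiable_freeSolution lam _)).const_mul _
    · exact differentiable_const _
  · have hc := continuous_freeSolution lam z
    exact (h.integrable_slice
      (F := fun s r => freeSolution lam z (s + r) + freeSolution lam z (s - r))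
      (by fun_prop) le_rfl).aestronglyMeasurable
  · rw [norm_mul]
    by_cases hp : ω p = 0
    · simp [hp]
    obtain ⟨h1, h2⟩ := h.abs_le_and p hp
    have hpos := (besselCompactBound_pos 0 R (|logShift lam| + 2 * M)).le
    refine mul_le_mul_of_nonneg_left ?_ (norm_nonneg _)
    split_ifs
    · refine (norm_add_le _ _).trans ?_
      rw [two_mul]
      refine add_le_add (norm_freeSolution_le hz ?_) (norm_freeSolution_le hz ?_)
      · rw [sub_zero]; exact (abs_add_le _ _).trans (by linarith)
      · rw [sub_zero]; exact (abs_sub _ _).trans (by linarith)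
    · rw [norm_zero]; positivity

lemma differentiable_jostSolutionDeriv (hlam : 0 < lam) (hQ : IsCompactPotential Q a C)
    (hK : IsExtendedKernel lam Q a K) :
    Differentiable ℂ fun z => jostSolutionDeriv lam Q a K z 0 :=
  (differentiable_besselSeries 1 _).neg.sub
    (((isLayerData_diagonal hQ).differentiable_layerIntegral lam).add
      ((isLayerData_interior hlam hQ hK).differentiable_layerIntegral lam))

/-- The kernel at $x=0$ has compact support and finite $L^1$ norm $N$, so the bound for the Bessel
function on a compact set is multiplied by at most $1+N\le e^N$. -/
lemma hasGrowth_jostSolution (hK : IsExtendedKernel lam Q a K) (ha : 0 < a) :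
    HasGrowth fun z => jostSolution lam K z 0 := by
  set N := ∫ t in Ioi 0, (Icc 0 (2 * a)).indicator (fun t => |K 0 t|) t with hN
  have hN0 : 0 ≤ N := setIntegral_nonneg measurableSet_Ioi fun t _ =>
    indicator_nonneg (fun _ _ => abs_nonneg _) t
  set L := |logShift lam| + 2 * a with hL
  have hL0 : 0 ≤ L := by positivity
  have hG := besselGrowth_nonneg
  refine ⟨N + besselGrowth + L + Real.exp (2 * L), by positivity, fun z => ?_⟩
  have hz0 := norm_nonneg z
  have h1 : ‖jostSolution lam K z 0‖ ≤ (1 + N) * besselCompactBound 0 ‖z‖ L := by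
    rw [jostSolution, add_mul, one_mul]
    refine (norm_add_le _ _).trans (add_le_add (norm_freeSolution_le le_rfl (by simp [ha.le])) ?_)
    rw [hN, ← integral_mul_const]
    refine norm_integral_le_of_norm_le ((integrable_kernel_zero hK).restrict.mul_const _) ?_
    filter_upwards [ae_restrict_mem measurableSet_Ioi] with t ht
    exact norm_kernel_mul_freeSolution_le hK le_rfl ht
  have hpow : 1 + ‖z‖ ≤ (1 + ‖z‖) ^ (3 / 2 : ℝ) := by
    conv_lhs => rw [← Real.rpow_one (1 + ‖z‖)]
    exact Real.rpow_le_rpow_of_exponent_le (by linarith) (by norm_num)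
  calc ‖jostSolution lam K z 0‖ ≤ (1 + N) * besselCompactBound 0 ‖z‖ L := h1
    _ ≤ Real.exp N * besselCompactBound 0 ‖z‖ L := by
        have := (besselCompactBound_pos 0 ‖z‖ L).le
        gcongr
        linarith [Real.add_one_le_exp N]
    _ = Real.exp (N + (besselGrowth * (1 + ‖z‖) ^ (3 / 2 : ℝ) + ‖z‖ * L + Real.exp (2 * L))) := by
        rw [besselCompactBound, besselBound, Real.exp_add, Real.exp_add, Real.exp_add]
        simp [Real.exp_add]
    _ ≤ _ := by
        refine Real.exp_le_exp.2 ?_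
        have e1 : N ≤ N * (1 + ‖z‖) ^ (3 / 2 : ℝ) := le_mul_of_one_le_right hN0 (by linarith)
        have e2 : ‖z‖ * L ≤ L * (1 + ‖z‖) ^ (3 / 2 : ℝ) := by
          rw [mul_comm]; gcongr; linarith
        have e3 : Real.exp (2 * L) ≤ Real.exp (2 * L) * (1 + ‖z‖) ^ (3 / 2 : ℝ) :=
          le_mul_of_one_le_right (Real.exp_pos _).le (by linarith)
        linarith

/-- Asymptotics of the Jost function along the positive reals. -/
lemma tendsto_Gamma_mul_jostSolution (hK : IsExtendedKernel lam Q a K) :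
    Tendsto (fun x : ℝ => Complex.Gamma (x + 1) * Complex.exp (-(x * logShift lam))
      * jostSolution lam K x 0) atTop (𝓝 1) := by
  set ℓ := logShift lam with hℓ
  set D := Real.exp (Real.exp (2 * ℓ)) with hD
  have hKc : Continuous fun t => K 0 t := hK.continuous.comp (Continuous.prodMk_right (0 : ℝ))
  obtain ⟨B, hB⟩ := (isCompact_Icc (a := (0 : ℝ)) (b := 2 * a)).exists_bound_of_continuousOn
    hKc.continuousOn
  have hB' : ∀ t, 0 < t → |K 0 t| ≤ max B 0 := by
    intro t ht
    rcases le_or_gt (2 * a) t with h | h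
    · rw [hK.eq_zero 0 t le_rfl ht.le (by linarith), abs_zero]; exact le_max_right _ _
    · exact (hB t ⟨ht.le, h.le⟩).trans (le_max_left _ _)
  set B' := max B 0 with hB'def
  have hB0 : 0 ≤ B' := le_max_right _ _
  have hexp : ∀ x y : ℝ, ‖Complex.exp (x * y)‖ = Real.exp (x * y) := by
    intro x y; rw [Complex.norm_exp]; simp
  -- The normalized free solution decays like $e^{-xt}$ in $t$; against a bounded kernel its
  -- integral is $O(1/x)$, so the transform does not affect the limit.
  have hfree : ∀ x t : ℝ, 0 ≤ x → 0 ≤ t →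
      ‖Complex.Gamma (x + 1) * freeSolution lam x t‖
        ≤ Real.exp (x * ℓ) * ((1 + D) * Real.exp (-x * t)) := by
    intro x t hx ht
    have h1 := norm_Gamma_mul_besselSeries_sub_le hx (ℓ - t)
    have h2 : ‖Complex.Gamma (x + 1) * freeSolution lam x t‖
        ≤ Real.exp (x * (ℓ - t)) * (Real.exp (Real.exp (2 * (ℓ - t))) / (x + 1))
          + Real.exp (x * (ℓ - t)) := by
      rw [← hexp x (ℓ - t)] at h1 ⊢
      refine (norm_le_norm_sub_add _ (Complex.exp (x * ((ℓ - t : ℝ) : ℂ)))).trans ?_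
      gcongr
      exact h1
    have h3 : Real.exp (Real.exp (2 * (ℓ - t))) / (x + 1) ≤ D := by
      rw [div_le_iff₀ (by linarith)]
      calc Real.exp (Real.exp (2 * (ℓ - t))) ≤ D := by rw [hD]; gcongr; linarith
        _ ≤ D * (x + 1) := le_mul_of_one_le_right (Real.exp_pos _).le (by linarith)
    calc _ ≤ _ := h2
      _ ≤ Real.exp (x * (ℓ - t)) * D + Real.exp (x * (ℓ - t)) := by gcongr
      _ = Real.exp (x * ℓ) * ((1 + D) * Real.exp (-x * t)) := by
        have : Real.exp (x * (ℓ - t)) = Real.exp (x * ℓ) * Real.exp (-x * t) := by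
          rw [← Real.exp_add]; ring_nf
        rw [this]; ring
  have hbound : ∀ᶠ x : ℝ in atTop, ‖Complex.Gamma (x + 1) * Complex.exp (-(x * ℓ))
      * jostSolution lam K x 0 - 1‖ ≤ (D + B' * (1 + D)) * x⁻¹ := by
    filter_upwards [eventually_gt_atTop 0] with x hx
    have h1 := norm_Gamma_mul_besselSeries_sub_le hx.le ℓ
    have h2 : ‖Complex.Gamma (x + 1) * ∫ t in Ioi 0, (K 0 t : ℂ) * freeSolution lam x t‖
        ≤ Real.exp (x * ℓ) * (B' * (1 + D) * x⁻¹) := by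
      rw [← integral_const_mul]
      have hi : IntegrableOn (fun t => Real.exp (-x * t)) (Ioi 0) :=
        integrableOn_exp_mul_Ioi (by linarith) 0
      have he : ∫ t in Ioi 0, Real.exp (x * ℓ) * (B' * (1 + D)) * Real.exp (-x * t)
          = Real.exp (x * ℓ) * (B' * (1 + D) * x⁻¹) := by
        rw [integral_const_mul, integral_exp_mul_Ioi (by linarith : -x < 0)]
        simp [mul_assoc]
      rw [← he]
      refine norm_integral_le_of_norm_le (hi.const_mul _) ?_
      filter_upwards [ae_restrict_mem measurableSet_Ioi] with t ht
      rw [mul_left_comm, norm_mul, Complex.norm_real, Real.norm_eq_abs]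
      have ht' : 0 < t := ht
      calc |K 0 t| * ‖Complex.Gamma (x + 1) * freeSolution lam x t‖
          ≤ B' * (Real.exp (x * ℓ) * ((1 + D) * Real.exp (-x * t))) := by
            gcongr
            · exact hB' t ht'
            · exact hfree x t hx.le ht'.le
        _ = _ := by ring
    have h3 : Complex.exp (-(x * ℓ)) * Complex.exp (x * ℓ) = 1 := by
      rw [← Complex.exp_add]; simp
    have h4 : Complex.Gamma (x + 1) * Complex.exp (-(x * ℓ)) * jostSolution lam K x 0 - 1
        = Complex.exp (-(x * ℓ)) * ((Complex.Gamma (x + 1) * besselSeries 0 x ℓ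
          - Complex.exp (x * ℓ))
          + Complex.Gamma (x + 1) * ∫ t in Ioi 0, (K 0 t : ℂ) * freeSolution lam x t) := by
      rw [jostSolution, freeSolution, ← hℓ, sub_zero]
      linear_combination h3
    have h5 : ‖Complex.exp (-(x * ℓ))‖ = Real.exp (-(x * ℓ)) := by
      rw [Complex.norm_exp]; simp
    rw [h4, norm_mul, h5]
    have h6 : D / (x + 1) ≤ D * x⁻¹ := by
      rw [div_eq_mul_inv]; gcongr; linarith
    calc _ ≤ Real.exp (-(x * ℓ)) * (Real.exp (x * ℓ) * (D / (x + 1))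
          + Real.exp (x * ℓ) * (B' * (1 + D) * x⁻¹)) := by
          gcongr
          exact (norm_add_le _ _).trans (add_le_add h1 h2)
      _ = (Real.exp (-(x * ℓ)) * Real.exp (x * ℓ)) * (D / (x + 1) + B' * (1 + D) * x⁻¹) := by ring
      _ = D / (x + 1) + B' * (1 + D) * x⁻¹ := by rw [← Real.exp_add]; simp
      _ ≤ _ := by linarith
  have hlim : Tendsto (fun x : ℝ => (D + B' * (1 + D)) * x⁻¹) atTop (𝓝 0) := by
    simpa using tendsto_inv_atTop_zero.const_mul (D + B' * (1 + D))
  rw [tendsto_iff_norm_sub_tendsto_zero]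
  exact tendsto_of_tendsto_of_tendsto_of_le_of_le' tendsto_const_nhds hlim
    (Eventually.of_forall fun x => norm_nonneg _) hbound

end PerturbedSolution

/-! ### Weyl solutions and Regge poles -/

section WeylTheory

variable {lam : ℝ} {Q : ℝ → ℝ} {a C : ℝ} {K : ℝ → ℝ → ℝ} {z : ℂ} {u u' v v' : ℝ → ℂ}

lemma absolutelyContinuousOnInterval_of_eq_integral {f g : ℝ → ℂ} {X B : ℝ} (hX : 0 ≤ X)
    (hg : IntervalIntegrable g volume 0 X) (hB : ∀ s ∈ Icc 0 X, ‖g s‖ ≤ B)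
    (h : ∀ x, 0 ≤ x → f x = f 0 + ∫ s in (0 : ℝ)..x, g s) :
    AbsolutelyContinuousOnInterval f 0 X := by
  refine LipschitzOnWith.absolutelyContinuousOnInterval (K := B.toNNReal)
    (LipschitzOnWith.of_dist_le_mul fun x hx y hy => ?_)
  rw [uIcc_of_le hX] at hx hy
  have hsub : ∀ x ∈ Icc 0 X, IntervalIntegrable g volume 0 x := fun x hx =>
    hg.mono_set (by rw [uIcc_of_le hx.1, uIcc_of_le hX]; exact Icc_subset_Icc_right hx.2)
  have hB0 : 0 ≤ B := (norm_nonneg _).trans (hB 0 ⟨le_rfl, hX⟩)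
  rw [dist_eq_norm, h x hx.1, h y hy.1, add_sub_add_left_eq_sub,
    intervalIntegral.integral_interval_sub_left (hsub x hx) (hsub y hy), Real.dist_eq,
    Real.coe_toNNReal _ hB0]
  refine intervalIntegral.norm_integral_le_of_norm_le_const fun s hs => hB s ?_
  have := uIoc_subset_uIcc hs
  rw [mem_uIcc] at this
  rcases this with h | h
  · exact ⟨hy.1.trans h.1, h.2.trans hx.2⟩
  · exact ⟨hx.1.trans h.1, h.2.trans hy.2⟩

lemma ae_hasDerivAt_of_eq_integral {f g : ℝ → ℂ} {X : ℝ} (hX : 0 ≤ X)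
    (hg : IntervalIntegrable g volume 0 X)
    (h : ∀ x, 0 ≤ x → f x = f 0 + ∫ s in (0 : ℝ)..x, g s) :
    ∀ᵐ x, x ∈ uIcc 0 X → HasDerivAt f (g x) x := by
  have hne : ∀ᵐ x : ℝ, x ≠ 0 := by simp [ae_iff, measure_singleton]
  filter_upwards [hg.ae_hasDerivAt_integral, hne] with x hx hx0 hmem
  have h1 := (hx hmem 0 left_mem_uIcc).const_add (f 0)
  rw [uIcc_of_le hX] at hmem
  have hpos : 0 < x := lt_of_le_of_ne hmem.1 hx0.symm
  refine h1.congr_of_eventuallyEq ?_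
  filter_upwards [Ioi_mem_nhds hpos] with y hy using h y (le_of_lt hy)

lemma intervalIntegrable_of_continuousOn_Ici {f : ℝ → ℂ} (hf : ContinuousOn f (Ici 0)) {X : ℝ}
    (hX : 0 ≤ X) : IntervalIntegrable f volume 0 X :=
  (hf.mono (by rw [uIcc_of_le hX]; exact Icc_subset_Ici_self)).intervalIntegrable

lemma exists_bound_of_continuousOn_Ici {f : ℝ → ℂ} (hf : ContinuousOn f (Ici 0)) (X : ℝ) :
    ∃ B, 0 ≤ B ∧ ∀ s ∈ Icc 0 X, ‖f s‖ ≤ B := by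
  obtain ⟨B, hB⟩ := isCompact_Icc.exists_bound_of_continuousOn
    (hf.mono (Icc_subset_Ici_self : Icc 0 X ⊆ Ici 0))
  exact ⟨max B 0, le_max_right _ _, fun s hs => (hB s hs).trans (le_max_left _ _)⟩

lemma IsCompactPotential.norm_coefficient_le (hlam : 0 < lam) (hQ : IsCompactPotential Q a C)
    (z : ℂ) {s : ℝ} (hs : 0 ≤ s) :
    ‖((Q s + referencePotential lam s : ℝ) : ℂ) + z ^ 2‖ ≤ C + lam + ‖z‖ ^ 2 := by
  refine (norm_add_le _ _).trans ?_
  rw [Complex.norm_real, norm_pow]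
  gcongr
  refine (norm_add_le _ _).trans (add_le_add (hQ.abs_le s) ?_)
  rw [referencePotential, Real.norm_eq_abs, abs_mul, abs_neg, abs_of_pos hlam, Real.abs_exp]
  exact mul_le_of_le_one_right hlam.le (Real.exp_le_one_iff.2 (by linarith))

/-! ### Wronskian and uniqueness for the Cauchy problem. -/

namespace IsHalfLineSolution

lemma exists_bound_equation (hlam : 0 < lam) (hQ : IsCompactPotential Q a C)
    (h : IsHalfLineSolution lam Q z v v') {X : ℝ} (hX : 0 ≤ X) :
    IntervalIntegrable (fun s => (((Q s + referencePotential lam s : ℝ) : ℂ) + z ^ 2) * v s)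
      volume 0 X ∧ ∃ B, ∀ s ∈ Icc 0 X,
        ‖(((Q s + referencePotential lam s : ℝ) : ℂ) + z ^ 2) * v s‖ ≤ B := by
  refine ⟨?_, ?_⟩
  · refine IntervalIntegrable.mul_continuousOn ?_
      (h.continuousOn.mono (by rw [uIcc_of_le hX]; exact Icc_subset_Ici_self))
    have h1 : Continuous (referencePotential lam) := by unfold referencePotential; fun_prop
    have h2 : IntervalIntegrable (fun s => Q s + referencePotential lam s) volume 0 X :=
      hQ.integrable.intervalIntegrable.add (h1.intervalIntegrable _ _)
    exact IntervalIntegrable.add ⟨h2.1.ofReal, h2.2.ofReal⟩ intervalIntegrable_const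
  · obtain ⟨B, hB0, hB⟩ := exists_bound_of_continuousOn_Ici h.continuousOn X
    have hc := (norm_nonneg _).trans (hQ.norm_coefficient_le hlam z le_rfl)
    refine ⟨(C + lam + ‖z‖ ^ 2) * B, fun s hs => ?_⟩
    rw [norm_mul]
    exact mul_le_mul (hQ.norm_coefficient_le hlam z hs.1) (hB s hs) (norm_nonneg _) hc

lemma hasDerivAt (h : IsHalfLineSolution lam Q z v v') {x : ℝ} (hx : 0 < x) :
    HasDerivAt v (v' x) x := by
  have h1 := (intervalIntegral.integral_hasDerivAt_right
    (intervalIntegrable_of_continuousOn_Ici h.continuousOn_deriv hx.le)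
    ((h.continuousOn_deriv.mono Ioi_subset_Ici_self).stronglyMeasurableAtFilter isOpen_Ioi x hx)
    (h.continuousOn_deriv.continuousAt (Ici_mem_nhds hx))).const_add (v 0)
  refine h1.congr_of_eventuallyEq ?_
  filter_upwards [Ioi_mem_nhds hx] with y hy using h.eq_integral_deriv y (le_of_lt hy)

/-- The Wronskian of two solutions is constant. -/
lemma wronskian_eq (hlam : 0 < lam) (hQ : IsCompactPotential Q a C)
    (hu : IsHalfLineSolution lam Q z u u') (hv : IsHalfLineSolution lam Q z v v') {x : ℝ}
    (hx : 0 ≤ x) : u' x * v x - u x * v' x = u' 0 * v 0 - u 0 * v' 0 := by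
  obtain ⟨iu, Bu, hBu⟩ := hu.exists_bound_equation hlam hQ hx
  obtain ⟨iv, Bv, hBv⟩ := hv.exists_bound_equation hlam hQ hx
  obtain ⟨Du, _, hDu⟩ := exists_bound_of_continuousOn_Ici hu.continuousOn_deriv x
  obtain ⟨Dv, _, hDv⟩ := exists_bound_of_continuousOn_Ici hv.continuousOn_deriv x
  have iu1 := intervalIntegrable_of_continuousOn_Ici hu.continuousOn_deriv hx
  have iv1 := intervalIntegrable_of_continuousOn_Ici hv.continuousOn_deriv hx
  have au' := absolutelyContinuousOnInterval_of_eq_integral hx iu hBu hu.equation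
  have av' := absolutelyContinuousOnInterval_of_eq_integral hx iv hBv hv.equation
  have au := absolutelyContinuousOnInterval_of_eq_integral hx iu1 hDu hu.eq_integral_deriv
  have av := absolutelyContinuousOnInterval_of_eq_integral hx iv1 hDv hv.eq_integral_deriv
  -- The potential is merely bounded and measurable, so the Wronskian is differentiated almost
  -- everywhere; absolute continuity then makes it constant.
  obtain ⟨c, hc⟩ := ((au'.smul av).sub (au.smul av')).const_of_ae_hasDerivAt_zero (by
    filter_upwards [ae_hasDerivAt_of_eq_integral hx iu hu.equation,
      ae_hasDerivAt_of_eq_integral hx iv hv.equation,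
      ae_hasDerivAt_of_eq_integral hx iu1 hu.eq_integral_deriv,
      ae_hasDerivAt_of_eq_integral hx iv1 hv.eq_integral_deriv] with y h1 h2 h3 h4 hy
    have := ((h1 hy).mul (h4 hy)).sub ((h3 hy).mul (h2 hy))
    convert! this using 1
    ring)
  have e1 := hc x right_mem_uIcc
  have e2 := hc 0 left_mem_uIcc
  exact e1.trans e2.symm

/-- A solution with trivial Cauchy data at `0` vanishes. -/
lemma eq_zero (hlam : 0 < lam) (hQ : IsCompactPotential Q a C)
    (h : IsHalfLineSolution lam Q z v v') (h0 : v 0 = 0) (h0' : v' 0 = 0) {x : ℝ} (hx : 0 ≤ x) :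
    v x = 0 := by
  set M := C + lam + ‖z‖ ^ 2 with hM
  have hM0 : 0 ≤ M := (norm_nonneg _).trans (hQ.norm_coefficient_le hlam z le_rfl)
  -- Both integral equations bound $w$ by a constant times its own primitive; Grönwall's inequality
  -- applied to that primitive gives zero.
  set w : ℝ → ℝ := fun s => ‖v s‖ + ‖v' s‖ with hw
  have hwc : ContinuousOn w (Ici 0) := h.continuousOn.norm.add h.continuousOn_deriv.norm
  have hwi : ∀ y, 0 ≤ y → IntervalIntegrable w volume 0 y := fun y hy =>
    (hwc.mono (by rw [uIcc_of_le hy]; exact Icc_subset_Ici_self)).intervalIntegrable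
  have hw0 : ∀ s, 0 ≤ w s := fun s => by positivity
  have hbound : ∀ y, 0 ≤ y → w y ≤ (1 + M) * ∫ s in (0 : ℝ)..y, w s := by
    intro y hy
    have e1 : ‖v y‖ ≤ ∫ s in (0 : ℝ)..y, w s := by
      rw [h.eq_integral_deriv y hy, h0, zero_add]
      refine intervalIntegral.norm_integral_le_of_norm_le hy (Eventually.of_forall fun s _ => ?_)
        (hwi y hy)
      exact le_add_of_nonneg_left (norm_nonneg _)
    have e2 : ‖v' y‖ ≤ ∫ s in (0 : ℝ)..y, M * w s := by
      rw [h.equation y hy, h0', zero_add]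
      refine intervalIntegral.norm_integral_le_of_norm_le hy
        (Eventually.of_forall fun s hs => ?_) ((hwi y hy).const_mul M)
      rw [norm_mul]
      exact mul_le_mul (hQ.norm_coefficient_le hlam z hs.1.le)
        (le_add_of_nonneg_right (norm_nonneg _)) (norm_nonneg _) hM0
    rw [intervalIntegral.integral_const_mul] at e2
    calc w y ≤ _ := add_le_add e1 e2
      _ = _ := by ring
  have hy0 : ∀ y, 0 ≤ y → 0 ≤ ∫ s in (0 : ℝ)..y, w s := fun y hy =>
    intervalIntegral.integral_nonneg hy fun s _ => hw0 s
  have hcont : ContinuousOn (fun y => ∫ s in (0 : ℝ)..y, w s) (Icc 0 x) := by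
    have := intervalIntegral.continuousOn_primitive_interval' (hwi x hx) left_mem_uIcc
    rwa [uIcc_of_le hx] at this
  have hg := norm_le_gronwallBound_of_norm_deriv_right_le (f' := w) (δ := 0) (K := 1 + M)
    (ε := 0) hcont (fun y hy => ?_) (by simp) (fun y hy => ?_) x ⟨hx, le_rfl⟩
  · rw [gronwallBound_ε0_δ0, Real.norm_of_nonneg (hy0 x hx)] at hg
    have h1 := hbound x hx
    have h2 : w x ≤ 0 := h1.trans (mul_nonpos_of_nonneg_of_nonpos (by linarith) hg)
    have h3 : ‖v x‖ ≤ 0 := (le_add_of_nonneg_right (norm_nonneg (v' x))).trans h2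
    exact norm_le_zero_iff.1 h3
  · have hmem : Ici (0 : ℝ) ∈ 𝓝[Ici y] y :=
      mem_of_superset self_mem_nhdsWithin (Ici_subset_Ici.2 hy.1)
    refine intervalIntegral.integral_hasDerivWithinAt_right (hwi y hy.1) ?_
      ((hwc y hy.1).mono (Ioi_subset_Ici_self.trans (Ici_subset_Ici.2 hy.1))) (t := Ioi y)
    exact (hwc.mono (Ioi_subset_Ici_self.trans (Ici_subset_Ici.2 hy.1))).stronglyMeasurableAtFilter_nhdsWithin
      measurableSet_Ioi y
  · rw [Real.norm_of_nonneg (hw0 y), Real.norm_of_nonneg (hy0 y hy.1), add_zero]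
    exact hbound y hy.1

end IsHalfLineSolution

lemma memLp_of_norm_le_exp {f : ℝ → ℂ} {σ : ℝ} (hσ : 0 < σ) (hf : ContinuousOn f (Ici 0))
    (hb : ∃ c, 0 ≤ c ∧ ∀ x, 0 ≤ x → ‖f x‖ ≤ c * Real.exp (-σ * x)) :
    MemLp f 2 (volume.restrict (Ioi 0)) := by
  obtain ⟨c, hc, hb⟩ := hb
  have hm : AEStronglyMeasurable f (volume.restrict (Ioi 0)) :=
    (hf.mono Ioi_subset_Ici_self).aestronglyMeasurable measurableSet_Ioi
  rw [memLp_two_iff_integrable_sq_norm hm]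
  have hi : IntegrableOn (fun x => Real.exp ((-2 * σ) * x)) (Ioi 0) :=
    integrableOn_exp_mul_Ioi (by linarith) 0
  refine (hi.const_mul (c ^ 2)).mono' (hm.norm.pow 2) ?_
  filter_upwards [ae_restrict_mem measurableSet_Ioi] with x hx
  rw [Real.norm_of_nonneg (by positivity)]
  calc ‖f x‖ ^ 2 ≤ (c * Real.exp (-σ * x)) ^ 2 := by gcongr; exact hb x (le_of_lt hx)
    _ = _ := by rw [mul_pow, ← Real.exp_nat_mul]; push_cast; ring_nf

/-- Square-integrable solutions are unique up to a factor. -/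
lemma IsHalfLineSolution.wronskian_zero_eq_zero (hlam : 0 < lam) (hQ : IsCompactPotential Q a C)
    (hu : IsHalfLineSolution lam Q z u u') (hv : IsHalfLineSolution lam Q z v v')
    (hu2 : MemLp u 2 (volume.restrict (Ioi 0))) (hv2 : MemLp v 2 (volume.restrict (Ioi 0)))
    (hv2' : MemLp v' 2 (volume.restrict (Ioi 0))) : u' 0 * v 0 = u 0 * v' 0 := by
  set w := u' 0 * v 0 - u 0 * v' 0 with hw
  have h1 : IntegrableOn (fun x => u x * v x) (Ioi 0) := hu2.integrable_mul hv2
  have h2 : IntegrableOn (fun x => u x * v' x) (Ioi 0) := hu2.integrable_mul hv2'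
  have hii : ∀ x, 0 ≤ x → IntervalIntegrable (fun x => u x * v' x) volume 0 x := fun x hx =>
    intervalIntegrable_of_continuousOn_Ici (hu.continuousOn.mul hv.continuousOn_deriv) hx
  -- With constant Wronskian $w$, $(uv)'=w+2uv'$. As $uv'$ is integrable, $w\ne0$ would make $uv$
  -- grow linearly, although it is integrable. Only $v'$, not $u'$, has to be square-integrable.
  have hprod : ∀ x, 0 ≤ x → u x * v x
      = u 0 * v 0 + w * x + 2 * ∫ s in (0 : ℝ)..x, u s * v' s := by
    intro x hx
    have hFTC := intervalIntegral.integral_eq_sub_of_hasDerivAt_of_le (f := fun s => u s * v s)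
      (f' := fun s => u' s * v s + u s * v' s) hx
      ((hu.continuousOn.mul hv.continuousOn).mono Icc_subset_Ici_self)
      (fun y hy => (hu.hasDerivAt hy.1).mul (hv.hasDerivAt hy.1))
      (intervalIntegrable_of_continuousOn_Ici ((hu.continuousOn_deriv.mul hv.continuousOn).add
        (hu.continuousOn.mul hv.continuousOn_deriv)) hx)
    have hcongr : ∫ s in (0 : ℝ)..x, (u' s * v s + u s * v' s)
        = ∫ s in (0 : ℝ)..x, (w + 2 * (u s * v' s)) := by
      refine intervalIntegral.integral_congr fun s hs => ?_
      rw [uIcc_of_le hx] at hs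
      have := wronskian_eq hlam hQ hu hv hs.1
      rw [hw, ← this]; ring
    rw [hcongr, intervalIntegral.integral_add intervalIntegrable_const ((hii x hx).const_mul 2),
      intervalIntegral.integral_const_mul, intervalIntegral.integral_const] at hFTC
    simp only [sub_zero, Complex.real_smul] at hFTC
    linear_combination -hFTC
  set B := ∫ s in Ioi (0 : ℝ), ‖u s * v' s‖ with hB
  have hBx : ∀ x, 0 ≤ x → ‖∫ s in (0 : ℝ)..x, u s * v' s‖ ≤ B := by
    intro x hx
    refine (intervalIntegral.norm_integral_le_integral_norm hx).trans ?_
    rw [intervalIntegral.integral_of_le hx]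
    exact setIntegral_mono_set h2.norm (Eventually.of_forall fun _ => norm_nonneg _)
      Ioc_subset_Ioi_self.eventuallyLE
  by_contra hne
  have hw0 : 0 < ‖w‖ := norm_pos_iff.2 (sub_ne_zero.2 hne)
  set X := max 0 ((1 + ‖u 0 * v 0‖ + 2 * B) / ‖w‖) with hX
  have hlarge : ∀ x, X < x → 1 ≤ ‖u x * v x‖ := by
    intro x hx
    have hx0 : 0 ≤ x := (le_max_left _ _).trans hx.le
    have h3 : 1 + ‖u 0 * v 0‖ + 2 * B ≤ ‖w‖ * x := by
      have := (le_max_right 0 ((1 + ‖u 0 * v 0‖ + 2 * B) / ‖w‖)).trans hx.le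
      rwa [div_le_iff₀' hw0] at this
    have h4 : w * x = u x * v x - u 0 * v 0 - 2 * ∫ s in (0 : ℝ)..x, u s * v' s := by
      rw [hprod x hx0]; ring
    have h5 : ‖w‖ * x = ‖w * x‖ := by
      rw [norm_mul, Complex.norm_real, Real.norm_of_nonneg hx0]
    have h6 : ‖w * x‖ ≤ ‖u x * v x‖ + ‖u 0 * v 0‖ + 2 * B := by
      rw [h4]
      refine (norm_sub_le _ _).trans (add_le_add (norm_sub_le _ _) ?_)
      rw [norm_mul, Complex.norm_two]
      exact mul_le_mul_of_nonneg_left (hBx x hx0) zero_le_two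
    linarith
  have h7 : IntegrableOn (fun _ : ℝ => (1 : ℝ)) (Ioi X) := by
    refine (h1.mono_set (Ioi_subset_Ioi (le_max_left _ _))).norm.mono' (by fun_prop) ?_
    filter_upwards [ae_restrict_mem measurableSet_Ioi] with x hx
    rw [norm_one]; exact hlarge x hx
  rw [integrableOn_const_iff] at h7
  simp at h7

lemma isWeylSolution_jostSolution (hlam : 0 < lam) (hQ : IsCompactPotential Q a C)
    (hK : IsExtendedKernel lam Q a K) (hz : 0 < z.re) :
    IsWeylSolution lam Q z (jostSolution lam K z) (jostSolutionDeriv lam Q a K z) := by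
  have h := isHalfLineSolution_jostSolution hlam hQ hK z
  exact ⟨h.continuousOn, h.continuousOn_deriv, h.eq_integral_deriv, h.equation,
    memLp_of_norm_le_exp hz h.continuousOn (exists_norm_jostSolution_le hlam hQ hK z)⟩

/-- Vanishing Cauchy data would make the whole solution vanish. This excludes cancellation in
$\psi'(0,z)/\psi(0,z)$, so zeros of the denominator become poles of the same order. -/
lemma jostSolutionDeriv_ne_zero (hlam : 0 < lam) (hQ : IsCompactPotential Q a C)
    (hK : IsExtendedKernel lam Q a K) (h0 : jostSolution lam K z 0 = 0) :
    jostSolutionDeriv lam Q a K z 0 ≠ 0 := by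
  intro hderiv
  obtain ⟨x, hx, hne⟩ := exists_jostSolution_ne_zero hQ hK z
  exact hne ((isHalfLineSolution_jostSolution hlam hQ hK z).eq_zero hlam hQ h0 hderiv hx)

/-- The Weyl-Titchmarsh function is the logarithmic derivative of the perturbed solution. -/
lemma isWeylTitchmarshValue_iff (hlam : 0 < lam) (hQ : IsCompactPotential Q a C)
    (hK : IsExtendedKernel lam Q a K) (hz : 0 < z.re) (w : ℂ) :
    IsWeylTitchmarshValue lam Q z w ↔ jostSolution lam K z 0 ≠ 0 ∧
      w = jostSolutionDeriv lam Q a K z 0 / jostSolution lam K z 0 := by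
  have hψ := isWeylSolution_jostSolution hlam hQ hK hz
  constructor
  · rintro ⟨v, v', hv, hv0, rfl⟩
    have h := isHalfLineSolution_jostSolution hlam hQ hK z
    have hW := IsHalfLineSolution.wronskian_zero_eq_zero hlam hQ
      (⟨hv.continuousOn, hv.continuousOn_deriv, hv.eq_integral_deriv, hv.equation⟩ :
        IsHalfLineSolution lam Q z v v') h hv.memLp hψ.memLp
      (memLp_of_norm_le_exp hz h.continuousOn_deriv (exists_norm_jostSolutionDeriv_le hlam hQ hK z))
    -- If $\psi(0)=0$, the vanishing Wronskian gives $v(0)\psi'(0)=0$, although neither factor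
    -- vanishes.
    have hne : jostSolution lam K z 0 ≠ 0 := by
      intro h0
      rw [h0, mul_zero] at hW
      exact mul_ne_zero hv0 (jostSolutionDeriv_ne_zero hlam hQ hK h0) hW.symm
    exact ⟨hne, by rw [div_eq_div_iff hv0 hne, hW, mul_comm]⟩
  · rintro ⟨hne, rfl⟩
    exact ⟨_, _, hψ, hne, rfl⟩

lemma exists_jostFunction_ne_zero (hK : IsExtendedKernel lam Q a K) :
    ∃ z, jostSolution lam K z 0 ≠ 0 := by
  obtain ⟨x, hx⟩ := ((tendsto_Gamma_mul_jostSolution hK).eventually_ne one_ne_zero).exists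
  exact ⟨x, right_ne_zero_of_mul hx⟩

lemma analyticOrderAt_jostFunction_ne_top (hK : IsExtendedKernel lam Q a K) (z : ℂ) :
    analyticOrderAt (fun z => jostSolution lam K z 0) z ≠ ⊤ := by
  rw [Ne, analyticOrderAt_eq_top]
  intro h
  obtain ⟨w, hw⟩ := exists_jostFunction_ne_zero hK
  have := AnalyticOnNhd.eq_of_eventuallyEq
    (fun w _ => (differentiable_jostSolution hK).analyticAt w) (analyticOnNhd_const (v := (0 : ℂ))) (z₀ := z) h
  exact hw (congrFun this w)

/-- Two meromorphic functions on `ℂ` which agree near one point agree near every point. -/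
lemma eventuallyEq_of_meromorphicOn_univ {f g : ℂ → ℂ} (hf : MeromorphicOn f univ)
    (hg : MeromorphicOn g univ) {z₀ : ℂ} (h : f =ᶠ[𝓝[≠] z₀] g) (z : ℂ) : f =ᶠ[𝓝[≠] z] g := by
  have h0 : meromorphicOrderAt (f - g) z₀ = ⊤ := by
    rw [meromorphicOrderAt_eq_top_iff]
    filter_upwards [h] with w hw
    simp [hw]
  have h1 : meromorphicOrderAt (f - g) z = ⊤ := by
    by_contra hne
    exact (hf.sub hg).meromorphicOrderAt_ne_top_of_isPreconnected isPreconnected_univ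
      (mem_univ z) (mem_univ z₀) hne h0
  rw [meromorphicOrderAt_eq_top_iff] at h1
  filter_upwards [h1] with w hw
  exact sub_eq_zero.1 hw

lemma isMeromorphicExtension_jostSolution (hlam : 0 < lam) (hQ : IsCompactPotential Q a C)
    (hK : IsExtendedKernel lam Q a K) : IsMeromorphicExtension lam Q
      ((fun z => jostSolutionDeriv lam Q a K z 0) / fun z => jostSolution lam K z 0) := by
  refine ⟨fun z _ => ?_, fun z hz w hw => ?_⟩
  · exact ((differentiable_jostSolutionDeriv hlam hQ hK).analyticAt z).meromorphicAt.div
      ((differentiable_jostSolution hK).analyticAt z).meromorphicAt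
  · exact (((isWeylTitchmarshValue_iff hlam hQ hK hz w).1 hw).2).symm

/-- An extension is prescribed only where a Weyl–Titchmarsh value exists. Near $1$ the zeros of the
Jost function are isolated, which gives agreement on a punctured neighbourhood, and the identity
theorem spreads it. Pole orders thus do not depend on the chosen extension. -/
lemma IsMeromorphicExtension.eventuallyEq (hlam : 0 < lam) (hQ : IsCompactPotential Q a C)
    (hK : IsExtendedKernel lam Q a K) {m : ℂ → ℂ} (hm : IsMeromorphicExtension lam Q m) (z : ℂ) :
    m =ᶠ[𝓝[≠] z]
      (fun z => jostSolutionDeriv lam Q a K z 0) / fun z => jostSolution lam K z 0 := by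
  refine eventuallyEq_of_meromorphicOn_univ hm.1
    (isMeromorphicExtension_jostSolution hlam hQ hK).1 (z₀ := 1) ?_ z
  have hne := ((differentiable_jostSolution hK).analyticAt 1).eventually_eq_zero_or_eventually_ne_zero
    |>.resolve_left fun h => analyticOrderAt_jostFunction_ne_top hK 1 (analyticOrderAt_eq_top.2 h)
  have hre : ∀ᶠ w : ℂ in 𝓝[≠] 1, 0 < w.re :=
    nhdsWithin_le_nhds ((isOpen_lt continuous_const Complex.continuous_re).mem_nhds (by simp))
  filter_upwards [hne, hre] with w hw hwre
  exact hm.2 w hwre _ ((isWeylTitchmarshValue_iff hlam hQ hK hwre _).2 ⟨hw, rfl⟩)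

lemma zero_sub_order_eq_neg_iff (n k : ℕ) :
    ENat.map (Nat.cast : ℕ → ℤ) 0 - ENat.map (Nat.cast : ℕ → ℤ) n = ((-(k : ℤ) : ℤ) : WithTop ℤ)
      ↔ (n : ℕ∞) = k := by
  have h : ENat.map (Nat.cast : ℕ → ℤ) 0 - ENat.map (Nat.cast : ℕ → ℤ) n
      = (((0 : ℤ) - (n : ℤ) : ℤ) : WithTop ℤ) := rfl
  rw [h, WithTop.coe_inj, zero_sub, neg_inj, Nat.cast_inj, Nat.cast_inj]

lemma order_sub_zero_ne_neg (m : ℕ∞) {k : ℕ} (hk : 1 ≤ k) :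
    ENat.map (Nat.cast : ℕ → ℤ) m - ENat.map (Nat.cast : ℕ → ℤ) 0
      ≠ ((-(k : ℤ) : ℤ) : WithTop ℤ) := by
  induction m using ENat.recTopCoe with
  | top => exact WithTop.top_ne_coe
  | coe m =>
    have h : ENat.map (Nat.cast : ℕ → ℤ) m - ENat.map (Nat.cast : ℕ → ℤ) 0
        = (((m : ℤ) - 0 : ℤ) : WithTop ℤ) := rfl
    rw [h, Ne, WithTop.coe_inj]
    omega

/-- The Regge poles are the zeros of the Jost function, with multiplicities. -/
lemma isReggePole_iff (hlam : 0 < lam) (hQ : IsCompactPotential Q a C)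
    (hK : IsExtendedKernel lam Q a K) (z : ℂ) (k : ℕ) : IsReggePole lam Q z k ↔
      1 ≤ k ∧ analyticOrderAt (fun z => jostSolution lam K z 0) z = k := by
  have hm := isMeromorphicExtension_jostSolution hlam hQ hK
  have hA := (differentiable_jostSolution hK).analyticAt z
  have hA' := (differentiable_jostSolutionDeriv hlam hQ hK).analyticAt z
  have hexists : IsReggePole lam Q z k ↔ 1 ≤ k ∧ meromorphicOrderAt
      ((fun z => jostSolutionDeriv lam Q a K z 0) / fun z => jostSolution lam K z 0) z
        = ((-(k : ℤ) : ℤ) : WithTop ℤ) := by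
    refine and_congr_right fun _ => ⟨?_, fun h => ⟨_, hm, h⟩⟩
    rintro ⟨m, hm', h⟩
    rwa [← meromorphicOrderAt_congr (hm'.eventuallyEq hlam hQ hK z)]
  rw [hexists]
  refine and_congr_right fun hk => ?_
  rw [meromorphicOrderAt_div hA'.meromorphicAt hA.meromorphicAt, hA.meromorphicOrderAt_eq,
    hA'.meromorphicOrderAt_eq]
  obtain ⟨n, hn⟩ := ENat.ne_top_iff_exists.1 (analyticOrderAt_jostFunction_ne_top hK z)
  rw [← hn]
  by_cases h0 : jostSolution lam K z 0 = 0
  · rw [hA'.analyticOrderAt_eq_zero.2 (jostSolutionDeriv_ne_zero hlam hQ hK h0)]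
    exact zero_sub_order_eq_neg_iff n k
  · rw [hA.analyticOrderAt_eq_zero.2 h0] at hn
    have hk' : k ≠ 0 := by omega
    rw [hn]
    exact iff_of_false (order_sub_zero_ne_neg _ hk) (by exact_mod_cast hk'.symm)

end WeylTheory

/-! ### Potentials of warped balls -/

section WarpedPotential

/-! ### Only the values of the potential on $(0,\infty)$ matter. -/

section Congruence

variable {lam : ℝ} {Q₁ Q₂ : ℝ → ℝ}

/-- The integral equation evaluates $Q$ at positive points only. Equality of the predicates
themselves is needed so that `Classical.epsilon` selects the same kernel for both potentials. -/
lemma isTransformationKernel_congr (h : EqOn Q₁ Q₂ (Ioi 0)) :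
    IsTransformationKernel lam Q₁ = IsTransformationKernel lam Q₂ := by
  have key : ∀ (K : ℝ → ℝ → ℝ) (x t : ℝ), 0 ≤ x → x ≤ t →
      kernelMap lam Q₁ K x t = kernelMap lam Q₂ K x t := by
    intro K x t hx hxt
    unfold kernelMap
    congr 1
    · congr 1
      refine setIntegral_congr_fun measurableSet_Ioi fun s hs => h ?_
      have hs' : (t + x) / 2 < s := hs
      exact lt_of_le_of_lt (by linarith) hs'
    · refine setIntegral_congr_fun measurableSet_Ioi fun α hα => ?_
      have hα' : (t + x) / 2 < α := hα
      refine intervalIntegral.integral_congr fun β hβ => ?_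
      rw [uIcc_of_le (by linarith)] at hβ
      have : Q₁ (α - β) = Q₂ (α - β) := h (show 0 < α - β by linarith [hβ.2])
      simp only [this]
  funext K
  refine propext ⟨fun hK => ⟨hK.continuousOn, hK.support, fun x t hx hxt => ?_⟩,
    fun hK => ⟨hK.continuousOn, hK.support, fun x t hx hxt => ?_⟩⟩
  · rw [← key K x t hx hxt]; exact hK.fixed_point x t hx hxt
  · rw [key K x t hx hxt]; exact hK.fixed_point x t hx hxt

lemma modifiedJostFunction_congr (h : EqOn Q₁ Q₂ (Ioi 0)) (z : ℂ) :
    modifiedJostFunction lam Q₁ z = modifiedJostFunction lam Q₂ z := by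
  unfold modifiedJostFunction modifiedJostSolution transformationKernel
  rw [isTransformationKernel_congr h]

lemma isWeylSolution_congr (h : EqOn Q₁ Q₂ (Ioi 0)) (z : ℂ) (v v' : ℝ → ℂ) :
    IsWeylSolution lam Q₁ z v v' ↔ IsWeylSolution lam Q₂ z v v' := by
  have key : ∀ x : ℝ, 0 ≤ x →
      ∫ s in (0 : ℝ)..x, (((Q₁ s + referencePotential lam s : ℝ) : ℂ) + z ^ 2) * v s
        = ∫ s in (0 : ℝ)..x, (((Q₂ s + referencePotential lam s : ℝ) : ℂ) + z ^ 2) * v s := by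
    intro x hx
    refine intervalIntegral.integral_congr_ae (Eventually.of_forall fun s hs => ?_)
    rw [uIoc_of_le hx] at hs
    rw [h hs.1]
  refine ⟨fun hv => ⟨hv.1, hv.2, hv.3, fun x hx => ?_, hv.5⟩,
    fun hv => ⟨hv.1, hv.2, hv.3, fun x hx => ?_, hv.5⟩⟩
  · rw [← key x hx]; exact hv.equation x hx
  · rw [key x hx]; exact hv.equation x hx

lemma isReggePole_congr (h : EqOn Q₁ Q₂ (Ioi 0)) (z : ℂ) (k : ℕ) :
    IsReggePole lam Q₁ z k ↔ IsReggePole lam Q₂ z k := by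
  simp only [IsReggePole, IsMeromorphicExtension, IsWeylTitchmarshValue, isWeylSolution_congr h]

end Congruence

/-! ### Boundedness, measurability and support of the potential $Q_f$. -/

namespace IsWarpingFunction

variable {f : ℝ → ℝ}

lemma eq_add (f : ℝ → ℝ) : f = fun x => perturbation f x + Real.exp (-x) := by
  funext x; simp [perturbation]

lemma contDiffOn_self (hf : IsWarpingFunction f) : ContDiffOn ℝ 1 f (Ici 0) := by
  rw [eq_add f]
  exact hf.contDiffOn.add (by fun_prop : ContDiff ℝ 1 fun x : ℝ => Real.exp (-x)).contDiffOn

/-- The derivative of the warping function, up to the boundary point `0`. -/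
lemma hasDerivAt_self (hf : IsWarpingFunction f) {x : ℝ} (hx : 0 < x) :
    HasDerivAt f (derivWithin (perturbation f) (Ici 0) x - Real.exp (-x)) x := by
  have h1 : HasDerivAt (perturbation f) (derivWithin (perturbation f) (Ici 0) x) x :=
    (((hf.contDiffOn.differentiableOn one_ne_zero) x hx.le).hasDerivWithinAt).hasDerivAt
      (Ici_mem_nhds hx)
  have h2 : HasDerivAt (fun x : ℝ => Real.exp (-x)) (-Real.exp (-x)) x := by
    simpa using (hasDerivAt_neg x).exp
  have h3 := h1.add h2
  rw [← sub_eq_add_neg] at h3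
  convert! h3 using 1
  exact eq_add f

/-- The derivative $pf^{p-1}f'$ is a product of bounded Lipschitz functions on $[0,X]$, hence
Lipschitz, and this bounds its `deriv` at every interior point; where it is not differentiable,
`deriv` is $0$. -/
lemma exists_bound_deriv_deriv (hf : IsWarpingFunction f) (p X : ℝ) :
    ∃ B, 0 ≤ B ∧ ∀ x, 0 < x → x < X → |deriv (deriv fun y => f y ^ p) x| ≤ B := by
  set g : ℝ → ℝ := fun x => derivWithin (perturbation f) (Ici 0) x - Real.exp (-x) with hg
  have hpos : ∀ x ∈ Icc 0 X, f x ≠ 0 := fun x hx => (hf.pos x hx.1).ne'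
  have hr : ContDiffOn ℝ 1 (fun x => p * f x ^ (p - 1)) (Icc 0 X) :=
    contDiffOn_const.mul
      ((hf.contDiffOn_self.mono Icc_subset_Ici_self).rpow_const_of_ne hpos)
  have he : ContDiffOn ℝ 1 (fun x : ℝ => Real.exp (-x)) (Icc 0 X) :=
    (by fun_prop : ContDiff ℝ 1 fun x : ℝ => Real.exp (-x)).contDiffOn
  obtain ⟨L₁, hL₁⟩ := hr.exists_lipschitzOnWith one_ne_zero (convex_Icc _ _) isCompact_Icc
  obtain ⟨L₂, hL₂⟩ := he.exists_lipschitzOnWith one_ne_zero (convex_Icc _ _) isCompact_Icc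
  obtain ⟨L₃, hL₃⟩ := hf.lipschitz_deriv
  have hgL : LipschitzOnWith (L₃ + L₂) g (Icc 0 X) := (hL₃.mono Icc_subset_Ici_self).sub hL₂
  obtain ⟨B₁, hB₁⟩ := isCompact_Icc.exists_bound_of_continuousOn hr.continuousOn
  obtain ⟨B₂, hB₂⟩ := isCompact_Icc.exists_bound_of_continuousOn hgL.continuousOn
  refine ⟨|L₁ * B₂ + B₁ * (L₃ + L₂)|, abs_nonneg _, fun x hx hxX => ?_⟩
  have hev : deriv (fun y => f y ^ p) =ᶠ[𝓝 x] fun y => (p * f y ^ (p - 1)) * g y := by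
    filter_upwards [Ioi_mem_nhds hx] with y hy
    rw [((hf.hasDerivAt_self hy).rpow_const (Or.inl (hf.pos y (le_of_lt hy)).ne')).deriv]
    ring
  rw [hev.deriv_eq, ← Real.norm_eq_abs]
  refine norm_deriv_le_of_lip' (abs_nonneg _) ?_
  have hxm : x ∈ Icc 0 X := ⟨hx.le, hxX.le⟩
  filter_upwards [Icc_mem_nhds hx hxX] with y hy
  have h1 := hL₁.norm_sub_le hy hxm
  have h2 := hgL.norm_sub_le hy hxm
  push_cast at h2
  have h3 : p * f y ^ (p - 1) * g y - p * f x ^ (p - 1) * g x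
      = (p * f y ^ (p - 1) - p * f x ^ (p - 1)) * g y + p * f x ^ (p - 1) * (g y - g x) := by ring
  rw [h3]
  refine (norm_add_le _ _).trans ?_
  rw [norm_mul, norm_mul]
  have hB1 := (norm_nonneg _).trans (hB₁ x hxm)
  calc _ ≤ L₁ * ‖y - x‖ * B₂ + B₁ * ((L₃ + L₂) * ‖y - x‖) :=
        add_le_add (mul_le_mul h1 (hB₂ y hy) (norm_nonneg _) (by positivity))
          (mul_le_mul (hB₁ x hxm) h2 (norm_nonneg _) hB1)
    _ = (L₁ * B₂ + B₁ * (L₃ + L₂)) * ‖y - x‖ := by ring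
    _ ≤ _ := by gcongr; exact le_abs_self _

/-- For $f=e^{-x}$ the conformal term is $(n/2-1)^2=(n-2)^2/4$, and the remaining terms cancel or
vanish. The inequality is strict because the second derivative needs a full neighbourhood. -/
lemma warpedPotential_eq_zero {a : ℝ} (n : ℕ) (lam : ℝ)
    (ha : ∀ x, a ≤ x → perturbation f x = 0) {x : ℝ} (hx : a < x) :
    warpedPotential n lam f x = 0 := by
  set p : ℝ := (n : ℝ) / 2 - 1 with hp
  have hfe : ∀ y, a ≤ y → f y = Real.exp (-y) := fun y hy => sub_eq_zero.1 (ha y hy)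
  have hev : (fun y => f y ^ p) =ᶠ[𝓝 x] fun y => Real.exp (-p * y) := by
    filter_upwards [Ioi_mem_nhds hx] with y hy
    rw [hfe y (le_of_lt hy), ← Real.exp_mul]
    ring_nf
  have hd : ∀ c : ℝ, deriv (fun y => c * Real.exp (-p * y)) = fun y => (-p * c) * Real.exp (-p * y) := by
    intro c
    funext y
    have h1 : HasDerivAt (fun y => -p * y) (-p) y := by
      simpa using (hasDerivAt_id y).const_mul (-p)
    rw [(h1.exp.const_mul c).deriv]
    ring
  have hd1 : deriv (fun y => Real.exp (-p * y)) = fun y => -p * Real.exp (-p * y) := by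
    simpa using hd 1
  have h2 : deriv (deriv fun y => f y ^ p) x = p ^ 2 * Real.exp (-p * x) := by
    rw [hev.deriv.deriv_eq, hd1, hd]
    ring
  have h3 : f x ^ p = Real.exp (-p * x) := hev.eq_of_nhds
  rw [warpedPotential, conformalPotential, ← hp, h2, h3, hfe x hx.le,
    mul_div_cancel_right₀ _ (Real.exp_pos _).ne', hp]
  ring

/-- The potential of a warped ball is bounded, measurable and compactly supported. -/
lemma exists_isCompactPotential (hf : IsWarpingFunction f) (n : ℕ) (lam : ℝ) :
    ∃ a C, IsCompactPotential ((Ioi 0).indicator (warpedPotential n lam f)) a C := by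
  obtain ⟨a, ha0, ha⟩ := hf.compact_support
  set p : ℝ := (n : ℝ) / 2 - 1 with hp
  have hc := hf.contDiffOn_self.continuousOn
  have hc' : ContinuousOn f (Icc 0 (a + 1)) := hc.mono Icc_subset_Ici_self
  obtain ⟨B, hB0, hB⟩ := hf.exists_bound_deriv_deriv p (a + 1)
  have hcp : ContinuousOn (fun x => f x ^ p) (Icc 0 (a + 1)) :=
    hc'.rpow_const fun x hx => Or.inl (hf.pos x hx.1).ne'
  have hci : ContinuousOn (fun x => (f x ^ p)⁻¹) (Icc 0 (a + 1)) :=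
    hcp.inv₀ fun x hx => (Real.rpow_pos_of_pos (hf.pos x hx.1) p).ne'
  obtain ⟨D, hD⟩ := isCompact_Icc.exists_bound_of_continuousOn hci
  have hce : ContinuousOn (fun x => lam * (f x - Real.exp (-x)) * (f x + Real.exp (-x)))
      (Icc 0 (a + 1)) := by fun_prop
  obtain ⟨E, hE⟩ := isCompact_Icc.exists_bound_of_continuousOn hce
  refine ⟨a + 1, |B * D + ((n : ℝ) - 2) ^ 2 / 4 + E|, ?_, by linarith, abs_nonneg _, fun x => ?_,
    fun x hx => indicator_of_notMem (by simpa using hx) _, fun x hx => ?_⟩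
  -- Nothing is known about $f$ at negative arguments; replacing $f(x)$ by $f(\max(x,0))$ makes it
  -- continuous without changing the indicator, and `deriv` is measurable in any case.
  · have hF : Continuous fun x => f (max x 0) :=
      continuousOn_univ.1 (hc.comp (by fun_prop) fun x _ => le_max_right x 0)
    have hm : Measurable fun x => deriv (deriv fun y => f y ^ p) x / f (max x 0) ^ p
        - ((n : ℝ) - 2) ^ 2 / 4
        - lam * (f (max x 0) - Real.exp (-x)) * (f (max x 0) + Real.exp (-x)) := by
      have h1 := measurable_deriv (deriv fun y => f y ^ p)
      have h2 := hF.measurable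
      have h3 : Measurable fun x => f (max x 0) ^ p := h2.pow_const p
      have h4 : Measurable fun x : ℝ => Real.exp (-x) := by fun_prop
      exact ((h1.div h3).sub_const _).sub (((h2.sub h4).const_mul lam).mul (h2.add h4))
    convert hm.indicator measurableSet_Ioi using 1
    refine indicator_congr fun x hx => ?_
    have hx' : max x 0 = x := max_eq_left (le_of_lt hx)
    rw [warpedPotential, conformalPotential, hx']
  · by_cases hx : x ∈ Ioi (0 : ℝ)
    swap
    · rw [indicator_of_notMem hx, abs_zero]; exact abs_nonneg _
    have hx0 : 0 < x := hx
    rw [indicator_of_mem hx]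
    rcases le_or_gt (a + 1) x with h | h
    · rw [warpedPotential_eq_zero n lam ha (by linarith), abs_zero]; exact abs_nonneg _
    · have hxm : x ∈ Icc 0 (a + 1) := ⟨hx0.le, h.le⟩
      have e1 : |conformalPotential n f x| ≤ B * D := by
        rw [conformalPotential, ← hp, div_eq_mul_inv, abs_mul]
        exact mul_le_mul (hB x hx0 h) (hD x hxm) (abs_nonneg _) hB0
      have e2 := hE x hxm
      rw [Real.norm_eq_abs] at e2
      have e3 : 0 ≤ ((n : ℝ) - 2) ^ 2 / 4 := by positivity
      rw [warpedPotential]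
      refine (abs_sub _ _).trans ((add_le_add ((abs_sub _ _).trans
        (add_le_add e1 (abs_of_nonneg e3).le)) e2).trans (le_abs_self _))
  · rw [indicator_of_mem (show x ∈ Ioi (0 : ℝ) by rw [mem_Ioi]; linarith), warpedPotential_eq_zero n lam ha (by linarith)]

end IsWarpingFunction

/-- The modified Jost function in terms of an extended kernel, and the description of the
Regge poles as its zeros. -/
lemma IsCompactPotential.exists_jostFunction {lam : ℝ} (hlam : 0 < lam) {Q : ℝ → ℝ} {a C : ℝ}
    (hQ : IsCompactPotential Q a C) : ∃ b K, IsCompactPotential Q b C ∧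
      IsExtendedKernel lam Q b K ∧ ∀ z, modifiedJostFunction lam Q z = jostSolution lam K z 0 := by
  have hK₀ : IsTransformationKernel lam Q (transformationKernel lam Q) :=
    Classical.epsilon_spec (exists_isTransformationKernel hlam hQ)
  obtain ⟨b, K, hQ', hK, hKK⟩ := hK₀.exists_isExtendedKernel hQ
  refine ⟨b, K, hQ', hK, fun z => ?_⟩
  rw [modifiedJostFunction, modifiedJostSolution, besselJ_eq_besselSeries hlam, jostSolution]
  congr 1
  refine setIntegral_congr_fun measurableSet_Ioi fun t ht => ?_
  rw [besselJ_eq_besselSeries hlam, hKK 0 t le_rfl (le_of_lt ht)]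
  rfl

/-- The Regge poles of compactly supported potentials determine the modified Jost function. -/
lemma modifiedJostFunction_eq_of_isReggePole_iff {lam : ℝ} (hlam : 0 < lam) {Q₁ Q₂ : ℝ → ℝ}
    {a₁ a₂ C₁ C₂ : ℝ} (hQ₁ : IsCompactPotential Q₁ a₁ C₁) (hQ₂ : IsCompactPotential Q₂ a₂ C₂)
    (hpoles : ∀ z k, IsReggePole lam Q₁ z k ↔ IsReggePole lam Q₂ z k) (z : ℂ) :
    modifiedJostFunction lam Q₁ z = modifiedJostFunction lam Q₂ z := by
  obtain ⟨b₁, K₁, hQ₁, hK₁, hJ₁⟩ := hQ₁.exists_jostFunction hlam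
  obtain ⟨b₂, K₂, hQ₂, hK₂, hJ₂⟩ := hQ₂.exists_jostFunction hlam
  rw [hJ₁, hJ₂]
  refine eq_of_same_zeros (f₁ := fun z => jostSolution lam K₁ z 0)
    (f₂ := fun z => jostSolution lam K₂ z 0) (differentiable_jostSolution hK₁)
    (differentiable_jostSolution hK₂) (hasGrowth_jostSolution hK₁ hQ₁.a_pos)
    (hasGrowth_jostSolution hK₂ hQ₂.a_pos) (fun w => ?_) ?_ z
  · obtain ⟨m₁, hm₁⟩ := ENat.ne_top_iff_exists.1 (analyticOrderAt_jostFunction_ne_top hK₁ w)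
    obtain ⟨m₂, hm₂⟩ := ENat.ne_top_iff_exists.1 (analyticOrderAt_jostFunction_ne_top hK₂ w)
    -- The hypothesis sees only positive orders; order $0$ for one function then follows for the
    -- other by exclusion.
    have h : ∀ k, 1 ≤ k ∧ m₁ = k ↔ 1 ≤ k ∧ m₂ = k := by
      intro k
      have := hpoles w k
      rwa [isReggePole_iff hlam hQ₁ hK₁, isReggePole_iff hlam hQ₂ hK₂, ← hm₁, ← hm₂,
        Nat.cast_inj, Nat.cast_inj] at this
    rw [← hm₁, ← hm₂, Nat.cast_inj]
    have h1 := h m₁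
    have h2 := h m₂
    omega
  · have h := (tendsto_Gamma_mul_jostSolution hK₁).div (tendsto_Gamma_mul_jostSolution hK₂)
      one_ne_zero
    rw [div_one] at h
    refine h.congr' ?_
    filter_upwards [eventually_gt_atTop 0] with x hx
    refine mul_div_mul_left _ _ (mul_ne_zero (Complex.Gamma_ne_zero_of_re_pos ?_)
      (Complex.exp_ne_zero _))
    simp only [Complex.add_re, Complex.ofReal_re, Complex.one_re]
    linarith

end WarpedPotential

end ReggePoles

end

theorem proposition3p3 (lam : ℝ) (hlam : 0 < lam)
    (n₁ n₂ : ℕ) (hn₁ : 2 ≤ n₁) (hn₂ : 2 ≤ n₂) (f₁ f₂ : ℝ → ℝ)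
    (hf₁ : ReggePoles.IsWarpingFunction f₁) (hf₂ : ReggePoles.IsWarpingFunction f₂)
    (hpoles : ∀ (z : ℂ) (k : ℕ),
      ReggePoles.IsReggePole lam (ReggePoles.warpedPotential n₁ lam f₁) z k ↔
        ReggePoles.IsReggePole lam (ReggePoles.warpedPotential n₂ lam f₂) z k) :
    ∀ z : ℂ,
      ReggePoles.modifiedJostFunction lam (ReggePoles.warpedPotential n₁ lam f₁) z =
        ReggePoles.modifiedJostFunction lam (ReggePoles.warpedPotential n₂ lam f₂) z := by
  intro z
  obtain ⟨a₁, C₁, hQ₁⟩ := hf₁.exists_isCompactPotential n₁ lam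
  obtain ⟨a₂, C₂, hQ₂⟩ := hf₂.exists_isCompactPotential n₂ lam
  -- The values of the potential at $x\le0$ are uncontrolled; cutting them off changes neither the
  -- Regge poles nor the Jost function.
  have h₁ : EqOn (ReggePoles.warpedPotential n₁ lam f₁) ((Ioi 0).indicator (ReggePoles.warpedPotential n₁ lam f₁))
    (Ioi 0) := fun x hx => (indicator_of_mem hx _).symm
  have h₂ : EqOn (ReggePoles.warpedPotential n₂ lam f₂) ((Ioi 0).indicator (ReggePoles.warpedPotential n₂ lam f₂))
    (Ioi 0) := fun x hx => (indicator_of_mem hx _).symm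
  rw [ReggePoles.modifiedJostFunction_congr h₁, ReggePoles.modifiedJostFunction_congr h₂]
  refine ReggePoles.modifiedJostFunction_eq_of_isReggePole_iff hlam hQ₁ hQ₂ (fun w k => ?_) z
  rw [← ReggePoles.isReggePole_congr h₁, ← ReggePoles.isReggePole_congr h₂]
  exact hpoles w k
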